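/- **Theorem A.** Fix an enumeration $(q_n)_{n\ge 1}$ of $\mathbb{Q}\cap(0,1)$. Let $\Delta$ be the set of nonincreasing sequences $\gamma=(\gamma_i)_{i\ge 1}$ of positive reals with $\gamma_i<2^{-(i+1)}$ for all $i$ and $q_1+\gamma_1<1$. For $\gamma\in\Delta$ put inductively $G_i^\gamma=(q_{n_i},q_{n_i}+\gamma_i)$, where $n_i$ is the least $n$ with $(q_n,q_n+\gamma_i)\subset(0,1)\setminus\bigcup_{j<i}G_j^\gamma$ (so $n_1=1$), and $T_\gamma=[0,1]\setminus\bigcup_i G_i^\gamma$. For $0<a\le 1$ let $T_\gamma(1,a)$ be the set $T_\gamma$ with the metric $d(x,y)=\min\{|x-y|,\;x+(1-y)+a,\;y+(1-x)+a\}$. *Attachment.* If $M$ and $N_\gamma$ ($\gamma\in\Gamma$) are pairwise disjoint complete metric spaces, and $\Phi_\gamma$ maps a compact set $S_\gamma\subset N_\gamma$ isometrically into $M$, the attachment of $M$ with the $N_\gamma$ along the $S_\gamma$ is $M\cup\bigcup_\gamma (N_\gamma\setminus S_\gamma)$, with the given metrics on $M$ and on each $N_\gamma\setminus S_\gamma$,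 with $d(p,z)=\min_{x\in S_\gamma}(d(p,x)+d(\Phi_\gamma(x),z))$ for $p\in N_\gamma\setminus S_\gamma$, $z\in M$, and with $d(p,z)=\min_{x\in S_\gamma,\,y\in S_\eta}(d(p,x)+d(\Phi_\gamma(x),\Phi_\eta(y))+d(y,z))$ for $p\in N_\gamma\setminus S_\gamma$, $z\in N_\eta\setminus S_\eta$, $\gamma\ne\eta$. *Threading space.* For two points $A,B$ at distance $a\in(0,1]$, the threading space $\mathrm{Th}(A,B)$ anchored at $A,B$ is the attachment of $\{A,B\}$ with the spaces $T_\gamma(1,a)$, $\gamma\in\Delta$, the point $0$ of each being glued to $A$ and the point $1$ to $B$. *Skein spaces.* $\mathrm{Sk}(0)$ consists of two points at distance $1/2$. For a limit ordinal $\beta$, $\mathrm{Sk}(\beta)$ is the completion of $\bigcup_{\alpha<\beta}\mathrm{Sk}(\alpha)$. Finally, $\mathrm{Sk}(\lambda+1)$ is the attachment of $\mathrm{Sk}(\lambda)$ with one threading space anchored at $p$ and $q$ (with either choice of which anchor is $A$ and which is $B$) for every pair $\{p,q\}\subset\mathrm{Sk}(\lambda)$ such that $q\notin\bigcup_{\alpha<\lambda}\mathrm{Sk}(\alpha)$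 and $0<d(p,q)\le 1/2$; the threading spaces are glued by their anchors. Then this construction can be carried out up to $\omega_1$, and, whatever choices are made, the resulting skein space $M=\mathrm{Sk}(\omega_1)$ is a complete metric space of cardinality continuum in which every closed separable subset that is not a singleton fails to be a Lipschitz retract of $M$: if $S\subset M$ is such a set, there is no Lipschitz map $R\colon M\to S$ with $R(x)=x$ for all $x\in S$. In particular, there exists a complete metric space of cardinality continuum in which no closed separable subset other than a singleton is a Lipschitz retract. -/

import Mathlib

open Set

/-! ### Threads -/

/-- The thread metric of length `l` and width `a` on a subset of `[0, l]`. -/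
noncomputable def threadDist (l a x y : ℝ) : ℝ :=
  min |x - y| (min (x + (l - y) + a) (y + (l - x) + a))

/-- The set `Δ` of admissible sequences of gap lengths, for a fixed enumeration `q` of the
rationals in `(0, 1)`.  Sequences are indexed from `0`, so that the bound `2 ^ (-(i + 1))` for the
`i`-th term (`i ≥ 1`) reads `2 ^ (-(i + 2))` for the term with index `i`. -/
def GapLengths (q : ℕ ≃ Ioo (0 : ℚ) 1) : Set (ℕ → ℝ) :=
  {γ | Antitone γ ∧ (∀ i, 0 < γ i) ∧ (∀ i, γ i < (1 / 2 : ℝ) ^ (i + 2)) ∧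
    (((q 0 : ℚ) : ℝ)) + γ 0 < 1}

/-- The open interval `(q n, q n + r)`. -/
def gapAt (q : ℕ ≃ Ioo (0 : ℚ) 1) (n : ℕ) (r : ℝ) : Set ℝ :=
  Ioo (((q n : ℚ) : ℝ)) (((q n : ℚ) : ℝ) + r)

/-- The index `n_i` such that the `i`-th gap is `(q n_i, q n_i + γ i)`: the least `n` such that this
interval lies in `(0, 1)` and is disjoint from the previous gaps.
For `γ ∈ GapLengths q` and `i = 0` this is `0`, because `q 0 + γ 0 < 1`. -/
noncomputable def gapIndex (q : ℕ ≃ Ioo (0 : ℚ) 1) (γ : ℕ → ℝ) (i : ℕ) : ℕ :=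
  sInf {n | gapAt q n (γ i) ⊆ Ioo 0 1 \ ⋃ j : Fin i, gapAt q (gapIndex q γ j.1) (γ j.1)}
termination_by i
decreasing_by exact j.2

/-- The closed set `T_γ ⊆ [0, 1]`. -/
def threadSet (q : ℕ ≃ Ioo (0 : ℚ) 1) (γ : ℕ → ℝ) : Set ℝ :=
  Icc 0 1 \ ⋃ i : ℕ, gapAt q (gapIndex q γ i) (γ i)

/-- `T` is a copy, inside the metric space `X`, of the thread `T_γ(1, d(A, B))`, with lower extreme
point `A` and upper extreme point `B`. -/
def IsThread {X : Type*} [MetricSpace X] (q : ℕ ≃ Ioo (0 : ℚ) 1) (γ : ℕ → ℝ)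
    (A B : X) (T : Set X) : Prop :=
  ∃ f : ℝ → X, f 0 = A ∧ f 1 = B ∧ f '' threadSet q γ = T ∧
    ∀ s ∈ threadSet q γ, ∀ t ∈ threadSet q γ,
      dist (f s) (f t) = threadDist 1 (dist A B) s t

/-! ### Attachments and threading spaces -/

/-- Inside a metric space `X`, the subset `Y` is the attachment of the subset `M` with the pieces
`N i` along the sets `S i`.  All the spaces are regarded as subsets of `X`, the gluing isometries
being identities: a piece meets `M` exactly in `S i`, two pieces meet only inside `M`, and all
distances are computed along the sets `S i` (the minima are attained). -/
structure IsAttachment {X : Type*} [MetricSpace X] (M Y : Set X) {ι : Type*}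
    (N S : ι → Set X) : Prop where
  isCompact : ∀ i, IsCompact (S i)
  inter_base : ∀ i, N i ∩ M = S i
  inter_pieces : ∀ i j, i ≠ j → N i ∩ N j ⊆ M
  union : Y = M ∪ ⋃ i, N i
  dist_base : ∀ i, ∀ p ∈ N i \ S i, ∀ z ∈ M,
    IsLeast {r : ℝ | ∃ x ∈ S i, r = dist p x + dist x z} (dist p z)
  dist_pieces : ∀ i j, i ≠ j → ∀ p ∈ N i \ S i, ∀ z ∈ N j \ S j,
    IsLeast {r : ℝ | ∃ x ∈ S i, ∃ y ∈ S j, r = dist p x + dist x y + dist y z} (dist p z)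

/-- Inside a metric space, `Y` is a copy of the threading space anchored at `A` and `B`: the
attachment of `{A, B}` with one thread of width `d(A, B)` for each `γ ∈ Δ`, each thread being glued
by its two extreme points. -/
def IsThreadingSpace {X : Type*} [MetricSpace X] (q : ℕ ≃ Ioo (0 : ℚ) 1)
    (A B : X) (Y : Set X) : Prop :=
  ∃ T : GapLengths q → Set X, (∀ γ : GapLengths q, IsThread q γ.1 A B (T γ)) ∧
    IsAttachment {A, B} Y T (fun _ => {A, B})

/-! ### Skein spaces -/

/-- The set of unordered pairs `{p, z}` of points of `M` at distance in `(0, 1/2]`, at least one of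
which does not belong to `M'`. -/
def newPairs {X : Type*} [MetricSpace X] (M' M : Set X) : Set (Set X) :=
  {s | ∃ p ∈ M, ∃ z ∈ M \ M', s = {p, z} ∧ 0 < dist p z ∧ dist p z ≤ 1 / 2}

/-- The successor step: `Y` is obtained from `M` by attaching a threading space at every pair in
`newPairs M' M`.  The pairs are unordered; which of the two points is the lower extreme point of the
threads is an arbitrary choice made for each pair. -/
def IsSkeinSucc {X : Type*} [MetricSpace X] (q : ℕ ≃ Ioo (0 : ℚ) 1) (M' M Y : Set X) : Prop :=
  ∃ Th : newPairs M' M → Set X,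
    (∀ s : newPairs M' M, ∃ A B : X, s.1 = {A, B} ∧ IsThreadingSpace q A B (Th s)) ∧
    IsAttachment M Y Th (fun s => s.1)

/-- `Sk` is a realization, inside the metric space `X`, of the transfinite construction of the skein
spaces `Sk α`, `α ≤ β`, the last one being all of `X`. -/
structure IsSkeinTower {X : Type*} [MetricSpace X] (q : ℕ ≃ Ioo (0 : ℚ) 1) (β : Ordinal.{0})
    (Sk : Ordinal.{0} → Set X) : Prop where
  zero : ∃ A B : X, dist A B = 1 / 2 ∧ Sk 0 = {A, B}
  succ : ∀ α < β, IsSkeinSucc q (⋃ δ < α, Sk δ) (Sk α) (Sk (Order.succ α))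
  /-- At a limit stage, `Sk α` is the completion of the union of the previous stages. -/
  limit : ∀ α ≤ β, Order.IsSuccLimit α →
    IsComplete (Sk α) ∧ (⋃ δ < α, Sk δ) ⊆ Sk α ∧ Sk α ⊆ closure (⋃ δ < α, Sk δ)
  top : Sk β = univ

/-- The metric space `X` is a `β`-skein space. -/
def IsSkeinSpace (q : ℕ ≃ Ioo (0 : ℚ) 1) (β : Ordinal.{0}) (X : Type*) [MetricSpace X] : Prop :=
  ∃ Sk : Ordinal.{0} → Set X, IsSkeinTower q β Sk

/-- `S` is a Lipschitz retract of the metric space `X`. -/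
def IsLipschitzRetract {X : Type*} [MetricSpace X] (S : Set X) : Prop :=
  ∃ R : X → X, (∃ K : NNReal, LipschitzWith K R) ∧ (∀ x, R x ∈ S) ∧ ∀ x ∈ S, R x = x

section

open MeasureTheory Filter Topology
open scoped ENNReal NNReal

/-! ### Thread sets -/

section ThreadSet

variable {q : ℕ ≃ Ioo (0 : ℚ) 1} {γ : ℕ → ℝ}

/-! The core claim is that a Lipschitz map `R` from `M` into a separable set `S` takes equal values
at any two points `p`, `z` with `dist p z ≤ 1 / 2`. Every point of `M` is reached from the two
initial points by jumps of length at most `1 / 2`, so `R` is then constant. A retraction fixes `S`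
pointwise, hence `S` is a singleton.

To prove the claim, suppose `R p ≠ R z`. Since `ω₁` has uncountable cofinality, `S` lies in a
countable stage `Sk α₀`. At each earlier stage only countably many of the new threads meet `S` off
their base, because threads are separated from each other away from the base. So only countably many
gap sequences matter, and a diagonal choice gives `γ ∈ Δ` decreasing much faster than all of them,
with `γ 0` tiny. Some thread of type `γ` joins `p` to `z`; let `c : T_γ → S` be `R` along it. If `c`
has an `H¹`-null image, then the distance from `R p`, extended as a Lipschitz function across the
gaps, sweeps out the interval `[0, dist (R p) (R z)]` while only the gaps contribute measure. Thus
`dist (R p) (R z) ≤ K * (2 * γ 0)`, which is absurd for small `γ 0`.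

That `c(T_γ) ∩ Sk α` is null is shown by induction on `α ≤ α₀`. At a successor, `c` locally projects
to a Lipschitz map from `T_γ` into another set `T_γ'`. The gaps of `T_γ` past the `n`-th are too
short to carry it across the comparatively long gaps of `T_γ'`, so each of `n + 1` pieces of `T_γ`
has an image of diameter at most `1 / (n + 1) ^ 2` (`volume_image_eq_zero_of_eventuallyFiner`). At a
limit, projecting `c` to an earlier stage gives an image that is null up to a countable set, so the
sweeping argument bounds distances by the lengths of gaps. This makes the `n + 1` pieces so small
that the image is null (`hausdorffMeasure_inter_eq_zero_of_approx`). The projections exist because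
at small scales each stage is attached to the earlier ones like a tree: a nearby point has a unique
gate, and the gate map is locally 1-Lipschitz (`Gated`).

Existence is obtained by transfinite recursion on subsets of the fixed type `Set ℝ`, whose
cardinality exceeds the continuum and so always leaves room for the next stage. -/

theorem gapIndex_mem {i : ℕ}
    (h : {n | gapAt q n (γ i) ⊆
      Ioo 0 1 \ ⋃ j : Fin i, gapAt q (gapIndex q γ j.1) (γ j.1)}.Nonempty) :
    gapAt q (gapIndex q γ i) (γ i) ⊆
      Ioo 0 1 \ ⋃ j : Fin i, gapAt q (gapIndex q γ j.1) (γ j.1) := by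
  have := Nat.sInf_mem h
  rw [gapIndex]
  exact this

theorem gapIndex_le {i n : ℕ}
    (h : gapAt q n (γ i) ⊆ Ioo 0 1 \ ⋃ j : Fin i, gapAt q (gapIndex q γ j.1) (γ j.1)) :
    gapIndex q γ i ≤ n := by
  rw [gapIndex]
  exact Nat.sInf_le h

theorem gap_subset_Ioo (hγ : γ ∈ GapLengths q) (i : ℕ) :
    gapAt q (gapIndex q γ i) (γ i) ⊆ Ioo 0 1 := by
  by_cases h : {n | gapAt q n (γ i) ⊆
      Ioo 0 1 \ ⋃ j : Fin i, gapAt q (gapIndex q γ j.1) (γ j.1)}.Nonempty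
  · exact (gapIndex_mem h).trans sdiff_subset
  -- If no index is admissible, `sInf ∅ = 0` selects `q 0`. Its interval still lies in `(0, 1)`,
  -- because `γ i ≤ γ 0` and `q 0 + γ 0 < 1`. Hence the existence of admissible indices need not be
  -- settled.
  · have h0 : gapIndex q γ i = 0 := by
      rw [gapIndex, not_nonempty_iff_eq_empty.1 h, Nat.sInf_empty]
    rw [h0]
    have h1 : (0 : ℝ) < ((q 0 : ℚ) : ℝ) := by exact_mod_cast (q 0).2.1
    have h2 := hγ.2.2.2
    have h3 := hγ.1 (Nat.zero_le i)
    exact Ioo_subset_Ioo h1.le (by linarith)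

theorem threadSet_subset : threadSet q γ ⊆ Icc 0 1 := sdiff_subset

theorem isClosed_threadSet : IsClosed (threadSet q γ) :=
  isClosed_Icc.sdiff (isOpen_iUnion fun _ => isOpen_Ioo)

theorem isCompact_threadSet : IsCompact (threadSet q γ) :=
  isCompact_Icc.of_isClosed_subset isClosed_threadSet threadSet_subset

theorem zero_mem_threadSet (hγ : γ ∈ GapLengths q) : (0 : ℝ) ∈ threadSet q γ := by
  refine ⟨by simp, fun h => ?_⟩
  obtain ⟨i, hi⟩ := mem_iUnion.1 h
  exact lt_irrefl _ (gap_subset_Ioo hγ i hi).1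

theorem one_mem_threadSet (hγ : γ ∈ GapLengths q) : (1 : ℝ) ∈ threadSet q γ := by
  refine ⟨by simp, fun h => ?_⟩
  obtain ⟨i, hi⟩ := mem_iUnion.1 h
  exact lt_irrefl _ (gap_subset_Ioo hγ i hi).2

/-- Thread sets are nowhere dense. An interval inside the set would contain some `q n`, and since `γ
i → 0`, this `n` would be admissible for all large `i`. Minimality forces `n_i ≤ n` for these `i`,
while disjointness of the gaps makes the `n_i` distinct. -/
theorem exists_mem_Ioo_notMem_threadSet (hγ : γ ∈ GapLengths q) {a b : ℝ} (hab : a < b) :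
    ∃ x ∈ Ioo a b, x ∉ threadSet q γ := by
  by_contra! hT
  have hI : Ioo a b ⊆ Ioo 0 1 := by
    rw [← interior_Icc (a := (0 : ℝ)) (b := 1)]
    exact interior_maximal (fun x hx => threadSet_subset (hT x hx)) isOpen_Ioo
  obtain ⟨r, har, hrb⟩ := exists_rat_btwn hab
  have hr : r ∈ Ioo (0 : ℚ) 1 := by
    have := hI ⟨har, hrb⟩
    exact ⟨by exact_mod_cast this.1, by exact_mod_cast this.2⟩
  set n := q.symm ⟨r, hr⟩ with hn
  have hqn : ((q n : ℚ) : ℝ) = r := by simp [hn]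
  obtain ⟨i₀, hi₀⟩ := exists_pow_lt_of_lt_one (sub_pos.2 hrb) (by norm_num : (1 / 2 : ℝ) < 1)
  have hlt : ∀ i, γ (i₀ + i) < b - r := fun i => by
    refine (hγ.2.2.1 _).trans (lt_of_le_of_lt ?_ hi₀)
    exact pow_le_pow_of_le_one (by norm_num) (by norm_num) (by omega)
  have hmem : ∀ i, gapAt q n (γ (i₀ + i)) ⊆
      Ioo 0 1 \ ⋃ j : Fin (i₀ + i), gapAt q (gapIndex q γ j.1) (γ j.1) := by
    intro i x hx
    have hx' : x ∈ Ioo a b := by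
      rw [gapAt, hqn] at hx
      exact ⟨har.trans hx.1, by linarith [hx.2, hlt i]⟩
    refine ⟨hI hx', fun h => ?_⟩
    obtain ⟨j, hj⟩ := mem_iUnion.1 h
    exact (hT x hx').2 (mem_iUnion.2 ⟨j.1, hj⟩)
  have hle : ∀ i, gapIndex q γ (i₀ + i) ≤ n := fun i => gapIndex_le (hmem i)
  have hne : ∀ i j, i < j → gapIndex q γ (i₀ + i) ≠ gapIndex q γ (i₀ + j) := by
    intro i j hij h
    have h1 := gapIndex_mem ⟨n, hmem j⟩
    have hpos := hγ.2.1 (i₀ + j)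
    have hanti : γ (i₀ + j) ≤ γ (i₀ + i) := hγ.1 (by omega)
    have h2 : ((q (gapIndex q γ (i₀ + j)) : ℚ) : ℝ) + γ (i₀ + j) / 2 ∈
        gapAt q (gapIndex q γ (i₀ + j)) (γ (i₀ + j)) := ⟨by linarith, by linarith⟩
    refine (h1 h2).2 (mem_iUnion.2 ⟨⟨i₀ + i, by omega⟩, ?_⟩)
    change _ ∈ gapAt q (gapIndex q γ (i₀ + i)) (γ (i₀ + i))
    rw [h]
    exact ⟨by linarith, by linarith⟩
  have hinj : Function.Injective fun i => gapIndex q γ (i₀ + i) := by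
    intro i j h
    by_contra hij
    rcases lt_or_gt_of_ne hij with h' | h'
    · exact hne _ _ h' h
    · exact hne _ _ h' h.symm
  exact infinite_of_injective_forall_mem hinj (s := Iic n) hle (finite_Iic n)

/-- Nowhere density supplies a gap near each point; compactness of `[0, 1]` makes its length
uniform. -/
theorem exists_uniform_gap (hγ : γ ∈ GapLengths q) {r : ℝ} (hr : 0 < r) :
    ∃ η > 0, ∀ y ∈ Icc (0 : ℝ) 1, ∃ z, y ≤ z ∧ z + η ≤ y + r ∧
      Disjoint (Ioo z (z + η)) (threadSet q γ) := by
  refine (isCompact_Icc (a := (0 : ℝ)) (b := 1)).induction_on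
    (p := fun s => ∃ η > 0, ∀ y ∈ s, ∃ z, y ≤ z ∧ z + η ≤ y + r ∧
      Disjoint (Ioo z (z + η)) (threadSet q γ)) ⟨1, one_pos, by simp⟩ ?_ ?_ ?_
  · rintro s t hst ⟨η, h0, h⟩
    exact ⟨η, h0, fun y hy => h y (hst hy)⟩
  · rintro s t ⟨η, h0, h⟩ ⟨η', h0', h'⟩
    refine ⟨min η η', lt_min h0 h0', fun y hy => ?_⟩
    rcases hy with hy | hy
    · obtain ⟨z, h1, h2, h3⟩ := h y hy
      have := min_le_left η η'
      exact ⟨z, h1, by linarith, h3.mono_left (Ioo_subset_Ioo_right (by linarith))⟩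
    · obtain ⟨z, h1, h2, h3⟩ := h' y hy
      have := min_le_right η η'
      exact ⟨z, h1, by linarith, h3.mono_left (Ioo_subset_Ioo_right (by linarith))⟩
  · intro y _
    -- A gap starting in the middle third of `(y, y + r)` serves every starting point within `r / 3`
    -- of `y`.
    obtain ⟨x, hx, hxT⟩ := exists_mem_Ioo_notMem_threadSet hγ
      (show y + r / 3 < y + 2 * r / 3 by linarith)
    obtain ⟨ε, hε, hball⟩ := Metric.isOpen_iff.1 isClosed_threadSet.isOpen_compl x hxT
    refine ⟨Ioo (y - r / 3) (y + r / 3),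
      mem_nhdsWithin_of_mem_nhds (Ioo_mem_nhds (by linarith) (by linarith)),
      min ε (y + 2 * r / 3 - x), lt_min hε (by linarith [hx.2]), fun y' hy' => ?_⟩
    have h1 := min_le_left ε (y + 2 * r / 3 - x)
    have h2 := min_le_right ε (y + 2 * r / 3 - x)
    refine ⟨x, by linarith [hy'.2, hx.1], by linarith [hy'.1], ?_⟩
    refine disjoint_left.2 fun w hw => hball ?_
    rw [Metric.mem_ball, Real.dist_eq, abs_of_pos (by linarith [hw.1])]
    linarith [hw.2]

/-- The halving condition bounds every tail sum by twice its first term, which is what makes the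
gaps past the `N`-th negligible. -/
theorem exists_gapLengths_le (q : ℕ ≃ Ioo (0 : ℚ) 1) {h : ℕ → ℝ} (hh : ∀ n, 0 < h n) :
    ∃ γ ∈ GapLengths q, (∀ n, γ n ≤ h n) ∧ ∀ n, γ (n + 1) ≤ γ n / 2 := by
  have hq : ((q 0 : ℚ) : ℝ) < 1 := by exact_mod_cast (q 0).2.2
  let γ : ℕ → ℝ := fun n => Nat.rec (min (h 0) (min (1 / 8) ((1 - ((q 0 : ℚ) : ℝ)) / 2)))
    (fun n g => min (h (n + 1)) (g / 2)) n
  have h0 : γ 0 = min (h 0) (min (1 / 8) ((1 - ((q 0 : ℚ) : ℝ)) / 2)) := rfl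
  have hs : ∀ n, γ (n + 1) = min (h (n + 1)) (γ n / 2) := fun n => rfl
  have hhalf : ∀ n, γ (n + 1) ≤ γ n / 2 := fun n => (hs n).trans_le (min_le_right _ _)
  have hpos : ∀ n, 0 < γ n := by
    intro n
    induction n with
    | zero => rw [h0]; exact lt_min (hh 0) (lt_min (by norm_num) (by linarith))
    | succ n ih => rw [hs]; exact lt_min (hh _) (by linarith)
  -- Exponent `n + 3` leaves room for the strict inequality with exponent `n + 2` required in `Δ`.
  have hpow : ∀ n, γ n ≤ (1 / 2 : ℝ) ^ (n + 3) := by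
    intro n
    induction n with
    | zero =>
      rw [h0]
      exact (min_le_right _ _).trans ((min_le_left _ _).trans (by norm_num))
    | succ n ih =>
      have := hhalf n
      rw [show n + 1 + 3 = n + 3 + 1 from rfl, pow_succ]
      linarith
  refine ⟨γ, ⟨antitone_nat_of_succ_le fun n => ?_, hpos, fun n => ?_, ?_⟩, fun n => ?_, hhalf⟩
  · linarith [hhalf n, hpos n]
  · refine (hpow n).trans_lt ?_
    exact pow_lt_pow_right_of_lt_one₀ (by norm_num) (by norm_num) (by omega)
  · have : γ 0 ≤ (1 - ((q 0 : ℚ) : ℝ)) / 2 := by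
      rw [h0]; exact (min_le_right _ _).trans (min_le_right _ _)
    linarith
  · cases n with
    | zero => rw [h0]; exact min_le_left _ _
    | succ n => rw [hs]; exact min_le_left _ _

theorem volume_iUnion_gap_le (hhalf : ∀ n, γ (n + 1) ≤ γ n / 2) (N : ℕ) :
    volume (⋃ i, gapAt q (gapIndex q γ (N + i)) (γ (N + i))) ≤ ENNReal.ofReal (2 * γ N) := by
  have hle : ∀ i, γ (N + i) ≤ γ N * (1 / 2) ^ i := by
    intro i
    induction i with
    | zero => simp
    | succ i ih =>
      rw [pow_succ]
      linarith [hhalf (N + i), show γ (N + (i + 1)) = γ (N + i + 1) from rfl]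
  calc volume (⋃ i, gapAt q (gapIndex q γ (N + i)) (γ (N + i)))
      ≤ ∑' i, volume (gapAt q (gapIndex q γ (N + i)) (γ (N + i))) := measure_iUnion_le _
    _ ≤ ∑' i, ENNReal.ofReal (γ N) * (2⁻¹ : ℝ≥0∞) ^ i := by
      refine ENNReal.tsum_le_tsum fun i => ?_
      rw [gapAt, Real.volume_Ioo, add_sub_cancel_left]
      refine (ENNReal.ofReal_le_ofReal (hle i)).trans_eq ?_
      rw [ENNReal.ofReal_mul' (by positivity), ENNReal.ofReal_pow (by norm_num), one_div,
        ENNReal.ofReal_inv_of_pos (by norm_num)]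
      norm_num
    _ = ENNReal.ofReal (2 * γ N) := by
      rw [ENNReal.tsum_mul_left, ENNReal.tsum_geometric, ENNReal.one_sub_inv_two, inv_inv,
        mul_comm, ENNReal.ofReal_mul (by norm_num)]
      norm_num

theorem volume_Icc_diff_threadSet_le (hhalf : ∀ n, γ (n + 1) ≤ γ n / 2) :
    volume (Icc 0 1 \ threadSet q γ) ≤ ENNReal.ofReal (2 * γ 0) := by
  refine (measure_mono ?_).trans (volume_iUnion_gap_le (q := q) hhalf 0)
  intro x hx
  by_contra h
  refine hx.2 ⟨hx.1, ?_⟩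
  simpa using h

/-- The first `N` gaps cut the thread set into at most `N + 1` pieces, and between two points of one
piece only later gaps occur. A piece is recorded by the number of these gaps whose left end is
smaller than the point: the set of such gaps grows with the point, so its cardinality determines it.
-/
theorem exists_partition (hhalf : ∀ n, γ (n + 1) ≤ γ n / 2) (N : ℕ) :
    ∃ P : Fin (N + 1) → Set ℝ, threadSet q γ ⊆ ⋃ k, P k ∧ ∀ k, ∀ u ∈ P k, ∀ v ∈ P k,
      volume (Icc u v \ threadSet q γ) ≤ ENNReal.ofReal (2 * γ N) := by
  let l : ℕ → ℝ := fun i => ((q (gapIndex q γ i) : ℚ) : ℝ)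
  let key : ℝ → Finset ℕ := fun x => (Finset.range N).filter fun i => l i < x
  have hmono : Monotone key := fun x y hxy i hi => by
    simp only [key, Finset.mem_filter] at hi ⊢
    exact ⟨hi.1, hi.2.trans_le hxy⟩
  refine ⟨fun k => {x ∈ threadSet q γ | (key x).card = k}, fun x hx => ?_, ?_⟩
  · have : (key x).card < N + 1 :=
      Nat.lt_succ_of_le ((Finset.card_filter_le _ _).trans_eq (Finset.card_range N))
    exact mem_iUnion.2 ⟨⟨_, this⟩, hx, rfl⟩
  · rintro k u ⟨hu, hku⟩ v ⟨hv, hkv⟩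
    rcases lt_or_ge v u with huv | huv
    · simp [Icc_eq_empty_of_lt huv]
    have hkey : key u = key v :=
      Finset.eq_of_subset_of_card_le (hmono huv) (by rw [hku, hkv])
    refine (measure_mono ?_).trans (volume_iUnion_gap_le (q := q) hhalf N)
    rintro x ⟨hx, hxT⟩
    have hx01 : x ∈ Icc (0 : ℝ) 1 :=
      ⟨(threadSet_subset hu).1.trans hx.1, hx.2.trans (threadSet_subset hv).2⟩
    have hx' : x ∈ ⋃ i, gapAt q (gapIndex q γ i) (γ i) := by
      by_contra h
      exact hxT ⟨hx01, h⟩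
    obtain ⟨i, hi⟩ := mem_iUnion.1 hx'
    by_cases hiN : i < N
    · exfalso
      have h1 : i ∈ key v := by
        simp only [key, Finset.mem_filter, Finset.mem_range]
        exact ⟨hiN, hi.1.trans_le hx.2⟩
      rw [← hkey] at h1
      simp only [key, Finset.mem_filter] at h1
      exact hu.2 (mem_iUnion.2 ⟨i, h1.2, hx.1.trans_lt hi.2⟩)
    · obtain ⟨j, rfl⟩ := Nat.exists_eq_add_of_le (not_lt.1 hiN)
      exact mem_iUnion.2 ⟨j, hi⟩

end ThreadSet

/-! ### Lipschitz images of thread sets -/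

section Images

/-- Extend `g` to a Lipschitz function on the line. By the intermediate value theorem each point of
`A` is a value on `[u, v]`, taken either on `T` or in the complement of `T`, whose image has measure
at most `K` times its length. -/
theorem volume_le_of_lipschitzOnWith {K : ℝ≥0} {g : ℝ → ℝ} {T : Set ℝ} {u v : ℝ} (huv : u ≤ v)
    (hu : u ∈ T) (hv : v ∈ T) (hg : LipschitzOnWith K g (T ∩ Icc u v)) {A : Set ℝ}
    (hA : A ⊆ uIcc (g u) (g v)) :
    volume A ≤ volume (A ∩ g '' (T ∩ Icc u v)) + K * volume (Icc u v \ T) := by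
  obtain ⟨G, hG, hGg⟩ := hg.extend_real
  have hsub : A ⊆ (A ∩ g '' (T ∩ Icc u v)) ∪ G '' (Icc u v \ T) := by
    intro y hy
    have h1 : y ∈ uIcc (G u) (G v) := by
      rw [← hGg ⟨hu, left_mem_Icc.2 huv⟩, ← hGg ⟨hv, right_mem_Icc.2 huv⟩]
      exact hA hy
    obtain ⟨x, hx, rfl⟩ := intermediate_value_uIcc hG.continuous.continuousOn h1
    rw [uIcc_of_le huv] at hx
    by_cases hxT : x ∈ T
    · exact Or.inl ⟨hy, x, ⟨hxT, hx⟩, hGg ⟨hxT, hx⟩⟩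
    · exact Or.inr ⟨x, ⟨hx, hxT⟩, rfl⟩
  refine (measure_mono hsub).trans ((measure_union_le _ _).trans ?_)
  gcongr
  have := hG.hausdorffMeasure_image_le zero_le_one (Icc u v \ T)
  rwa [hausdorffMeasure_real, ENNReal.rpow_one] at this

variable {X : Type*} [MetricSpace X] [MeasurableSpace X] [BorelSpace X]

/-- The distance from `c u` is 1-Lipschitz, so its values along `c` form a null set. The interval
from `0` to `dist (c u) (c v)` must therefore be covered, up to measure zero, by the images of the
gaps. -/
theorem edist_le_of_hausdorffMeasure_image_eq_zero {K : ℝ≥0} {c : ℝ → X} {T : Set ℝ} {u v : ℝ}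
    (huv : u ≤ v) (hu : u ∈ T) (hv : v ∈ T) (hc : LipschitzOnWith K c (T ∩ Icc u v))
    (h0 : μH[1] (c '' (T ∩ Icc u v)) = 0) :
    edist (c u) (c v) ≤ K * volume (Icc u v \ T) := by
  have hd : LipschitzWith 1 fun x => dist (c u) x := LipschitzWith.dist_right _
  have hg : LipschitzOnWith K (fun w => dist (c u) (c w)) (T ∩ Icc u v) := by
    have := hd.comp_lipschitzOnWith hc
    rwa [one_mul] at this
  have h1 := volume_le_of_lipschitzOnWith huv hu hv hg Subset.rfl
  have h2 : volume ((fun w => dist (c u) (c w)) '' (T ∩ Icc u v)) = 0 := by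
    have := hd.hausdorffMeasure_image_le zero_le_one (c '' (T ∩ Icc u v))
    rw [h0, mul_zero, image_image, hausdorffMeasure_real] at this
    exact le_antisymm this zero_le
  rw [measure_mono_null inter_subset_right h2, zero_add, dist_self, uIcc_of_le dist_nonneg,
    Real.volume_Icc, sub_zero, ← edist_dist] at h1
  exact h1

theorem hausdorffMeasure_image_eq_zero_of_locally {c : ℝ → X} {E : Set ℝ}
    (h : ∀ u ∈ E, ∃ U ∈ 𝓝 u, μH[1] (c '' (E ∩ U)) = 0) : μH[1] (c '' E) = 0 := by
  -- Pulling `H¹` back along `c` as an outer measure reduces this to the Lindelöf argument on the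
  -- line, with no measurability needed.
  refine measure_null_of_locally_null
    (μ := OuterMeasure.comap c (μH[1] : Measure X).toOuterMeasure) E fun u hu => ?_
  obtain ⟨U, hU, h0⟩ := h u hu
  exact ⟨E ∩ U, inter_mem_nhdsWithin _ hU, h0⟩

theorem countable_image_of_locally_const {Y : Type*} {f : ℝ → Y} {E : Set ℝ}
    (h : ∀ u ∈ E, ∃ U ∈ 𝓝 u, ∀ w ∈ E ∩ U, f w = f u) : (f '' E).Countable := by
  choose! U hU hf using h
  obtain ⟨t, htE, ht, hcov⟩ := TopologicalSpace.countable_cover_nhdsWithin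
    (fun u hu => inter_mem_nhdsWithin E (hU u hu))
  refine (ht.image f).mono ?_
  rintro _ ⟨w, hw, rfl⟩
  obtain ⟨u, hut, hwu⟩ := mem_iUnion₂.1 (hcov hw)
  exact ⟨u, hut, (hf u (htE hut) w hwu).symm⟩

theorem hausdorffMeasure_eq_zero_of_countable {s : Set X} (hs : s.Countable) :
    μH[1] s = 0 := by
  have := Measure.nullSingletonClass_hausdorff X one_pos
  exact hs.measure_zero _

variable {q : ℕ ≃ Ioo (0 : ℚ) 1} {γ : ℕ → ℝ}

theorem tendsto_succ_mul_of_halving (h0 : ∀ n, 0 < γ n) (hhalf : ∀ n, γ (n + 1) ≤ γ n / 2) :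
    Tendsto (fun n : ℕ => ((n : ℝ) + 1) * γ n) atTop (𝓝 0) := by
  have hle : ∀ n, γ n ≤ γ 0 * (1 / 2) ^ n := by
    intro n
    induction n with
    | zero => simp
    | succ n ih => rw [pow_succ]; linarith [hhalf n]
  have h1 : Tendsto (fun n : ℕ => (n : ℝ) * (1 / 2 : ℝ) ^ n) atTop (𝓝 0) :=
    tendsto_self_mul_const_pow_of_lt_one (by norm_num) (by norm_num)
  have h2 : Tendsto (fun n : ℕ => (1 / 2 : ℝ) ^ n) atTop (𝓝 0) :=
    tendsto_pow_atTop_nhds_zero_of_lt_one (by norm_num) (by norm_num)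
  have h3 := (h1.add h2).const_mul (γ 0)
  simp only [add_zero, mul_zero] at h3
  refine squeeze_zero (fun n => ?_) (fun n => ?_) h3
  · have := h0 n; positivity
  · have := mul_le_mul_of_nonneg_left (hle n) (show (0 : ℝ) ≤ n + 1 by positivity)
    linarith

/-- The `N + 1` pieces of `exists_partition` have images of diameter at most `2 * K * γ N`. Their
total `(N + 1) * 2 * K * γ N` tends to `0` since `γ` decays geometrically. -/
theorem hausdorffMeasure_image_eq_zero_of_edist_le (h0 : ∀ n, 0 < γ n)
    (hhalf : ∀ n, γ (n + 1) ≤ γ n / 2) {K : ℝ≥0} {c : ℝ → X} {F : Set ℝ}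
    (hF : F ⊆ threadSet q γ)
    (h : ∀ u ∈ F, ∀ v ∈ F, u ≤ v →
      edist (c u) (c v) ≤ K * volume (Icc u v \ threadSet q γ)) :
    μH[1] (c '' F) = 0 := by
  choose P hPcov hP using exists_partition (q := q) hhalf
  have hdiam : ∀ N k, Metric.ediam (c '' (F ∩ P N k)) ≤ K * ENNReal.ofReal (2 * γ N) := by
    intro N k
    refine Metric.ediam_le ?_
    rintro _ ⟨u, ⟨huF, hu⟩, rfl⟩ _ ⟨v, ⟨hvF, hv⟩, rfl⟩
    rcases le_total u v with huv | huv
    · exact (h u huF v hvF huv).trans (by gcongr; exact hP N k u hu v hv)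
    · rw [edist_comm]
      exact (h v hvF u huF huv).trans (by gcongr; exact hP N k v hv u hu)
  have hlim : Tendsto (fun N : ℕ => (K : ℝ≥0∞) * ENNReal.ofReal (2 * (((N : ℝ) + 1) * γ N)))
      atTop (𝓝 0) := by
    have h1 := (tendsto_succ_mul_of_halving h0 hhalf).const_mul 2
    have h2 := ENNReal.Tendsto.const_mul (a := (K : ℝ≥0∞)) (ENNReal.tendsto_ofReal h1)
      (Or.inr ENNReal.coe_ne_top)
    simpa using h2
  have hle := Measure.hausdorffMeasure_le_liminf_sum 1 (c '' F) (l := atTop)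
    (fun N : ℕ => (K : ℝ≥0∞) * ENNReal.ofReal (2 * (((N : ℝ) + 1) * γ N))) hlim
    (fun N k => c '' (F ∩ P N k)) (Eventually.of_forall fun N k => (hdiam N k).trans ?_)
    (Eventually.of_forall fun N => ?_)
  · refine le_antisymm (hle.trans ?_) zero_le
    rw [← hlim.liminf_eq]
    refine liminf_le_liminf (Eventually.of_forall fun N => ?_)
    calc ∑ i, Metric.ediam (c '' (F ∩ P N i)) ^ (1 : ℝ)
        ≤ ∑ _i : Fin (N + 1), K * ENNReal.ofReal (2 * γ N) :=
          Finset.sum_le_sum fun i _ => by rw [ENNReal.rpow_one]; exact hdiam N i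
      _ = K * ENNReal.ofReal (2 * (((N : ℝ) + 1) * γ N)) := by
        rw [Finset.sum_const, Finset.card_univ, Fintype.card_fin, nsmul_eq_mul,
          mul_left_comm (2 : ℝ), ENNReal.ofReal_mul (by positivity : (0 : ℝ) ≤ (N : ℝ) + 1),
          mul_left_comm]
        congr 2
        exact_mod_cast (ENNReal.ofReal_natCast (N + 1)).symm
  · gcongr
    have := h0 N
    nlinarith [show (0 : ℝ) ≤ N by positivity]
  · rw [← image_iUnion]
    refine image_mono fun u hu => ?_
    obtain ⟨k, hk⟩ := mem_iUnion.1 (hPcov N (hF hu))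
    exact mem_iUnion.2 ⟨k, hu, hk⟩

/-- The gaps of `γ` are eventually small compared with those of a set `T'` at the scales
`1 / (n + 1) ^ 2`. -/
def EventuallyFiner (γ : ℕ → ℝ) (T' : Set ℝ) : Prop :=
  ∀ᶠ n : ℕ in atTop, ∀ y ∈ Icc (0 : ℝ) 1, ∃ z, y ≤ z ∧ z + (n + 1) * γ n ≤ y + 1 / (n + 1) ^ 2 ∧
    Disjoint (Ioo z (z + (n + 1) * γ n)) T'

/-- If the image of one of the `n + 1` pieces spread over more than `1 / (n + 1) ^ 2`, it would
straddle a gap of `T'` of length `(n + 1) * γ n`. This gap would have to be covered by the images of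
gaps of `γ` of total length at most `2 * γ n`, which is impossible once `n + 1 > 2 * K`. So the
image has measure at most `(n + 1) / (n + 1) ^ 2`, for all large `n`. -/
theorem volume_image_eq_zero_of_eventuallyFiner (h0 : ∀ n, 0 < γ n)
    (hhalf : ∀ n, γ (n + 1) ≤ γ n / 2) {T' : Set ℝ} (hT' : T' ⊆ Icc 0 1)
    (hfine : EventuallyFiner γ T') {K : ℝ≥0} {x : ℝ → ℝ} {I : Set ℝ} (hI : I.OrdConnected)
    (hx : LipschitzOnWith K x (threadSet q γ ∩ I)) (hmaps : MapsTo x (threadSet q γ ∩ I) T') :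
    volume (x '' (threadSet q γ ∩ I)) = 0 := by
  set T := threadSet q γ
  set m := volume (x '' (T ∩ I)) with hm
  have key : ∀ᶠ n : ℕ in atTop, m ≤ ENNReal.ofReal (1 / ((n : ℝ) + 1)) := by
    obtain ⟨n₀, hn₀⟩ := exists_nat_gt (2 * (K : ℝ))
    filter_upwards [hfine, eventually_ge_atTop n₀] with n hn hnn
    have hKn : 2 * (K : ℝ) < n + 1 := by
      have : (n₀ : ℝ) ≤ n := by exact_mod_cast hnn
      linarith
    obtain ⟨P, hPcov, hP⟩ := exists_partition (q := q) hhalf n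
    have hdiam : ∀ k, Metric.ediam (x '' (T ∩ I ∩ P k)) ≤
        ENNReal.ofReal (1 / ((n : ℝ) + 1) ^ 2) := by
      intro k
      have aux : ∀ u ∈ T ∩ I ∩ P k, ∀ v ∈ T ∩ I ∩ P k, u ≤ v →
          edist (x u) (x v) ≤ ENNReal.ofReal (1 / ((n : ℝ) + 1) ^ 2) := by
        rintro u ⟨⟨huT, huI⟩, hu⟩ v ⟨⟨hvT, hvI⟩, hv⟩ huv
        by_contra! hlt
        rw [edist_dist, ENNReal.ofReal_lt_ofReal_iff_of_nonneg (by positivity),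
          Real.dist_eq, abs_sub_comm, ← max_sub_min_eq_abs] at hlt
        have hmem : min (x u) (x v) ∈ Icc (0 : ℝ) 1 := by
          rcases min_choice (x u) (x v) with h | h <;> rw [h]
          · exact hT' (hmaps ⟨huT, huI⟩)
          · exact hT' (hmaps ⟨hvT, hvI⟩)
        obtain ⟨z, hz1, hz2, hz3⟩ := hn _ hmem
        have hsub : T ∩ Icc u v ⊆ T ∩ I := inter_subset_inter_right _ (hI.out huI hvI)
        have h1 := volume_le_of_lipschitzOnWith huv huT hvT (hx.mono hsub)
          (A := Ioo z (z + (n + 1) * γ n)) (by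
            intro y hy
            refine ⟨hz1.trans hy.1.le, ?_⟩
            linarith [hy.2])
        -- The values of `x` on the thread lie in `T'`, so they miss the gap and only the complement
        -- of `T` contributes.
        have h2 : Ioo z (z + (n + 1) * γ n) ∩ x '' (T ∩ Icc u v) = ∅ := by
          refine (hz3.mono_right ?_).inter_eq
          rintro _ ⟨w, hw, rfl⟩
          exact hmaps (hsub hw)
        rw [h2, measure_empty, zero_add, Real.volume_Ioo, add_sub_cancel_left] at h1
        have h3 : ENNReal.ofReal ((n + 1) * γ n) ≤ ENNReal.ofReal (K * (2 * γ n)) := by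
          rw [ENNReal.ofReal_mul (p := (K : ℝ)) K.2, ENNReal.ofReal_coe_nnreal]
          exact h1.trans (by gcongr; exact hP k u hu v hv)
        rw [ENNReal.ofReal_le_ofReal_iff (by have := h0 n; positivity)] at h3
        nlinarith [h0 n]
      refine Metric.ediam_le ?_
      rintro _ ⟨u, hu, rfl⟩ _ ⟨v, hv, rfl⟩
      rcases le_total u v with huv | huv
      · exact aux u hu v hv huv
      · rw [edist_comm]; exact aux v hv u hu huv
    calc m ≤ volume (⋃ k, x '' (T ∩ I ∩ P k)) := by
          rw [← image_iUnion]
          refine measure_mono (image_mono fun u hu => ?_)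
          obtain ⟨k, hk⟩ := mem_iUnion.1 (hPcov hu.1)
          exact mem_iUnion.2 ⟨k, hu, hk⟩
      _ ≤ ∑ k : Fin (n + 1), volume (x '' (T ∩ I ∩ P k)) := by
          exact measure_iUnion_fintype_le _ _
      _ ≤ ∑ _k : Fin (n + 1), ENNReal.ofReal (1 / ((n : ℝ) + 1) ^ 2) :=
          Finset.sum_le_sum fun k _ => (Real.volume_le_diam _).trans (hdiam k)
      _ = ENNReal.ofReal (1 / ((n : ℝ) + 1)) := by
          rw [Finset.sum_const, Finset.card_univ, Fintype.card_fin, ← ENNReal.ofReal_nsmul,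
            nsmul_eq_mul]
          congr 1
          push_cast
          field_simp
  have hlim : Tendsto (fun n : ℕ => ENNReal.ofReal (1 / ((n : ℝ) + 1))) atTop (𝓝 0) := by
    simpa using ENNReal.tendsto_ofReal (tendsto_one_div_add_atTop_nhds_zero_nat (𝕜 := ℝ))
  exact le_antisymm (ge_of_tendsto hlim key) zero_le

/-- A diagonal choice: enumerate `Γ` and let the `n`-th term respect the first `n + 1` members, so
that each member is respected from some index on. -/
theorem exists_gapLengths_finer (q : ℕ ≃ Ioo (0 : ℚ) 1) {Γ : Set (ℕ → ℝ)} (hΓ : Γ.Countable)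
    (hΓq : Γ ⊆ GapLengths q) {ε : ℝ} (hε : 0 < ε) :
    ∃ γ ∈ GapLengths q, γ 0 ≤ ε ∧ (∀ n, γ (n + 1) ≤ γ n / 2) ∧
      ∀ γ' ∈ Γ, EventuallyFiner γ (threadSet q γ') := by
  have hη : ∀ γ' : ℕ → ℝ, ∀ n : ℕ, ∃ η > 0, γ' ∈ Γ → ∀ y ∈ Icc (0 : ℝ) 1,
      ∃ z, y ≤ z ∧ z + η ≤ y + 1 / ((n : ℝ) + 1) ^ 2 ∧
        Disjoint (Ioo z (z + η)) (threadSet q γ') := by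
    intro γ' n
    by_cases h : γ' ∈ Γ
    · obtain ⟨η, h1, h2⟩ := exists_uniform_gap (hΓq h)
        (show (0 : ℝ) < 1 / ((n : ℝ) + 1) ^ 2 by positivity)
      exact ⟨η, h1, fun _ => h2⟩
    · exact ⟨1, one_pos, fun h' => absurd h' h⟩
  choose η hη0 hη using hη
  rcases Γ.eq_empty_or_nonempty with rfl | hne
  · obtain ⟨γ, h1, h2, h3⟩ := exists_gapLengths_le q (fun _ : ℕ => hε)
    exact ⟨γ, h1, h2 0, h3, by simp⟩
  obtain ⟨e, he⟩ := hΓ.exists_eq_range hne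
  obtain ⟨γ, h1, h2, h3⟩ := exists_gapLengths_le q (h := fun n => min ε
    ((Finset.range (n + 1)).inf' Finset.nonempty_range_add_one (fun k => η (e k) n) / (n + 1))) (fun n => by
      refine lt_min hε (div_pos ?_ (by positivity))
      rw [Finset.lt_inf'_iff]
      exact fun k _ => hη0 _ _)
  refine ⟨γ, h1, (h2 0).trans (min_le_left _ _), h3, fun γ' hγ' => ?_⟩
  obtain ⟨k, rfl⟩ : ∃ k, e k = γ' := by rw [he] at hγ'; exact hγ'
  filter_upwards [eventually_ge_atTop k] with n hn y hy
  have hle : (n + 1) * γ n ≤ η (e k) n := by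
    have h4 := (h2 n).trans (min_le_right _ _)
    rw [le_div_iff₀ (by positivity)] at h4
    have h5 := Finset.inf'_le (fun k => η (e k) n)
      (show k ∈ Finset.range (n + 1) by simp; omega)
    linarith
  obtain ⟨z, hz1, hz2, hz3⟩ := hη (e k) n hγ' y hy
  exact ⟨z, hz1, by linarith, hz3.mono_left (Ioo_subset_Ioo_right (by linarith))⟩

end Images

/-! ### Systems of threads -/

/-- The set `s` is a pair of points of `M`, not both in `M'`, at `d`-distance in `(0, 1/2]`. -/
def IsNewPair {X : Type*} (d : X → X → ℝ) (M' M s : Set X) : Prop :=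
  ∃ p ∈ M, ∃ z ∈ M \ M', s = {p, z} ∧ 0 < d p z ∧ d p z ≤ 1 / 2

/-- The maps `f s γ` parametrize the threads by which `Y` arises from `M` in the successor step of
the skein construction, the distances being measured by `d`. -/
structure IsThreadSystem {X : Type*} (q : ℕ ≃ Ioo (0 : ℚ) 1) (d : X → X → ℝ) (M' M Y : Set X)
    (A B : Set X → X) (f : Set X → (ℕ → ℝ) → ℝ → X) : Prop where
  pair : ∀ s, IsNewPair d M' M s → s = {A s, B s}
  zero : ∀ s, IsNewPair d M' M s → ∀ γ ∈ GapLengths q, f s γ 0 = A s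
  one : ∀ s, IsNewPair d M' M s → ∀ γ ∈ GapLengths q, f s γ 1 = B s
  dist_thread : ∀ s, IsNewPair d M' M s → ∀ γ ∈ GapLengths q, ∀ t ∈ threadSet q γ,
    ∀ t' ∈ threadSet q γ, d (f s γ t) (f s γ t') = threadDist 1 (d (A s) (B s)) t t'
  mem_iff : ∀ x, x ∈ Y ↔ x ∈ M ∨ ∃ s, IsNewPair d M' M s ∧ ∃ γ ∈ GapLengths q,
    ∃ t ∈ threadSet q γ, x = f s γ t
  endpoint : ∀ s, IsNewPair d M' M s → ∀ γ ∈ GapLengths q, ∀ t ∈ threadSet q γ,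
    f s γ t ∈ M → t = 0 ∨ t = 1
  dist_base : ∀ s, IsNewPair d M' M s → ∀ γ ∈ GapLengths q, ∀ t ∈ threadSet q γ, ∀ z ∈ M,
    ∃ w ∈ s, d (f s γ t) z = d (f s γ t) w + d w z
  dist_pieces : ∀ s, IsNewPair d M' M s → ∀ γ ∈ GapLengths q, ∀ t ∈ threadSet q γ,
    ∀ s', IsNewPair d M' M s' → ∀ γ' ∈ GapLengths q, ∀ t' ∈ threadSet q γ', (s, γ) ≠ (s', γ') →
    ∃ w ∈ s, ∃ w' ∈ s', d (f s γ t) (f s' γ' t') =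
      d (f s γ t) w + d w w' + d w' (f s' γ' t')

section ThreadSystem

theorem IsNewPair.subset {X : Type*} {M' M : Set X} {d : X → X → ℝ} {s : Set X}
    (hs : IsNewPair d M' M s) : s ⊆ M := by
  obtain ⟨p, hp, z, hz, rfl, -, -⟩ := hs
  rintro x (rfl | rfl)
  exacts [hp, hz.1]

variable {X : Type*} [MetricSpace X] {q : ℕ ≃ Ioo (0 : ℚ) 1} {M' M Y : Set X}

/-- The two nested attachments are flattened into one, with threads indexed by a pair and a gap
sequence. Distances between threads over the same pair come from the threading space, those over
different pairs from the skein step. -/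
theorem IsSkeinSucc.exists_threadSystem [Nonempty X] (h : IsSkeinSucc q M' M Y) :
    ∃ A B f, IsThreadSystem q dist M' M Y A B f := by
  classical
  obtain ⟨Th, hTh, hY⟩ := h
  choose A B hAB T hT hN using hTh
  choose f hf0 hf1 hfT hfd using hT
  have hsub : ∀ s : newPairs M' M, s.1 ⊆ M := fun s => IsNewPair.subset (d := dist) s.2
  have hA : ∀ s : newPairs M' M, A s ∈ s.1 := fun s => by rw [hAB s]; simp
  have hB : ∀ s : newPairs M' M, B s ∈ s.1 := fun s => by rw [hAB s]; simp
  have hThs : ∀ s γ, ∀ t ∈ threadSet q γ.1, f s γ t ∈ T s γ := fun s γ t ht => by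
    rw [← hfT]; exact mem_image_of_mem _ ht
  have hTTh : ∀ s γ, T s γ ⊆ Th s := fun s γ => by
    rw [(hN s).union]; exact (subset_iUnion _ γ).trans subset_union_right
  have hmem : ∀ s γ, ∀ t ∈ threadSet q γ.1, f s γ t ∈ M → f s γ t ∈ s.1 := fun s γ t ht hM => by
    rw [← hY.inter_base s]; exact ⟨hTTh s γ (hThs s γ t ht), hM⟩
  have hbase : ∀ s γ, ∀ t ∈ threadSet q γ.1, ∀ z ∈ M,
      ∃ w ∈ s.1, dist (f s γ t) z = dist (f s γ t) w + dist w z := fun s γ t ht z hz => by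
    by_cases hM : f s γ t ∈ M
    · exact ⟨f s γ t, hmem s γ t ht hM, by simp⟩
    · exact (hY.dist_base s _ ⟨hTTh s γ (hThs s γ t ht), fun h => hM (hsub s h)⟩ z hz).1
  have hpieces : ∀ s γ, ∀ t ∈ threadSet q γ.1, ∀ s' γ', ∀ t' ∈ threadSet q γ'.1,
      (s ≠ s' ∨ γ ≠ γ') → ∃ w ∈ s.1, ∃ w' ∈ s'.1, dist (f s γ t) (f s' γ' t') =
        dist (f s γ t) w + dist w w' + dist w' (f s' γ' t') := by
    intro s γ t ht s' γ' t' ht' hne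
    -- A point of a thread that lies in `M` belongs to its pair, so it serves as its own anchor and
    -- that part of the chain degenerates.
    by_cases hM : f s γ t ∈ M
    · obtain ⟨w', hw', h⟩ := hbase s' γ' t' ht' _ hM
      exact ⟨_, hmem s γ t ht hM, w', hw', by
        rw [dist_self, zero_add, dist_comm, h, dist_comm w', dist_comm w', add_comm]⟩
    by_cases hM' : f s' γ' t' ∈ M
    · obtain ⟨w, hw, h⟩ := hbase s γ t ht _ hM'
      exact ⟨w, hw, _, hmem s' γ' t' ht' hM', by rw [dist_self, add_zero, h]⟩
    have h1 : f s γ t ∉ s.1 := fun h => hM (hsub s h)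
    have h2 : f s' γ' t' ∉ s'.1 := fun h => hM' (hsub s' h)
    by_cases hs : s = s'
    · subst hs
      have hγ : γ ≠ γ' := by simpa using hne
      have := ((hN s).dist_pieces γ γ' hγ (f s γ t) ⟨hThs s γ t ht, ?_⟩ (f s γ' t')
        ⟨hThs s γ' t' ht', ?_⟩).1
      · rw [← hAB s] at this
        exact this
      · rwa [← hAB s]
      · rwa [← hAB s]
    · exact (hY.dist_pieces s s' hs _ ⟨hTTh s γ (hThs s γ t ht), h1⟩ _
        ⟨hTTh s' γ' (hThs s' γ' t' ht'), h2⟩).1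
  have hend : ∀ s γ, ∀ t ∈ threadSet q γ.1, f s γ t ∈ M → t = 0 ∨ t = 1 := by
    intro s γ t ht hM
    have hin := hmem s γ t ht hM
    have ht01 := threadSet_subset ht
    obtain ⟨p, -, z, -, hs, hpos, -⟩ := s.2
    have hABpos : 0 < dist (A s) (B s) := by
      rw [dist_pos]
      intro hEq
      have h1 := hAB s
      rw [hEq, hs] at h1
      have h2 : p = z := by
        have hp : p ∈ ({B s, B s} : Set X) := h1 ▸ (by simp)
        have hz : z ∈ ({B s, B s} : Set X) := h1 ▸ (by simp)
        simp only [mem_insert_iff, mem_singleton_iff, or_self] at hp hz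
        rw [hp, hz]
      rw [h2, dist_self] at hpos
      exact lt_irrefl _ hpos
    have hin' : f s γ t = A s ∨ f s γ t = B s := by
      rw [hAB s] at hin; simpa using hin
    rcases hin' with h | h
    · have h0 := hfd s γ t ht 0 (zero_mem_threadSet γ.2)
      rw [hf0, h, dist_self, threadDist] at h0
      left
      by_contra hne
      have : 0 < t := lt_of_le_of_ne ht01.1 (Ne.symm hne)
      have : 0 < min |t - 0| (min (t + (1 - 0) + dist (A s) (B s))
          (0 + (1 - t) + dist (A s) (B s))) := by
        refine lt_min ?_ (lt_min ?_ ?_)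
        · rw [sub_zero]; exact abs_pos.2 hne
        · linarith
        · linarith [ht01.2]
      linarith
    · have h0 := hfd s γ t ht 1 (one_mem_threadSet γ.2)
      rw [hf1, h, dist_self, threadDist] at h0
      right
      by_contra hne
      have : 0 < min |t - 1| (min (t + (1 - 1) + dist (A s) (B s))
          (1 + (1 - t) + dist (A s) (B s))) := by
        refine lt_min (abs_pos.2 (sub_ne_zero.2 hne)) (lt_min ?_ ?_)
        · linarith [ht01.1]
        · linarith [ht01.2]
      linarith
  refine ⟨fun s => if hs : s ∈ newPairs M' M then A ⟨s, hs⟩ else Classical.arbitrary X,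
    fun s => if hs : s ∈ newPairs M' M then B ⟨s, hs⟩ else Classical.arbitrary X,
    fun s γ t => if h : s ∈ newPairs M' M ∧ γ ∈ GapLengths q then f ⟨s, h.1⟩ ⟨γ, h.2⟩ t
      else Classical.arbitrary X, ?_⟩
  constructor
  · intro s (hs : s ∈ newPairs M' M)
    simp only [hs, dif_pos]
    exact hAB ⟨s, hs⟩
  · intro s (hs : s ∈ newPairs M' M) γ hγ
    simp only [hs, hγ, and_self, dif_pos, hf0]
  · intro s (hs : s ∈ newPairs M' M) γ hγ
    simp only [hs, hγ, and_self, dif_pos, hf1]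
  · intro s (hs : s ∈ newPairs M' M) γ hγ t ht t' ht'
    simp only [hs, hγ, and_self, dif_pos]
    exact hfd ⟨s, hs⟩ ⟨γ, hγ⟩ t ht t' ht'
  · intro x
    rw [hY.union]
    refine or_congr Iff.rfl (mem_iUnion.trans ⟨?_, ?_⟩)
    · rintro ⟨s, hx⟩
      rw [(hN s).union] at hx
      rcases hx with hx | hx
      · rcases hx with rfl | hx
        · obtain ⟨γ, hγ, -⟩ := exists_gapLengths_le q (fun _ => one_pos)
          refine ⟨s, s.2, γ, hγ, 0, zero_mem_threadSet hγ, ?_⟩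
          simp only [s.2, hγ, and_self, dif_pos, hf0]
        · rw [mem_singleton_iff] at hx
          subst hx
          obtain ⟨γ, hγ, -⟩ := exists_gapLengths_le q (fun _ => one_pos)
          refine ⟨s, s.2, γ, hγ, 1, one_mem_threadSet hγ, ?_⟩
          simp only [s.2, hγ, and_self, dif_pos, hf1]
      · obtain ⟨γ, hγ⟩ := mem_iUnion.1 hx
        rw [← hfT] at hγ
        obtain ⟨t, ht, rfl⟩ := hγ
        refine ⟨s, s.2, γ, γ.2, t, ht, ?_⟩
        simp only [s.2, γ.2, and_self, dif_pos]
    · rintro ⟨s, (hs : s ∈ newPairs M' M), γ, hγ, t, ht, rfl⟩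
      simp only [hs, hγ, and_self, dif_pos]
      exact ⟨⟨s, hs⟩, hTTh _ _ (hThs ⟨s, hs⟩ ⟨γ, hγ⟩ t ht)⟩
  · intro s (hs : s ∈ newPairs M' M) γ hγ t ht
    simp only [hs, hγ, and_self, dif_pos]
    exact hend ⟨s, hs⟩ ⟨γ, hγ⟩ t ht
  · intro s (hs : s ∈ newPairs M' M) γ hγ t ht z hz
    simp only [hs, hγ, and_self, dif_pos]
    exact hbase ⟨s, hs⟩ ⟨γ, hγ⟩ t ht z hz
  · intro s (hs : s ∈ newPairs M' M) γ hγ t ht s' (hs' : s' ∈ newPairs M' M) γ' hγ' t' ht' hne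
    simp only [hs, hγ, hs', hγ', and_self, dif_pos]
    refine hpieces ⟨s, hs⟩ ⟨γ, hγ⟩ t ht ⟨s', hs'⟩ ⟨γ', hγ'⟩ t' ht' ?_
    by_contra! h
    exact hne (Prod.ext (congrArg Subtype.val h.1) (congrArg Subtype.val h.2))

/-! ### Gates -/

/-- Every short way from `x` to a point of `M` passes through the nearby point `r` of `M`. -/
def IsGate (M : Set X) (x r : X) : Prop :=
  r ∈ M ∧ dist x r < 1 / 4 ∧ ∀ z ∈ M, dist x z < 1 / 2 → dist x z = dist x r + dist r z

/-- Each of the two gates lies on the way to the other. -/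
theorem IsGate.unique {x r r' : X} (h : IsGate M x r) (h' : IsGate M x r') : r = r' := by
  have h1 := h.2.2 r' h'.1 (by linarith [h'.2.1])
  have h2 := h'.2.2 r h.1 (by linarith [h.2.1])
  rw [dist_comm r' r] at h2
  have h3 := dist_nonneg (x := r) (y := r')
  exact dist_le_zero.1 (by linarith)

theorem isGate_self {x : X} (hx : x ∈ M) : IsGate M x x :=
  ⟨hx, by norm_num, fun z _ _ => by simp⟩

/-- `Y` is attached to `M` in a tree-like way at small scales. -/
structure Gated (M Y : Set X) : Prop where
  exists_gate : ∀ x ∈ Y, ∀ z ∈ M, dist x z < 1 / 4 → ∃ r, IsGate M x r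
  dist_eq : ∀ x ∈ Y, ∀ y ∈ Y, ∀ r r', IsGate M x r → IsGate M y r' → dist x y < 1 / 2 →
    r = r' ∨ dist x y = dist x r + dist r r' + dist r' y

/-- At small scales the gate map is 1-Lipschitz; this is what projects Lipschitz curves to earlier
stages. -/
theorem Gated.dist_le (h : Gated M Y) {x y r r' : X} (hx : x ∈ Y) (hy : y ∈ Y)
    (hr : IsGate M x r) (hr' : IsGate M y r') (hxy : dist x y < 1 / 2) :
    dist r r' ≤ dist x y := by
  rcases h.dist_eq x hx y hy r r' hr hr' hxy with rfl | h1
  · rw [dist_self]; exact dist_nonneg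
  · linarith [dist_nonneg (x := x) (y := r), dist_nonneg (x := r') (y := y)]

theorem Gated.refl (M : Set X) : Gated M M where
  exists_gate x hx _ _ _ := ⟨x, isGate_self hx⟩
  dist_eq x hx y hy r r' hr hr' _ := by
    rw [hr.unique (isGate_self hx), hr'.unique (isGate_self hy)]
    simp

/-- The gate in `M` of the gate in `Y` is the gate in `M`; the bound `1 / 4` survives because the
way to a nearby point of `M` passes through both. -/
theorem Gated.trans {Z : Set X} (hMY : M ⊆ Y) (h : Gated M Y) (h' : Gated Y Z) :
    Gated M Z := by
  have comp : ∀ x ∈ Z, ∀ z ∈ M, dist x z < 1 / 4 →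
      ∃ a r, IsGate Y x a ∧ IsGate M a r ∧ IsGate M x r := by
    intro x hx z hz hxz
    obtain ⟨a, ha⟩ := h'.exists_gate x hx z (hMY hz) hxz
    have h1 := ha.2.2 z (hMY hz) (by linarith)
    have h1' := dist_nonneg (x := x) (y := a)
    obtain ⟨r, hr⟩ := h.exists_gate a ha.1 z hz (by linarith)
    have h2 := hr.2.2 z hz (by linarith)
    refine ⟨a, r, ha, hr, hr.1, ?_, fun z' hz' hxz' => ?_⟩
    · linarith [dist_triangle x a r, dist_nonneg (x := r) (y := z)]
    · have h3 := ha.2.2 z' (hMY hz') hxz'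
      have h4 := hr.2.2 z' hz' (by linarith)
      linarith [dist_triangle x a r, dist_triangle x r z']
  refine ⟨fun x hx z hz hxz => ?_, fun x hx y hy r r' hr hr' hxy => ?_⟩
  · obtain ⟨a, r, -, -, hr⟩ := comp x hx z hz hxz
    exact ⟨r, hr⟩
  · obtain ⟨a, ρ, ha, haρ, hρ⟩ := comp x hx r hr.1 hr.2.1
    obtain ⟨a', ρ', ha', haρ', hρ'⟩ := comp y hy r' hr'.1 hr'.2.1
    obtain rfl := hρ.unique hr
    obtain rfl := hρ'.unique hr'
    rcases h'.dist_eq x hx y hy a a' ha ha' hxy with rfl | h1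
    · exact Or.inl (haρ.unique haρ')
    · have h2 := dist_nonneg (x := x) (y := a)
      have h3 := dist_nonneg (x := a') (y := y)
      rcases h.dist_eq a ha.1 a' ha'.1 ρ ρ' haρ haρ' (by linarith) with h4 | h4
      · exact Or.inl h4
      · refine Or.inr (le_antisymm ?_ ?_)
        · linarith [dist_triangle x ρ y, dist_triangle ρ ρ' y]
        · linarith [dist_triangle x a ρ, dist_triangle ρ' a' y]

/-- The gates of a convergent sequence form a Cauchy sequence because the gate map is 1-Lipschitz,
and their limit inherits the gate property. -/
theorem Gated.exists_seq [CompleteSpace X] (hM : IsClosed M) (h : Gated M Y) {x z : X}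
    (hx : x ∈ closure Y) (hz : z ∈ M) (hxz : dist x z < 1 / 4) :
    ∃ (xs rs : ℕ → X) (r : X), (∀ n, xs n ∈ Y ∧ IsGate M (xs n) (rs n)) ∧
      Tendsto xs atTop (𝓝 x) ∧ Tendsto rs atTop (𝓝 r) ∧ IsGate M x r := by
  obtain ⟨xs', hxs', hlim'⟩ := mem_closure_iff_seq_limit.1 hx
  have hev : ∀ᶠ n in atTop, dist (xs' n) z < 1 / 4 :=
    (hlim'.dist tendsto_const_nhds).eventually (gt_mem_nhds hxz)
  obtain ⟨N, hN⟩ := eventually_atTop.1 hev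
  let xs : ℕ → X := fun n => xs' (n + N)
  have hlim : Tendsto xs atTop (𝓝 x) := hlim'.comp (tendsto_add_atTop_nat N)
  have hxs : ∀ n, xs n ∈ Y := fun n => hxs' _
  have hd : ∀ n, dist (xs n) z < 1 / 4 := fun n => hN _ (by omega)
  choose rs hrs using fun n => h.exists_gate (xs n) (hxs n) z hz (hd n)
  have hcau : CauchySeq rs := by
    rw [Metric.cauchySeq_iff']
    intro ε hε
    obtain ⟨N', hN'⟩ := Metric.cauchySeq_iff'.1 hlim.cauchySeq (min ε (1 / 2)) (by positivity)
    refine ⟨N', fun n hn => ?_⟩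
    have h1 := lt_min_iff.1 (hN' n hn)
    exact (h.dist_le (hxs n) (hxs N') (hrs n) (hrs N') h1.2).trans_lt h1.1
  obtain ⟨r, hr⟩ := cauchySeq_tendsto_of_complete hcau
  have hgate : ∀ z' ∈ M, dist x z' < 1 / 2 → dist x z' = dist x r + dist r z' := by
    intro z' hz' hxz'
    have hev' : ∀ᶠ n in atTop, dist (xs n) z' < 1 / 2 :=
      (hlim.dist tendsto_const_nhds).eventually (gt_mem_nhds hxz')
    refine tendsto_nhds_unique_of_eventuallyEq (hlim.dist tendsto_const_nhds)
      ((hlim.dist hr).add (hr.dist tendsto_const_nhds)) ?_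
    filter_upwards [hev'] with n hn
    exact (hrs n).2.2 z' hz' hn
  refine ⟨xs, rs, r, fun n => ⟨hxs n, hrs n⟩, hlim, hr,
    hM.mem_of_tendsto hr (Eventually.of_forall fun n => (hrs n).1), ?_, hgate⟩
  -- The limit alone would give only `≤ 1 / 4`; strictness holds because `r` lies on the way from
  -- `x` to `z`.
  linarith [hgate z hz (by linarith), dist_nonneg (x := r) (y := z)]

theorem Gated.closure [CompleteSpace X] (hM : IsClosed M) (h : Gated M Y) :
    Gated M (closure Y) := by
  refine ⟨fun x hx z hz hxz => ?_, fun x hx y hy r r' hr hr' hxy => ?_⟩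
  · obtain ⟨-, -, r, -, -, -, hr⟩ := h.exists_seq hM hx hz hxz
    exact ⟨r, hr⟩
  · obtain ⟨xs, rs, ρ, h1, hxs, hrs, hρ⟩ := h.exists_seq hM hx hr.1 hr.2.1
    obtain ⟨ys, rs', ρ', h1', hys, hrs', hρ'⟩ := h.exists_seq hM hy hr'.1 hr'.2.1
    obtain rfl := hρ.unique hr
    obtain rfl := hρ'.unique hr'
    by_contra! hne
    have hev : ∀ᶠ n in atTop, dist (xs n) (ys n) < 1 / 2 :=
      (hxs.dist hys).eventually (gt_mem_nhds hxy)
    -- Distinct limiting gates force distinct gates eventually, so the additive alternative holds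
    -- along the sequence and passes to the limit.
    have hev' : ∀ᶠ n in atTop, rs n ≠ rs' n := by
      have := (hrs.dist hrs').eventually (lt_mem_nhds (dist_pos.2 hne.1))
      filter_upwards [this] with n hn using dist_pos.1 hn
    refine hne.2 (tendsto_nhds_unique_of_eventuallyEq (hxs.dist hys)
      (((hxs.dist hrs).add (hrs.dist hrs')).add (hrs'.dist hys)) ?_)
    filter_upwards [hev, hev'] with n hn hn'
    exact (h.dist_eq _ (h1 n).1 _ (h1' n).1 _ _ (h1 n).2 (h1' n).2 hn).resolve_left hn'

theorem Gated.mono {Z : Set X} (hZ : Z ⊆ Y) (h : Gated M Y) : Gated M Z :=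
  ⟨fun x hx => h.exists_gate x (hZ hx), fun x hx y hy => h.dist_eq x (hZ hx) y (hZ hy)⟩

/-! ### The successor step -/

namespace IsThreadSystem

variable {A B : Set X → X} {f : Set X → (ℕ → ℝ) → ℝ → X}

theorem subset (h : IsThreadSystem q dist M' M Y A B f) : M ⊆ Y :=
  fun x hx => (h.mem_iff x).2 (Or.inl hx)

theorem left_mem (h : IsThreadSystem q dist M' M Y A B f) {s : Set X}
    (hs : IsNewPair dist M' M s) : A s ∈ s := by
  have : A s ∈ ({A s, B s} : Set X) := by simp
  rwa [← h.pair s hs] at this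

theorem right_mem (h : IsThreadSystem q dist M' M Y A B f) {s : Set X}
    (hs : IsNewPair dist M' M s) : B s ∈ s := by
  have : B s ∈ ({A s, B s} : Set X) := by simp
  rwa [← h.pair s hs] at this

theorem dist_left (h : IsThreadSystem q dist M' M Y A B f) {s : Set X}
    (hs : IsNewPair dist M' M s) {γ : ℕ → ℝ} (hγ : γ ∈ GapLengths q) {t : ℝ}
    (ht : t ∈ threadSet q γ) :
    dist (f s γ t) (A s) = min t (1 - t + dist (A s) (B s)) := by
  have h01 := threadSet_subset ht
  have := dist_nonneg (x := A s) (y := B s)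
  rw [← h.zero s hs γ hγ, h.dist_thread s hs γ hγ t ht 0 (zero_mem_threadSet hγ), h.zero s hs γ hγ,
    threadDist, sub_zero, abs_of_nonneg h01.1, min_eq_right (a := t + (1 - 0) + _)]
  · simp
  · linarith [h01.1]

theorem dist_right (h : IsThreadSystem q dist M' M Y A B f) {s : Set X}
    (hs : IsNewPair dist M' M s) {γ : ℕ → ℝ} (hγ : γ ∈ GapLengths q) {t : ℝ}
    (ht : t ∈ threadSet q γ) :
    dist (f s γ t) (B s) = min (1 - t) (t + dist (A s) (B s)) := by
  have h01 := threadSet_subset ht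
  have := dist_nonneg (x := A s) (y := B s)
  rw [← h.one s hs γ hγ, h.dist_thread s hs γ hγ t ht 1 (one_mem_threadSet hγ), h.one s hs γ hγ,
    threadDist, abs_sub_comm, abs_of_nonneg (by linarith [h01.2]), min_eq_left (a := t + (1 - 1) + _)]
  · simp
  · linarith [h01.2]

/-- From a point in the half of the thread next to one end, the other end is at least `1 / 2` away
along the thread. A shorter distance therefore uses the jump from the near end. -/
theorem dist_near_end (h : IsThreadSystem q dist M' M Y A B f) {s : Set X}
    (hs : IsNewPair dist M' M s) {γ : ℕ → ℝ} (hγ : γ ∈ GapLengths q) {t : ℝ}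
    (ht : t ∈ threadSet q γ) {w : X} (hw : w ∈ s) (hlt : dist (f s γ t) w < 1 / 2) :
    dist (f s γ t) w = dist (f s γ t) (if t ≤ 1 / 2 then A s else B s) +
      dist (if t ≤ 1 / 2 then A s else B s) w := by
  have h01 := threadSet_subset ht
  have hnn := dist_nonneg (x := A s) (y := B s)
  rw [h.pair s hs] at hw
  have hl := h.dist_left hs hγ ht
  have hr := h.dist_right hs hγ ht
  split_ifs with hle
  · rcases hw with rfl | hw
    · simp
    · rw [mem_singleton_iff] at hw
      subst hw
      rw [hl, min_eq_left (by linarith)]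
      rw [hr] at hlt ⊢
      rcases min_choice (1 - t) (t + dist (A s) (B s)) with hm | hm
      · linarith
      · exact hm
  · rcases hw with rfl | hw
    · rw [hr, min_eq_left (by linarith), dist_comm (B s)]
      rw [hl] at hlt ⊢
      rcases min_choice t (1 - t + dist (A s) (B s)) with hm | hm
      · linarith
      · exact hm
    · rw [mem_singleton_iff] at hw
      subst hw
      simp

theorem exists_chart (h : IsThreadSystem q dist M' M Y A B f) {x : X} (hx : x ∈ Y) (hxM : x ∉ M) :
    ∃ s, IsNewPair dist M' M s ∧ ∃ γ ∈ GapLengths q, ∃ t ∈ threadSet q γ, x = f s γ t :=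
  ((h.mem_iff x).1 hx).resolve_left hxM

theorem end_mem (h : IsThreadSystem q dist M' M Y A B f) {s : Set X}
    (hs : IsNewPair dist M' M s) (t : ℝ) : (if t ≤ 1 / 2 then A s else B s) ∈ s := by
  split_ifs
  exacts [h.left_mem hs, h.right_mem hs]

theorem dist_base_near (h : IsThreadSystem q dist M' M Y A B f) {s : Set X}
    (hs : IsNewPair dist M' M s) {γ : ℕ → ℝ} (hγ : γ ∈ GapLengths q) {t : ℝ}
    (ht : t ∈ threadSet q γ) {z : X} (hz : z ∈ M) (hlt : dist (f s γ t) z < 1 / 2) :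
    dist (f s γ t) z = dist (f s γ t) (if t ≤ 1 / 2 then A s else B s) +
      dist (if t ≤ 1 / 2 then A s else B s) z := by
  obtain ⟨w, hw, hd⟩ := h.dist_base s hs γ hγ t ht z hz
  have hnn := dist_nonneg (x := w) (y := z)
  have h1 := h.dist_near_end hs hγ ht hw (by linarith)
  have h2 := dist_triangle (if t ≤ 1 / 2 then A s else B s) w z
  have h3 := dist_triangle (f s γ t) (if t ≤ 1 / 2 then A s else B s) z
  linarith

theorem isGate (h : IsThreadSystem q dist M' M Y A B f) {s : Set X}
    (hs : IsNewPair dist M' M s) {γ : ℕ → ℝ} (hγ : γ ∈ GapLengths q) {t : ℝ}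
    (ht : t ∈ threadSet q γ) {z : X} (hz : z ∈ M) (hlt : dist (f s γ t) z < 1 / 4) :
    IsGate M (f s γ t) (if t ≤ 1 / 2 then A s else B s) := by
  refine ⟨hs.subset (h.end_mem hs t), ?_, fun z' hz' hlt' => h.dist_base_near hs hγ ht hz' hlt'⟩
  have := h.dist_base_near hs hγ ht hz (by linarith)
  linarith [dist_nonneg (x := if t ≤ 1 / 2 then A s else B s) (y := z)]

/-- Both points are within `1 / 4` of opposite ends, so the direct route along the thread is longer
than `1 / 2` and the minimum is attained by the route through the ends. -/
theorem dist_across (h : IsThreadSystem q dist M' M Y A B f) {s : Set X}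
    (hs : IsNewPair dist M' M s) {γ : ℕ → ℝ} (hγ : γ ∈ GapLengths q) {t t' : ℝ}
    (ht : t ∈ threadSet q γ) (ht' : t' ∈ threadSet q γ) (h1 : t ≤ 1 / 2) (h2 : ¬t' ≤ 1 / 2)
    (hA : dist (f s γ t) (A s) < 1 / 4) (hB : dist (f s γ t') (B s) < 1 / 4)
    (hlt : dist (f s γ t) (f s γ t') < 1 / 2) :
    dist (f s γ t) (f s γ t') = dist (f s γ t) (A s) + dist (A s) (B s) +
      dist (B s) (f s γ t') := by
  have h01 := threadSet_subset ht
  have h01' := threadSet_subset ht'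
  have hnn := dist_nonneg (x := A s) (y := B s)
  have hl := h.dist_left hs hγ ht
  have hr := h.dist_right hs hγ ht'
  rw [min_eq_left (by linarith)] at hl hr
  have hd := h.dist_thread s hs γ hγ t ht t' ht'
  have habs : |t - t'| = t' - t := by rw [abs_sub_comm, abs_of_nonneg (by linarith)]
  rw [threadDist, habs] at hd
  rw [hd] at hlt ⊢
  rw [dist_comm (B s), hl, hr]
  rw [hl] at hA
  rw [hr] at hB
  rcases min_choice (t' - t) (min (t + (1 - t') + dist (A s) (B s))
    (t' + (1 - t) + dist (A s) (B s))) with h3 | h3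
  · linarith
  · rw [h3, min_eq_left (by linarith)]
    ring

/-- The gate of a thread point close to `M` is the end of its half of the thread. Different threads
communicate only through `M`, and opposite halves of one thread are covered by `dist_across`. -/
theorem gated (h : IsThreadSystem q dist M' M Y A B f) : Gated M Y := by
  refine ⟨fun x hx z hz hxz => ?_, fun x hx y hy r r' hr hr' hxy => ?_⟩
  · by_cases hxM : x ∈ M
    · exact ⟨x, isGate_self hxM⟩
    · obtain ⟨s, hs, γ, hγ, t, ht, rfl⟩ := h.exists_chart hx hxM
      exact ⟨_, h.isGate hs hγ ht hz hxz⟩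
  · by_cases hxM : x ∈ M
    · obtain rfl := (isGate_self hxM).unique hr
      right
      rw [dist_self, zero_add, dist_comm, hr'.2.2 x hxM (by rwa [dist_comm]), dist_comm y,
        add_comm, dist_comm]
    by_cases hyM : y ∈ M
    · obtain rfl := (isGate_self hyM).unique hr'
      right
      rw [dist_self, add_zero, hr.2.2 y hyM hxy]
    obtain ⟨s, hs, γ, hγ, t, ht, rfl⟩ := h.exists_chart hx hxM
    obtain ⟨s', hs', γ', hγ', t', ht', rfl⟩ := h.exists_chart hy hyM
    obtain rfl := (h.isGate hs hγ ht hr.1 hr.2.1).unique hr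
    obtain rfl := (h.isGate hs' hγ' ht' hr'.1 hr'.2.1).unique hr'
    by_cases hne : (s, γ) = (s', γ')
    · simp only [Prod.mk.injEq] at hne
      obtain ⟨rfl, rfl⟩ := hne
      have hg := hr.2.1
      have hg' := hr'.2.1
      clear hr hr'
      by_cases h1 : t ≤ 1 / 2 <;> by_cases h2 : t' ≤ 1 / 2
      · exact Or.inl (by rw [if_pos h1, if_pos h2])
      · rw [if_pos h1] at hg ⊢
        rw [if_neg h2] at hg' ⊢
        exact Or.inr (h.dist_across hs hγ ht ht' h1 h2 hg hg' hxy)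
      · rw [if_neg h1] at hg ⊢
        rw [if_pos h2] at hg' ⊢
        right
        rw [dist_comm, h.dist_across hs hγ ht' ht h2 h1 hg' hg (by rwa [dist_comm]),
          dist_comm (f s γ t), dist_comm (B s) (A s), dist_comm (A s) (f s γ t')]
        ring
      · exact Or.inl (by rw [if_neg h1, if_neg h2])
    · right
      obtain ⟨w, hw, w', hw', hd⟩ := h.dist_pieces s hs γ hγ t ht s' hs' γ' hγ' t' ht' hne
      have n1 := dist_nonneg (x := f s γ t) (y := w)
      have n2 := dist_nonneg (x := w) (y := w')
      have n3 := dist_nonneg (x := w') (y := f s' γ' t')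
      have e1 := h.dist_near_end hs hγ ht hw (by linarith)
      have e2 := h.dist_near_end hs' hγ' ht' hw' (by rw [dist_comm]; linarith)
      set g := if t ≤ 1 / 2 then A s else B s
      set g' := if t' ≤ 1 / 2 then A s' else B s'
      rw [dist_comm (f s' γ' t'), dist_comm (f s' γ' t') g', dist_comm g' w'] at e2
      refine le_antisymm ?_ ?_
      · linarith [dist_triangle (f s γ t) g (f s' γ' t'), dist_triangle g g' (f s' γ' t')]
      · linarith [dist_triangle g w g', dist_triangle w w' g']

theorem lipschitzOnWith_thread (h : IsThreadSystem q dist M' M Y A B f) {s : Set X}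
    (hs : IsNewPair dist M' M s) {γ : ℕ → ℝ} (hγ : γ ∈ GapLengths q) :
    LipschitzOnWith 1 (f s γ) (threadSet q γ) :=
  LipschitzOnWith.of_dist_le_mul fun t ht t' ht' => by
    rw [h.dist_thread s hs γ hγ t ht t' ht', NNReal.coe_one, one_mul]
    exact min_le_left _ _

theorem isCompact_thread (h : IsThreadSystem q dist M' M Y A B f) {s : Set X}
    (hs : IsNewPair dist M' M s) {γ : ℕ → ℝ} (hγ : γ ∈ GapLengths q) :
    IsCompact (f s γ '' threadSet q γ) :=
  isCompact_threadSet.image_of_continuousOn (h.lipschitzOnWith_thread hs hγ).continuousOn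

/-- Near a point off `M`, points of distinct threads are far apart, as a way between them passes
through `M`. So a limit point outside `M` is a limit of points of a single thread, which is compact.
-/
theorem isClosed (h : IsThreadSystem q dist M' M Y A B f) (hM : IsClosed M) : IsClosed Y := by
  refine isClosed_of_closure_subset fun x hx => ?_
  by_contra hxY
  obtain ⟨ε, hε, hball⟩ := Metric.isOpen_iff.1 hM.isOpen_compl x fun hxM => hxY (h.subset hxM)
  have hfar : ∀ w ∈ M, ε ≤ dist w x := fun w hw => by
    by_contra! hlt
    exact hball hlt hw
  obtain ⟨y, hy, hxy⟩ := Metric.mem_closure_iff.1 hx (ε / 4) (by positivity)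
  obtain ⟨s, hs, γ, hγ, t, ht, rfl⟩ := h.exists_chart hy fun hyM => by
    linarith [hfar y hyM, dist_comm x y]
  have hT := (h.isCompact_thread hs hγ).isClosed
  have hxT : x ∈ f s γ '' threadSet q γ := by
    rw [← hT.closure_eq, Metric.mem_closure_iff]
    intro δ hδ
    obtain ⟨y', hy', hxy'⟩ := Metric.mem_closure_iff.1 hx (min δ (ε / 4)) (by positivity)
    rw [lt_min_iff] at hxy'
    refine ⟨y', ?_, hxy'.1⟩
    obtain ⟨s', hs', γ', hγ', t', ht', rfl⟩ := h.exists_chart hy' fun hyM => by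
      linarith [hfar y' hyM, dist_comm x y']
    by_cases hne : (s, γ) = (s', γ')
    · simp only [Prod.mk.injEq] at hne
      obtain ⟨rfl, rfl⟩ := hne
      exact mem_image_of_mem _ ht'
    · exfalso
      obtain ⟨w, hw, w', hw', hd⟩ := h.dist_pieces s hs γ hγ t ht s' hs' γ' hγ' t' ht' hne
      have h1 := hfar w (hs.subset hw)
      linarith [dist_triangle x (f s γ t) w, dist_comm x w,
        dist_triangle_left (f s γ t) (f s' γ' t') x,
        dist_nonneg (x := w) (y := w'), dist_nonneg (x := w') (y := f s' γ' t')]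
  obtain ⟨t', ht', rfl⟩ := hxT
  exact hxY ((h.mem_iff _).2 (Or.inr ⟨s, hs, γ, hγ, t', ht', rfl⟩))

end IsThreadSystem

end ThreadSystem

/-! ### Null images -/

section NullImages

variable {X : Type*} [MetricSpace X] {q : ℕ ≃ Ioo (0 : ℚ) 1} {M' M Y : Set X}
  {A B : Set X → X} {f : Set X → (ℕ → ℝ) → ℝ → X}

theorem IsThreadSystem.le_dist_of_ne (h : IsThreadSystem q dist M' M Y A B f) {s s' : Set X}
    (hs : IsNewPair dist M' M s) (hs' : IsNewPair dist M' M s') {γ γ' : ℕ → ℝ}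
    (hγ : γ ∈ GapLengths q) (hγ' : γ' ∈ GapLengths q) {t t' : ℝ} (ht : t ∈ threadSet q γ)
    (ht' : t' ∈ threadSet q γ') (hne : (s, γ) ≠ (s', γ')) :
    Metric.infDist (f s γ t) M ≤ dist (f s γ t) (f s' γ' t') := by
  obtain ⟨w, hw, w', hw', hd⟩ := h.dist_pieces s hs γ hγ t ht s' hs' γ' hγ' t' ht' hne
  have := Metric.infDist_le_dist_of_mem (x := f s γ t) (hs.subset hw)
  linarith [dist_nonneg (x := w) (y := w'), dist_nonneg (x := w') (y := f s' γ' t')]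

/-- Pick a point of `S \ M` on each such thread. Balls around these points with half their distance
to `M` as radius are pairwise disjoint, and a separable space holds only countably many disjoint
nonempty open sets. -/
theorem IsThreadSystem.countable_threads (h : IsThreadSystem q dist M' M Y A B f)
    (hM : IsClosed M) {S : Set X} (hS : TopologicalSpace.IsSeparable S) :
    {i : Set X × (ℕ → ℝ) | IsNewPair dist M' M i.1 ∧ i.2 ∈ GapLengths q ∧
      ∃ t ∈ threadSet q i.2, f i.1 i.2 t ∈ S \ M}.Countable := by
  set I := {i : Set X × (ℕ → ℝ) | IsNewPair dist M' M i.1 ∧ i.2 ∈ GapLengths q ∧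
      ∃ t ∈ threadSet q i.2, f i.1 i.2 t ∈ S \ M}
  have : TopologicalSpace.SeparableSpace S := hS.separableSpace
  choose! t ht htS using fun (i : Set X × (ℕ → ℝ)) (hi : i ∈ I) => hi.2.2
  have hpos : ∀ i ∈ I, 0 < Metric.infDist (f i.1 i.2 (t i)) M := fun i hi => by
    rw [← hM.notMem_iff_infDist_pos ⟨_, hi.1.subset (h.left_mem hi.1)⟩]
    exact (htS i hi).2
  refine PairwiseDisjoint.countable_of_isOpen
    (s := fun i => {y : S | dist (y : X) (f i.1 i.2 (t i)) <
      Metric.infDist (f i.1 i.2 (t i)) M / 2}) ?_ ?_ ?_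
  · intro i hi j hj hij
    refine disjoint_left.2 fun y hyi hyj => ?_
    simp only [mem_ofPred_eq] at hyi hyj
    have h1 := h.le_dist_of_ne hi.1 hj.1 hi.2.1 hj.2.1 (ht i hi) (ht j hj) hij
    have h2 := h.le_dist_of_ne hj.1 hi.1 hj.2.1 hi.2.1 (ht j hj) (ht i hi) hij.symm
    rw [dist_comm] at h2
    linarith [dist_triangle_left (f i.1 i.2 (t i)) (f j.1 j.2 (t j)) y]
  · exact fun i _ => isOpen_lt (continuous_subtype_val.dist continuous_const) continuous_const
  · intro i hi
    refine ⟨⟨_, (htS i hi).1⟩, ?_⟩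
    simp only [mem_ofPred_eq, dist_self]
    linarith [hpos i hi]

variable [MeasurableSpace X] [BorelSpace X] {γ : ℕ → ℝ} {K : ℝ≥0} {c : ℝ → X}

theorem exists_pos_nnreal_mul_lt (K : ℝ≥0) {ε : ℝ} (hε : 0 < ε) : ∃ δ > 0, K * δ < ε := by
  have : (0 : ℝ) < K + 1 := by positivity
  refine ⟨ε / (K + 1), by positivity, ?_⟩
  rw [mul_div_assoc', div_lt_iff₀ this]
  linarith

/-- Near a parameter sent to the thread off `M`, the gate in `Y` followed by the thread coordinate
is a real Lipschitz map into `threadSet q γ'`, to which the comparison of gaps applies. -/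
theorem IsThreadSystem.hausdorffMeasure_thread_eq_zero
    (h : IsThreadSystem q dist M' M Y A B f) (hM : IsClosed M) (hg : Gated Y univ)
    (h0 : ∀ n, 0 < γ n) (hhalf : ∀ n, γ (n + 1) ≤ γ n / 2)
    (hc : LipschitzOnWith K c (threadSet q γ)) {s : Set X} (hs : IsNewPair dist M' M s)
    {γ' : ℕ → ℝ} (hγ' : γ' ∈ GapLengths q) (hfine : EventuallyFiner γ (threadSet q γ')) :
    μH[1] (c '' {u ∈ threadSet q γ | c u ∈ (f s γ' '' threadSet q γ') \ M}) = 0 := by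
  set T := threadSet q γ
  refine hausdorffMeasure_image_eq_zero_of_locally fun u hu => ?_
  obtain ⟨huT, ⟨t₀, ht₀, hcu⟩, huM⟩ := hu
  set ρ := Metric.infDist (c u) M with hρ
  have hρ0 : 0 < ρ :=
    (hM.notMem_iff_infDist_pos ⟨_, hs.subset (h.left_mem hs)⟩).1 huM
  have huY : c u ∈ Y := (h.mem_iff _).2 (Or.inr ⟨s, hs, γ', hγ', t₀, ht₀, hcu.symm⟩)
  obtain ⟨δ, hδ, hKδ⟩ := exists_pos_nnreal_mul_lt K (show 0 < min ρ (1 / 2) / 8 by positivity)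
  have hm1 := min_le_left ρ (1 / 2)
  have hm2 := min_le_right ρ (1 / 2)
  have hclose : ∀ w ∈ T ∩ Ioo (u - δ) (u + δ), dist (c w) (c u) < min ρ (1 / 2) / 8 := by
    intro w hw
    refine ((hc.dist_le_mul w hw.1 u huT).trans ?_).trans_lt hKδ
    gcongr
    rw [Real.dist_eq, abs_le]
    constructor <;> linarith [hw.2.1, hw.2.2]
  -- The curve may leave `Y` close to `u`, but its gates stay on the same thread. The coordinate is
  -- thus defined on all of `T ∩ Ioo (u - δ) (u + δ)`, as needed to compare gaps over whole
  -- intervals.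
  have hgate : ∀ w ∈ T ∩ Ioo (u - δ) (u + δ), ∃ x ∈ threadSet q γ',
      IsGate Y (c w) (f s γ' x) ∧ dist (f s γ' x) (c u) < ρ / 8 := by
    intro w hw
    have h1 := hclose w hw
    obtain ⟨r, hr⟩ := hg.exists_gate (c w) trivial (c u) huY (by linarith)
    have h2 := hg.dist_le trivial trivial hr (isGate_self huY) (by linarith)
    have hrM : r ∉ M := fun hrM => by
      have := Metric.infDist_le_dist_of_mem (x := c u) hrM
      rw [dist_comm] at this
      linarith
    obtain ⟨s₁, hs₁, γ₁, hγ₁, t₁, ht₁, rfl⟩ := h.exists_chart hr.1 hrM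
    by_cases hne : (s, γ') = (s₁, γ₁)
    · simp only [Prod.mk.injEq] at hne
      obtain ⟨rfl, rfl⟩ := hne
      exact ⟨t₁, ht₁, hr, by linarith⟩
    · exfalso
      have := h.le_dist_of_ne hs hs₁ hγ' hγ₁ ht₀ ht₁ hne
      rw [hcu, dist_comm] at this
      linarith
  choose! x hxT hxg hxd using hgate
  have hx : LipschitzOnWith K x (T ∩ Ioo (u - δ) (u + δ)) := by
    refine LipschitzOnWith.of_dist_le_mul fun w hw w' hw' => ?_
    have h1 := hclose w hw
    have h2 := hclose w' hw'
    have hww : dist (c w) (c w') < 1 / 2 := by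
      linarith [dist_triangle_right (c w) (c w') (c u)]
    have h3 := hg.dist_le trivial trivial (hxg w hw) (hxg w' hw') hww
    have h4 : dist (f s γ' (x w)) (f s γ' (x w')) < ρ / 4 := by
      linarith [dist_triangle_right (f s γ' (x w)) (f s γ' (x w')) (c u), hxd w hw, hxd w' hw']
    have hAB := dist_nonneg (x := A s) (y := B s)
    have hfar : ∀ v ∈ T ∩ Ioo (u - δ) (u + δ), 7 * ρ / 8 ≤ x v ∧ 7 * ρ / 8 ≤ 1 - x v := by
      intro v hv
      have e1 := Metric.infDist_le_dist_of_mem (x := c u) (hs.subset (h.left_mem hs))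
      have e2 := Metric.infDist_le_dist_of_mem (x := c u) (hs.subset (h.right_mem hs))
      have e3 := (h.dist_left hs hγ' (hxT v hv)).trans_le (min_le_left _ _)
      have e4 := (h.dist_right hs hγ' (hxT v hv)).trans_le (min_le_left _ _)
      have e5 := hxd v hv
      constructor
      · linarith [dist_triangle_left (c u) (A s) (f s γ' (x v))]
      · linarith [dist_triangle_left (c u) (B s) (f s γ' (x v))]
    -- The two routes around through the ends cost at least `7 * ρ / 4`, more than the distance
    -- bound `ρ / 4`, so the thread metric agrees here with that of the line.
    have h5 : dist (f s γ' (x w)) (f s γ' (x w')) = dist (x w) (x w') := by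
      rw [h.dist_thread s hs γ' hγ' _ (hxT w hw) _ (hxT w' hw'), threadDist] at h4 ⊢
      have e1 := hfar w hw
      have e2 := hfar w' hw'
      refine min_eq_left ?_
      by_contra! hlt
      rw [min_eq_right hlt.le, min_lt_iff] at h4
      rcases h4 with h4 | h4 <;> linarith
    rw [← h5]
    exact h3.trans (hc.dist_le_mul w hw.1 w' hw'.1)
  have hnull := volume_image_eq_zero_of_eventuallyFiner h0 hhalf threadSet_subset hfine
    ordConnected_Ioo hx hxT
  refine ⟨Ioo (u - δ) (u + δ), Ioo_mem_nhds (by linarith) (by linarith), ?_⟩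
  have hlip : LipschitzOnWith 1 (f s γ') (x '' (T ∩ Ioo (u - δ) (u + δ))) :=
    (h.lipschitzOnWith_thread hs hγ').mono (image_subset_iff.2 hxT)
  have h1 := hlip.hausdorffMeasure_image_le zero_le_one
  rw [hausdorffMeasure_real, hnull, mul_zero] at h1
  refine measure_mono_null ?_ (le_antisymm h1 zero_le)
  rintro _ ⟨w, ⟨⟨hwT, ⟨t, ht, hwt⟩, -⟩, hwI⟩, rfl⟩
  have hwY : c w ∈ Y := (h.mem_iff _).2 (Or.inr ⟨s, hs, γ', hγ', t, ht, hwt.symm⟩)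
  refine ⟨x w, ⟨w, ⟨hwT, hwI⟩, rfl⟩, ?_⟩
  exact (hxg w ⟨hwT, hwI⟩).unique (isGate_self hwY)

theorem IsThreadSystem.hausdorffMeasure_inter_eq_zero
    (h : IsThreadSystem q dist M' M Y A B f) (hM : IsClosed M) (hg : Gated Y univ)
    (h0 : ∀ n, 0 < γ n) (hhalf : ∀ n, γ (n + 1) ≤ γ n / 2)
    (hc : LipschitzOnWith K c (threadSet q γ)) {S : Set X}
    (hS : TopologicalSpace.IsSeparable S) (hcS : MapsTo c (threadSet q γ) S)
    (hfine : ∀ s, IsNewPair dist M' M s → ∀ γ' ∈ GapLengths q, ∀ t ∈ threadSet q γ',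
      f s γ' t ∈ S \ M → EventuallyFiner γ (threadSet q γ'))
    (hnull : μH[1] (c '' threadSet q γ ∩ M) = 0) :
    μH[1] (c '' threadSet q γ ∩ Y) = 0 := by
  have hcount := h.countable_threads hM hS
  set I := {i : Set X × (ℕ → ℝ) | IsNewPair dist M' M i.1 ∧ i.2 ∈ GapLengths q ∧
      ∃ t ∈ threadSet q i.2, f i.1 i.2 t ∈ S \ M}
  have hsub : c '' threadSet q γ ∩ Y ⊆ (c '' threadSet q γ ∩ M) ∪
      ⋃ i ∈ I, c '' {u ∈ threadSet q γ | c u ∈ (f i.1 i.2 '' threadSet q i.2) \ M} := by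
    rintro _ ⟨⟨u, hu, rfl⟩, hY⟩
    by_cases hM' : c u ∈ M
    · exact Or.inl ⟨⟨u, hu, rfl⟩, hM'⟩
    · obtain ⟨s, hs, γ', hγ', t, ht, hut⟩ := h.exists_chart hY hM'
      refine Or.inr (mem_iUnion₂.2 ⟨(s, γ'), ⟨hs, hγ', t, ht, ?_⟩, u, ⟨hu, ⟨t, ht, ?_⟩, hM'⟩, rfl⟩)
      · exact ⟨hut ▸ hcS hu, hut ▸ hM'⟩
      · exact hut.symm
  refine measure_mono_null hsub (measure_union_null hnull ?_)
  rw [measure_biUnion_null_iff hcount]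
  rintro i ⟨hi1, hi2, t, ht, hi3⟩
  exact h.hausdorffMeasure_thread_eq_zero hM hg h0 hhalf hc hi1 hi2
    (hfine i.1 hi1 i.2 hi2 t ht hi3)

/-- Two nearby points of the curve in `Y` are almost in some earlier `M`. The gates in `M` of the
arc between them form a null set, so the distance of the two gates is at most `K` times the total
gap length; the error `ε` is arbitrary. -/
theorem hausdorffMeasure_inter_eq_zero_of_approx {𝓜 : Set (Set X)}
    (hclosed : ∀ M ∈ 𝓜, IsClosed M) (hg : ∀ M ∈ 𝓜, Gated M univ)
    (happrox : ∀ x ∈ Y, ∀ y ∈ Y, ∀ ε > 0, ∃ M ∈ 𝓜, (∃ z ∈ M, dist x z < ε) ∧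
      ∃ z ∈ M, dist y z < ε)
    (h0 : ∀ n, 0 < γ n) (hhalf : ∀ n, γ (n + 1) ≤ γ n / 2)
    (hc : LipschitzOnWith K c (threadSet q γ))
    (hnull : ∀ M ∈ 𝓜, μH[1] (c '' threadSet q γ ∩ M) = 0) :
    μH[1] (c '' threadSet q γ ∩ Y) = 0 := by
  set T := threadSet q γ
  have himage : c '' T ∩ Y = c '' {u ∈ T | c u ∈ Y} := by
    rw [← image_inter_preimage]; rfl
  rw [himage]
  refine hausdorffMeasure_image_eq_zero_of_locally fun u₀ hu₀ => ?_
  obtain ⟨δ, hδ, hKδ⟩ := exists_pos_nnreal_mul_lt K (show (0 : ℝ) < 1 / 32 by norm_num)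
  refine ⟨Ioo (u₀ - δ) (u₀ + δ), Ioo_mem_nhds (by linarith) (by linarith), ?_⟩
  refine hausdorffMeasure_image_eq_zero_of_edist_le (q := q) (K := K) h0 hhalf
    (fun u hu => hu.1.1) ?_
  rintro u ⟨⟨huT, huY⟩, huI⟩ v ⟨⟨hvT, hvY⟩, hvI⟩ huv
  refine ENNReal.le_of_forall_pos_le_add fun ε hε _ => ?_
  obtain ⟨M, hM, ⟨z, hz, huz⟩, z', hz', hvz⟩ := happrox _ huY _ hvY (min (ε / 2) (1 / 8))
    (by positivity)
  rw [lt_min_iff] at huz hvz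
  have hclose : ∀ w ∈ T ∩ Icc u v, ∀ w' ∈ T ∩ Icc u v, dist (c w) (c w') < 1 / 16 := by
    intro w hw w' hw'
    have h1 : dist w w' ≤ 2 * δ := by
      rw [Real.dist_eq, abs_le]
      constructor <;> linarith [hw.2.1, hw.2.2, hw'.2.1, hw'.2.2, huI.1, hvI.2]
    have hK : (0 : ℝ) ≤ K := K.2
    have h2 := mul_le_mul_of_nonneg_left h1 hK
    linarith [hc.dist_le_mul w hw.1 w' hw'.1]
  have huv' : u ∈ T ∩ Icc u v := ⟨huT, left_mem_Icc.2 huv⟩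
  have hvv' : v ∈ T ∩ Icc u v := ⟨hvT, right_mem_Icc.2 huv⟩
  have hgate : ∀ w ∈ T ∩ Icc u v, ∃ r, IsGate M (c w) r := fun w hw =>
    (hg M hM).exists_gate _ trivial z hz (by
      linarith [dist_triangle (c w) (c u) z, hclose w hw u huv'])
  have : Nonempty X := ⟨z⟩
  choose! r hr using hgate
  have hlip : LipschitzOnWith K r (T ∩ Icc u v) :=
    LipschitzOnWith.of_dist_le_mul fun w hw w' hw' =>
      ((hg M hM).dist_le trivial trivial (hr w hw) (hr w' hw')
        (by linarith [hclose w hw w' hw'])).trans (hc.dist_le_mul w hw.1 w' hw'.1)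
  -- Off `M` the gate is locally constant: points with different gates are at least as far apart as
  -- `c w` is from `M`.
  have hcount : (r '' {w ∈ T ∩ Icc u v | c w ∉ M}).Countable := by
    refine countable_image_of_locally_const fun w hw => ?_
    have hρ := ((hclosed M hM).notMem_iff_infDist_pos ⟨z, hz⟩).1 hw.2
    obtain ⟨δ', hδ', hKδ'⟩ := exists_pos_nnreal_mul_lt K hρ
    refine ⟨Ioo (w - δ') (w + δ'), Ioo_mem_nhds (by linarith) (by linarith), ?_⟩
    rintro w' ⟨hw', hwI⟩
    refine (((hg M hM).dist_eq _ trivial _ trivial _ _ (hr w hw.1) (hr w' hw'.1)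
      (by linarith [hclose w hw.1 w' hw'.1])).resolve_right fun heq => ?_).symm
    have h1 := Metric.infDist_le_dist_of_mem (x := c w) (hr w hw.1).1
    have h2 : dist (c w) (c w') ≤ K * δ' := by
      refine (hc.dist_le_mul w hw.1.1 w' hw'.1.1).trans ?_
      gcongr
      rw [Real.dist_eq, abs_le]
      constructor <;> linarith [hwI.1, hwI.2]
    linarith [dist_nonneg (x := r w) (y := r w'), dist_nonneg (x := r w') (y := c w')]
  have hrnull : μH[1] (r '' (T ∩ Icc u v)) = 0 := by
    refine measure_mono_null (t := (c '' T ∩ M) ∪ r '' {w ∈ T ∩ Icc u v | c w ∉ M}) ?_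
      (measure_union_null (hnull M hM) (hausdorffMeasure_eq_zero_of_countable hcount))
    rintro _ ⟨w, hw, rfl⟩
    by_cases hwM : c w ∈ M
    · left
      rw [(hr w hw).unique (isGate_self hwM)]
      exact ⟨⟨w, hw.1, rfl⟩, hwM⟩
    · exact Or.inr ⟨w, ⟨hw, hwM⟩, rfl⟩
  have hmain := edist_le_of_hausdorffMeasure_image_eq_zero huv huT hvT hlip hrnull
  have hu1 := (hr u huv').2.2 z hz (by linarith)
  have hv1 := (hr v hvv').2.2 z' hz' (by linarith)
  have hu2 : edist (c u) (r u) ≤ ENNReal.ofReal (ε / 2) := by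
    rw [edist_dist]
    exact ENNReal.ofReal_le_ofReal (by linarith [dist_nonneg (x := r u) (y := z)])
  have hv2 : edist (r v) (c v) ≤ ENNReal.ofReal (ε / 2) := by
    rw [edist_comm, edist_dist]
    exact ENNReal.ofReal_le_ofReal (by linarith [dist_nonneg (x := r v) (y := z')])
  calc edist (c u) (c v) ≤ edist (c u) (r u) + edist (r u) (r v) + edist (r v) (c v) :=
        edist_triangle4 _ _ _ _
    _ ≤ ENNReal.ofReal (ε / 2) + K * volume (Icc u v \ T) + ENNReal.ofReal (ε / 2) := by
        gcongr
    _ = K * volume (Icc u v \ T) + ε := by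
        rw [add_comm (ENNReal.ofReal _), add_assoc, ← ENNReal.ofReal_add (by positivity)
          (by positivity), add_halves, ENNReal.ofReal_coe_nnreal]

end NullImages

/-! ### Skein towers -/

theorem isSuccLimit_omega_one : Order.IsSuccLimit (Ordinal.omega.{0} 1) := by
  rw [← Cardinal.ord_aleph]
  exact Cardinal.isSuccLimit_ord (Cardinal.aleph0_le_aleph 1)

namespace IsSkeinTower

variable {X : Type*} [MetricSpace X] {q : ℕ ≃ Ioo (0 : ℚ) 1} {β : Ordinal.{0}}
  {Sk : Ordinal.{0} → Set X}

theorem nonempty (h : IsSkeinTower q β Sk) : Nonempty X :=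
  let ⟨A, _⟩ := h.zero; ⟨A⟩

theorem exists_threadSystem (h : IsSkeinTower q β Sk) {α : Ordinal.{0}} (hα : α < β) :
    ∃ A B f, IsThreadSystem q dist (⋃ δ < α, Sk δ) (Sk α) (Sk (Order.succ α)) A B f :=
  have := h.nonempty
  (h.succ α hα).exists_threadSystem

theorem mono (h : IsSkeinTower q β Sk) {δ α : Ordinal.{0}} (hδ : δ ≤ α) (hα : α ≤ β) :
    Sk δ ⊆ Sk α := by
  induction α using Ordinal.limitRecOn with
  | zero => rw [le_zero_iff.1 hδ]
  | add_one α ih =>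
    rw [← Order.succ_eq_add_one] at hδ hα ⊢
    rcases hδ.eq_or_lt with rfl | hlt
    · exact Subset.rfl
    · have hα' : α < β := (Order.lt_succ α).trans_le hα
      obtain ⟨A, B, f, hf⟩ := h.exists_threadSystem hα'
      exact (ih (Order.lt_succ_iff.1 hlt) hα'.le).trans hf.subset
  | limit α hlim _ =>
    rcases hδ.eq_or_lt with rfl | hlt
    · exact Subset.rfl
    · exact (subset_biUnion_of_mem (u := Sk) hlt).trans (h.limit α hα hlim).2.1

theorem isClosed (h : IsSkeinTower q β Sk) {α : Ordinal.{0}} (hα : α ≤ β) : IsClosed (Sk α) := by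
  induction α using Ordinal.limitRecOn with
  | zero =>
    obtain ⟨A, B, -, h0⟩ := h.zero
    rw [h0]
    exact (Set.toFinite _).isClosed
  | add_one α ih =>
    rw [← Order.succ_eq_add_one] at hα ⊢
    have hα' : α < β := (Order.lt_succ α).trans_le hα
    obtain ⟨A, B, f, hf⟩ := h.exists_threadSystem hα'
    exact hf.isClosed (ih hα'.le)
  | limit α hlim _ => exact (h.limit α hα hlim).1.isClosed

theorem gated [CompleteSpace X] (h : IsSkeinTower q β Sk) {δ α : Ordinal.{0}} (hδ : δ ≤ α)
    (hα : α ≤ β) : Gated (Sk δ) (Sk α) := by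
  induction α using Ordinal.limitRecOn with
  | zero => rw [le_zero_iff.1 hδ]; exact Gated.refl _
  | add_one α ih =>
    rw [← Order.succ_eq_add_one] at hδ hα ⊢
    rcases hδ.eq_or_lt with rfl | hlt
    · exact Gated.refl _
    · have hα' : α < β := (Order.lt_succ α).trans_le hα
      obtain ⟨A, B, f, hf⟩ := h.exists_threadSystem hα'
      have hδα := Order.lt_succ_iff.1 hlt
      exact (ih hδα hα'.le).trans (h.mono hδα hα'.le) hf.gated
  | limit α hlim ih =>
    rcases hδ.eq_or_lt with rfl | hlt
    · exact Gated.refl _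
    · refine Gated.mono (h.limit α hα hlim).2.2 (Gated.closure (h.isClosed (hδ.trans hα)) ?_)
      have key : ∀ x ∈ ⋃ ε < α, Sk ε, ∀ y ∈ ⋃ ε < α, Sk ε,
          ∃ ε < α, x ∈ Sk ε ∧ y ∈ Sk ε ∧ Gated (Sk δ) (Sk ε) := by
        intro x hx y hy
        obtain ⟨ε₁, h1, hx⟩ := mem_iUnion₂.1 hx
        obtain ⟨ε₂, h2, hy⟩ := mem_iUnion₂.1 hy
        have h3 : max (max ε₁ ε₂) δ < α := max_lt (max_lt h1 h2) hlt
        exact ⟨_, h3, h.mono ((le_max_left _ _).trans (le_max_left _ _)) (h3.le.trans hα) hx,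
          h.mono ((le_max_right _ _).trans (le_max_left _ _)) (h3.le.trans hα) hy,
          ih _ h3 (le_max_right _ _) (h3.le.trans hα)⟩
      refine ⟨fun x hx => ?_, fun x hx y hy => ?_⟩
      · obtain ⟨ε, -, hxε, -, hg⟩ := key x hx x hx
        exact hg.exists_gate x hxε
      · obtain ⟨ε, -, hxε, hyε, hg⟩ := key x hx y hy
        exact hg.dist_eq x hxε y hyε

theorem gated_univ [CompleteSpace X] (h : IsSkeinTower q β Sk) {α : Ordinal.{0}} (hα : α ≤ β) :
    Gated (Sk α) univ := by
  rw [← h.top]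
  exact h.gated hα le_rfl

open Ordinal in
theorem completeSpace (h : IsSkeinTower q (ω_ 1) Sk) : CompleteSpace X := by
  have := (h.limit (ω_ 1) le_rfl isSuccLimit_omega_one).1
  rw [h.top] at this
  exact completeSpace_iff_isComplete_univ.2 this

open Ordinal in
-- Completion adds nothing at `ω₁`: a convergent sequence from earlier stages lies in one countable
-- stage, which is closed.
theorem iUnion_eq_univ (h : IsSkeinTower q (ω_ 1) Sk) : ⋃ α < ω_ 1, Sk α = Set.univ := by
  refine eq_univ_of_forall fun x => ?_
  have hx : x ∈ closure (⋃ α < ω_ 1, Sk α) :=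
    (h.limit (ω_ 1) le_rfl isSuccLimit_omega_one).2.2 (h.top ▸ mem_univ x)
  obtain ⟨xs, hxs, hlim⟩ := mem_closure_iff_seq_limit.1 hx
  simp only [mem_iUnion] at hxs
  choose δ hδ hxδ using hxs
  have hsup : ⨆ n, δ n < ω_ 1 := iSup_lt_omega_one hδ
  refine mem_iUnion₂.2 ⟨_, hsup, (h.isClosed hsup.le).mem_of_tendsto hlim
    (Eventually.of_forall fun n => h.mono ?_ hsup.le (hxδ n))⟩
  exact le_ciSup (bddAbove_of_small) n

open Ordinal in
theorem exists_subset_of_isSeparable (h : IsSkeinTower q (ω_ 1) Sk) {S : Set X}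
    (hS : TopologicalSpace.IsSeparable S) : ∃ α < ω_ 1, S ⊆ Sk α := by
  obtain ⟨D, hD, hSD⟩ := hS
  have hmem : ∀ x : D, ∃ δ < ω_ 1, (x : X) ∈ Sk δ := fun x => by
    have : (x : X) ∈ ⋃ α < ω_ 1, Sk α := h.iUnion_eq_univ ▸ mem_univ _
    simpa using this
  choose δ hδ hxδ using hmem
  have := hD.to_subtype
  have hsup : ⨆ x, δ x < ω_ 1 := iSup_lt_omega_one hδ
  refine ⟨_, hsup, hSD.trans (closure_minimal (fun x hx => ?_) (h.isClosed hsup.le))⟩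
  exact h.mono (le_ciSup bddAbove_of_small ⟨x, hx⟩) hsup.le (hxδ ⟨x, hx⟩)

end IsSkeinTower

namespace IsSkeinTower

variable {X : Type*} [MetricSpace X] {q : ℕ ≃ Ioo (0 : ℚ) 1} {Sk : Ordinal.{0} → Set X}

/-! ### Lipschitz maps into separable subsets are constant -/

/-- At the least stage containing both points their pair is new, so the next step attaches a thread
of every type to it. -/
theorem exists_thread (h : IsSkeinTower q (Ordinal.omega 1) Sk) {p z : X} (hpz : p ≠ z)
    (hd : dist p z ≤ 1 / 2) {γ : ℕ → ℝ} (hγ : γ ∈ GapLengths q) :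
    ∃ g : ℝ → X, LipschitzOnWith 1 g (threadSet q γ) ∧
      ((g 0 = p ∧ g 1 = z) ∨ (g 0 = z ∧ g 1 = p)) := by
  have hlev : ∀ x : X, ∃ δ < Ordinal.omega 1, x ∈ Sk δ := fun x => by
    have : x ∈ ⋃ α < Ordinal.omega 1, Sk α := h.iUnion_eq_univ ▸ mem_univ _
    simpa using this
  have hex : ∃ α, α < Ordinal.omega 1 ∧ p ∈ Sk α ∧ z ∈ Sk α := by
    obtain ⟨δ, hδ, hp⟩ := hlev p
    obtain ⟨δ', hδ', hz⟩ := hlev z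
    have hmax := max_lt hδ hδ'
    exact ⟨_, hmax, h.mono (le_max_left _ _) hmax.le hp, h.mono (le_max_right _ _) hmax.le hz⟩
  obtain ⟨α, ⟨hα, hp, hz⟩, hmin⟩ := WellFounded.has_min (wellFounded_lt (α := Ordinal.{0}))
    {α | α < Ordinal.omega 1 ∧ p ∈ Sk α ∧ z ∈ Sk α} hex
  have hpos : 0 < dist p z := dist_pos.2 hpz
  have hnew : IsNewPair dist (⋃ δ < α, Sk δ) (Sk α) {p, z} := by
    by_cases hz' : z ∈ ⋃ δ < α, Sk δ
    · by_cases hp' : p ∈ ⋃ δ < α, Sk δ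
      · exfalso
        obtain ⟨δ, hδ, hzδ⟩ := mem_iUnion₂.1 hz'
        obtain ⟨δ', hδ', hpδ⟩ := mem_iUnion₂.1 hp'
        have hmax := max_lt hδ hδ'
        have hle := (hmax.trans hα).le
        exact hmin _ ⟨hmax.trans hα, h.mono (le_max_right _ _) hle hpδ,
          h.mono (le_max_left _ _) hle hzδ⟩ hmax
      · exact ⟨z, hz, p, ⟨hp, hp'⟩, pair_comm _ _, by rwa [dist_comm], by rwa [dist_comm]⟩
    · exact ⟨p, hp, z, ⟨hz, hz'⟩, rfl, hpos, hd⟩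
  obtain ⟨A, B, f, hf⟩ := h.exists_threadSystem hα
  refine ⟨f {p, z} γ, hf.lipschitzOnWith_thread hnew hγ, ?_⟩
  rw [hf.zero _ hnew γ hγ, hf.one _ hnew γ hγ]
  have := hf.pair _ hnew
  rw [Set.pair_eq_pair_iff] at this
  rcases this with ⟨h1, h2⟩ | ⟨h1, h2⟩
  · exact Or.inl ⟨h1.symm, h2.symm⟩
  · exact Or.inr ⟨h2.symm, h1.symm⟩

/-- The heart of the proof: along a thread from `p` to `z` with gaps fine enough for `S`, the image
of `R` is `H¹`-null, and the total gap length is too small to bridge the distance from `R p` to `R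
z`. -/
theorem dist_le_of_lipschitz (h : IsSkeinTower q (Ordinal.omega 1) Sk) {S : Set X}
    (hS : TopologicalSpace.IsSeparable S) {R : X → X} {K : ℝ≥0} (hR : LipschitzWith K R)
    (hRS : ∀ x, R x ∈ S) {p z : X} (hd : dist p z ≤ 1 / 2) : R p = R z := by
  have := h.completeSpace
  by_contra hne
  have hpz : p ≠ z := fun h => hne (h ▸ rfl)
  obtain ⟨α₀, hα₀, hSα⟩ := h.exists_subset_of_isSeparable hS
  have hsys := fun (μ : Ordinal.{0}) (hμ : μ < Ordinal.omega 1) => h.exists_threadSystem hμ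
  have := h.nonempty
  choose! A B f hf using hsys
  -- The gap sequences of all threads that `S` meets off the stage to which they are attached.
  let Γ : Set (ℕ → ℝ) := ⋃ μ ∈ Iio α₀, Prod.snd '' {i : Set X × (ℕ → ℝ) |
    IsNewPair dist (⋃ δ < μ, Sk δ) (Sk μ) i.1 ∧ i.2 ∈ GapLengths q ∧
      ∃ t ∈ threadSet q i.2, f μ i.1 i.2 t ∈ S \ Sk μ}
  have hα₀c : (Iio α₀).Countable := by
    rw [← Cardinal.le_aleph0_iff_set_countable, Cardinal.mk_Iio_ordinal,
      Cardinal.lift_le_aleph0, ← Order.lt_succ_iff, Cardinal.succ_aleph0]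
    exact Cardinal.lt_omega_iff_card_lt.1 hα₀
  have hΓ : Γ.Countable := hα₀c.biUnion fun μ hμ =>
    ((hf μ (lt_trans hμ hα₀)).countable_threads (h.isClosed (lt_trans hμ hα₀).le) hS).image _
  have hΓq : Γ ⊆ GapLengths q := by
    intro γ hγ
    obtain ⟨μ, -, i, hi, rfl⟩ := mem_iUnion₂.1 hγ
    exact hi.2.1
  have hD : 0 < dist (R p) (R z) := dist_pos.2 hne
  -- With `γ 0 ≤ ε`, the final bound `K * (2 * γ 0)` falls below `dist (R p) (R z)`.
  obtain ⟨ε, hε, hKε⟩ := exists_pos_nnreal_mul_lt K (half_pos hD)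
  obtain ⟨γ, hγ, hγε, hhalf, hfine⟩ := exists_gapLengths_finer q hΓ hΓq hε
  obtain ⟨g, hg, hends⟩ := h.exists_thread hpz hd hγ
  have hc : LipschitzOnWith K (R ∘ g) (threadSet q γ) := by
    simpa using hR.comp_lipschitzOnWith hg
  borelize X
  have hnull : ∀ α ≤ α₀, μH[1] ((R ∘ g) '' threadSet q γ ∩ Sk α) = 0 := by
    intro α hα
    induction α using Ordinal.limitRecOn with
    | zero =>
      obtain ⟨a, b, -, h0⟩ := h.zero
      refine hausdorffMeasure_eq_zero_of_countable (Countable.mono inter_subset_right ?_)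
      rw [h0]
      exact (Set.toFinite _).countable
    | add_one α ih =>
      rw [← Order.succ_eq_add_one] at hα ⊢
      have hlt : α < α₀ := (Order.lt_succ α).trans_le hα
      have hlt' := hlt.trans hα₀
      refine (hf α hlt').hausdorffMeasure_inter_eq_zero (h.isClosed hlt'.le)
        (h.gated_univ (hα.trans hα₀.le)) hγ.2.1 hhalf hc hS (fun _ _ => hRS _) ?_ (ih hlt.le)
      intro s hs γ' hγ' t ht hst
      exact hfine γ' (mem_iUnion₂.2 ⟨α, hlt, (s, γ'), ⟨hs, hγ', t, ht, hst⟩, rfl⟩)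
    | limit α hlim ih =>
      have hαω := hα.trans hα₀.le
      refine hausdorffMeasure_inter_eq_zero_of_approx (𝓜 := Sk '' Iio α) ?_ ?_ ?_ hγ.2.1 hhalf hc ?_
      · rintro _ ⟨δ, hδ, rfl⟩
        exact h.isClosed ((le_of_lt hδ).trans hαω)
      · rintro _ ⟨δ, hδ, rfl⟩
        exact h.gated_univ ((le_of_lt hδ).trans hαω)
      · intro x hx y hy η hη
        have hcl := (h.limit α hαω hlim).2.2
        obtain ⟨x', hx', hxx'⟩ := Metric.mem_closure_iff.1 (hcl hx) η hη
        obtain ⟨y', hy', hyy'⟩ := Metric.mem_closure_iff.1 (hcl hy) η hη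
        obtain ⟨δ, hδ, hx'⟩ := mem_iUnion₂.1 hx'
        obtain ⟨δ', hδ', hy'⟩ := mem_iUnion₂.1 hy'
        have hmax := max_lt hδ hδ'
        have hle := hmax.le.trans hαω
        exact ⟨_, ⟨_, hmax, rfl⟩, ⟨x', h.mono (le_max_left _ _) hle hx', hxx'⟩,
          ⟨y', h.mono (le_max_right _ _) hle hy', hyy'⟩⟩
      · rintro _ ⟨δ, hδ, rfl⟩
        exact ih δ hδ ((le_of_lt hδ).trans hα)
  have himage : (R ∘ g) '' threadSet q γ ⊆ Sk α₀ := by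
    rintro _ ⟨t, -, rfl⟩
    exact hSα (hRS _)
  have hzero := hnull α₀ le_rfl
  rw [inter_eq_left.2 himage] at hzero
  have hsub : threadSet q γ ∩ Icc 0 1 ⊆ threadSet q γ := inter_subset_left
  have hmain := edist_le_of_hausdorffMeasure_image_eq_zero zero_le_one (zero_mem_threadSet hγ)
    (one_mem_threadSet hγ) (hc.mono hsub) (measure_mono_null (image_mono hsub) hzero)
  have hle : edist (R (g 0)) (R (g 1)) ≤ ENNReal.ofReal (K * (2 * γ 0)) := by
    rw [ENNReal.ofReal_mul (p := (K : ℝ)) K.2, ENNReal.ofReal_coe_nnreal]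
    exact hmain.trans (by gcongr; exact volume_Icc_diff_threadSet_le hhalf)
  have hγ0 := hγ.2.1 0
  rw [edist_dist, ENNReal.ofReal_le_ofReal_iff (by positivity)] at hle
  have hK : (0 : ℝ) ≤ K := K.2
  have h1 := mul_le_mul_of_nonneg_left hγε hK
  have h2 : dist (R (g 0)) (R (g 1)) = dist (R p) (R z) := by
    rcases hends with ⟨h3, h4⟩ | ⟨h3, h4⟩
    · rw [h3, h4]
    · rw [h3, h4, dist_comm]
  linarith

/-- By induction over the stages `R` is constant: a point of a thread is within `1 / 2` of one of
its ends, and a limit point is within `1 / 2` of a point of an earlier stage. -/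
theorem not_isLipschitzRetract (h : IsSkeinTower q (Ordinal.omega 1) Sk) {S : Set X}
    (hS : TopologicalSpace.IsSeparable S) (hne : ∀ x, S ≠ {x}) : ¬ IsLipschitzRetract S := by
  rintro ⟨R, ⟨K, hR⟩, hRS, hfix⟩
  obtain ⟨a, b, hab, h0⟩ := h.zero
  have key : ∀ {x y : X}, dist x y ≤ 1 / 2 → R x = R y :=
    fun hd => h.dist_le_of_lipschitz hS hR hRS hd
  have hconst : ∀ α ≤ Ordinal.omega 1, ∀ x ∈ Sk α, R x = R a := by
    intro α hα
    induction α using Ordinal.limitRecOn with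
    | zero =>
      intro x hx
      rw [h0] at hx
      rcases hx with rfl | hx
      · rfl
      · rw [mem_singleton_iff] at hx
        subst hx
        exact (key hab.le).symm
    | add_one α ih =>
      rw [← Order.succ_eq_add_one] at hα ⊢
      intro x hx
      have hlt : α < Ordinal.omega 1 := (Order.lt_succ α).trans_le hα
      obtain ⟨A, B, f, hf⟩ := h.exists_threadSystem hlt
      by_cases hxα : x ∈ Sk α
      · exact ih hlt.le x hxα
      obtain ⟨s, hs, γ, hγ, t, ht, rfl⟩ := hf.exists_chart hx hxα
      rcases le_total t (1 / 2) with ht' | ht'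
      · rw [← ih hlt.le (A s) (hs.subset (hf.left_mem hs))]
        exact key ((hf.dist_left hs hγ ht).trans_le ((min_le_left _ _).trans ht'))
      · rw [← ih hlt.le (B s) (hs.subset (hf.right_mem hs))]
        exact key ((hf.dist_right hs hγ ht).trans_le ((min_le_left _ _).trans (by linarith)))
    | limit α hlim ih =>
      intro x hx
      obtain ⟨y, hy, hxy⟩ := Metric.mem_closure_iff.1 ((h.limit α hα hlim).2.2 hx) (1 / 2)
        (by norm_num)
      obtain ⟨δ, hδ, hyδ⟩ := mem_iUnion₂.1 hy
      rw [key hxy.le, ih δ hδ (hδ.le.trans hα) y hyδ]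
  refine hne (R a) (Subset.antisymm (fun y hy => ?_) (singleton_subset_iff.2 (hRS a)))
  rw [mem_singleton_iff, ← hfix y hy]
  exact hconst _ le_rfl y (h.top ▸ mem_univ y)

end IsSkeinTower

/-! ### Cardinality -/

section Cardinality

open Cardinal

/-- Points of the closure are limits of sequences in `s`, and `𝔠 ^ ℵ₀ = 𝔠`. -/
theorem mk_closure_le_continuum {X : Type} [MetricSpace X] {s : Set X} (hs : #s ≤ 𝔠) :
    #(closure s) ≤ 𝔠 := by
  choose xs hxs hlim using fun x : closure s => mem_closure_iff_seq_limit.1 x.2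
  have hinj : Function.Injective fun (x : closure s) (n : ℕ) => (⟨xs x n, hxs x n⟩ : s) := by
    intro x y hxy
    have h1 : xs x = xs y := funext fun n => congrArg Subtype.val (congrFun hxy n)
    exact Subtype.ext (tendsto_nhds_unique (hlim x) (h1 ▸ hlim y))
  refine (mk_le_of_injective hinj).trans ?_
  rw [mk_arrow, mk_nat, lift_aleph0, lift_id, ← continuum_power_aleph0]
  exact power_le_power_right hs

theorem mk_thread_parameters_le (α : Type) (hα : #α ≤ 𝔠) :
    #((α × α) × (ℕ → ℝ) × ℝ) ≤ 𝔠 := by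
  simp only [mk_prod, lift_id, mk_arrow, mk_real, mk_nat,
    continuum_power_aleph0, continuum_mul_self]
  exact mul_le_of_le aleph0_le_continuum (mul_le_of_le aleph0_le_continuum hα hα) le_rfl

variable {X : Type} [MetricSpace X] {q : ℕ ≃ Ioo (0 : ℚ) 1} {M' M Y : Set X}
  {A B : Set X → X} {f : Set X → (ℕ → ℝ) → ℝ → X} {Sk : Ordinal.{0} → Set X}

theorem IsThreadSystem.mk_le (h : IsThreadSystem q dist M' M Y A B f) (hM : #M ≤ 𝔠) :
    #Y ≤ 𝔠 := by
  let F : (M × M) × (ℕ → ℝ) × ℝ → X := fun x => f {x.1.1.1, x.1.2.1} x.2.1 x.2.2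
  have hsub : Y ⊆ M ∪ range F := by
    intro x hx
    rcases (h.mem_iff x).1 hx with hx | ⟨s, ⟨p, hp, z, hz, rfl, -, -⟩, γ, -, t, -, rfl⟩
    · exact Or.inl hx
    · exact Or.inr ⟨((⟨p, hp⟩, ⟨z, hz.1⟩), γ, t), rfl⟩
  exact (mk_le_mk_of_subset hsub).trans ((mk_union_le _ _).trans
    (add_le_of_le aleph0_le_continuum hM (mk_range_le.trans (mk_thread_parameters_le M hM))))

theorem IsSkeinTower.mk_le (h : IsSkeinTower q (Ordinal.omega 1) Sk) {α : Ordinal.{0}}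
    (hα : α ≤ Ordinal.omega 1) : #(Sk α) ≤ 𝔠 := by
  induction α using Ordinal.limitRecOn with
  | zero =>
    obtain ⟨a, b, -, h0⟩ := h.zero
    rw [h0]
    exact ((Set.toFinite _).countable.le_aleph0).trans aleph0_le_continuum
  | add_one α ih =>
    rw [← Order.succ_eq_add_one] at hα ⊢
    have hlt : α < Ordinal.omega 1 := (Order.lt_succ α).trans_le hα
    obtain ⟨A, B, f, hf⟩ := h.exists_threadSystem hlt
    exact hf.mk_le (ih hlt.le)
  | limit α hlim ih =>
    refine (mk_le_mk_of_subset (h.limit α hα hlim).2.2).trans (mk_closure_le_continuum ?_)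
    refine mk_biUnion_le_of_le ?_ aleph0_le_continuum _ fun δ hδ => ih δ hδ (hδ.le.trans hα)
    have := Ordinal.card_le_card hα
    rw [← ord_aleph, card_ord] at this
    exact this.trans aleph_one_le_continuum

/-- The gaps have total length at most `2 * γ 0 < 1 / 2`, so the set has positive measure. -/
theorem not_countable_threadSet {γ : ℕ → ℝ} (hγ : γ ∈ GapLengths q)
    (hhalf : ∀ n, γ (n + 1) ≤ γ n / 2) : ¬ (threadSet q γ).Countable := by
  intro hc
  have h1 : volume (Icc (0 : ℝ) 1) ≤ volume (threadSet q γ) +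
      volume (Icc 0 1 \ threadSet q γ) := by
    rw [← union_sdiff_cancel (threadSet_subset (q := q) (γ := γ))]
    simpa using measure_union_le (μ := volume) (threadSet q γ) (Icc 0 1 \ threadSet q γ)
  rw [hc.measure_zero, zero_add, Real.volume_Icc] at h1
  have h2 := h1.trans (volume_Icc_diff_threadSet_le hhalf)
  have h3 := hγ.2.2.1 0
  have h4 := hγ.2.1 0
  rw [ENNReal.ofReal_le_ofReal_iff (by positivity)] at h2
  norm_num at h3
  linarith

/-- For the lower bound, an uncountable thread set is closed and so contains a Cantor set. The
thread over the two initial points is injective because its width is positive. -/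
theorem IsSkeinTower.mk_eq_continuum (h : IsSkeinTower q (Ordinal.omega 1) Sk) : #X = 𝔠 := by
  refine le_antisymm ?_ ?_
  · have := h.mk_le le_rfl
    rwa [h.top, mk_univ] at this
  · obtain ⟨a, b, hab, h0⟩ := h.zero
    obtain ⟨A, B, f, hf⟩ := h.exists_threadSystem (α := 0) (Ordinal.omega_pos 1)
    have hs : IsNewPair dist (⋃ δ < (0 : Ordinal.{0}), Sk δ) (Sk 0) {a, b} :=
      ⟨a, by simp [h0], b, by simp [h0], rfl, by rw [hab]; norm_num, hab.le⟩
    have hAB : dist (A {a, b}) (B {a, b}) = 1 / 2 := by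
      have := hf.pair _ hs
      rw [pair_eq_pair_iff] at this
      rcases this with ⟨h1, h2⟩ | ⟨h1, h2⟩
      · rw [← h1, ← h2, hab]
      · rw [← h1, ← h2, dist_comm, hab]
    obtain ⟨γ, hγ, -, hhalf⟩ := exists_gapLengths_le q (fun _ => one_pos)
    obtain ⟨k, hk, -, hkinj⟩ := isClosed_threadSet.exists_nat_bool_injection_of_not_countable
      (not_countable_threadSet hγ hhalf)
    have hinj : Function.Injective fun x => f {a, b} γ (k x) := by
      intro x y hxy
      have hx := hk ⟨x, rfl⟩
      have hy := hk ⟨y, rfl⟩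
      have hd := hf.dist_thread _ hs γ hγ _ hx _ hy
      have h1 := threadSet_subset hx
      have h2 := threadSet_subset hy
      rw [show f {a, b} γ (k x) = f {a, b} γ (k y) from hxy, dist_self, threadDist, hAB] at hd
      refine hkinj (sub_eq_zero.1 (abs_eq_zero.1 ?_))
      by_contra hne
      have : 0 < min |k x - k y| (min (k x + (1 - k y) + 1 / 2) (k y + (1 - k x) + 1 / 2)) :=
        lt_min (lt_of_le_of_ne (abs_nonneg _) (Ne.symm hne))
          (lt_min (by linarith [h1.1, h2.2]) (by linarith [h2.1, h1.2]))
      linarith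
    have := mk_le_of_injective hinj
    rwa [mk_arrow, mk_bool, mk_nat, lift_aleph0, lift_ofNat, two_power_aleph0] at this

end Cardinality

/-! ### Attaching threads -/

/-- A pseudometric on `Z`, in which points are joined directly, within pieces of real lines, or
through exits into a metric space `M`. -/
structure ExitData (Z M : Type*) [MetricSpace M] where
  anchor : Z → Bool → M
  cost : Z → Bool → ℝ
  coord : Z → ℝ
  same : Z → Z → Prop
  same_symm : ∀ {x y}, same x y → same y x
  same_trans : ∀ {x y z}, same x y → same y z → same x z
  self : ∀ x, same x x ∨ ∃ b, cost x b = 0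
  cost_nonneg : ∀ x b, 0 ≤ cost x b
  -- Passing through a piece from exit to exit must not be a shortcut in `M`. For threads, this says
  -- that the width does not exceed the length `1`.
  dist_anchor_le : ∀ x b b', dist (anchor x b) (anchor x b') ≤ cost x b + cost x b'
  anchor_eq : ∀ {x y} b, same x y → anchor x b = anchor y b
  cost_le : ∀ {x y} b, same x y → cost x b ≤ |coord x - coord y| + cost y b

namespace ExitData

variable {Z M : Type*} [MetricSpace M] (E : ExitData Z M)

/-- The length of the way from `x` to `y` using the exits `b` and `b'`. -/
def way (x y : Z) (b b' : Bool) : ℝ :=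
  E.cost x b + dist (E.anchor x b) (E.anchor y b') + E.cost y b'

/-- The length of the shortest way from `x` to `y` through exits. -/
noncomputable def outer (x y : Z) : ℝ :=
  min (min (E.way x y true true) (E.way x y true false))
    (min (E.way x y false true) (E.way x y false false))

theorem outer_le (x y : Z) (b b' : Bool) : E.outer x y ≤ E.way x y b b' := by
  cases b <;> cases b' <;> simp [outer]

theorem exists_outer_eq (x y : Z) : ∃ b b', E.outer x y = E.way x y b b' := by
  unfold outer
  rcases min_choice (min (E.way x y true true) (E.way x y true false))
    (min (E.way x y false true) (E.way x y false false)) with h | h <;> rw [h]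
  · rcases min_choice (E.way x y true true) (E.way x y true false) with h | h <;> rw [h]
    exacts [⟨_, _, rfl⟩, ⟨_, _, rfl⟩]
  · rcases min_choice (E.way x y false true) (E.way x y false false) with h | h <;> rw [h]
    exacts [⟨_, _, rfl⟩, ⟨_, _, rfl⟩]

theorem way_comm (x y : Z) (b b' : Bool) : E.way x y b b' = E.way y x b' b := by
  rw [way, way, dist_comm]; ring

theorem outer_le_outer (x y : Z) : E.outer x y ≤ E.outer y x := by
  obtain ⟨b, b', h⟩ := E.exists_outer_eq y x
  rw [h, way_comm]
  exact E.outer_le x y b' b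

theorem outer_comm (x y : Z) : E.outer x y = E.outer y x :=
  le_antisymm (E.outer_le_outer x y) (E.outer_le_outer y x)

theorem way_nonneg (x y : Z) (b b' : Bool) : 0 ≤ E.way x y b b' :=
  add_nonneg (add_nonneg (E.cost_nonneg _ _) dist_nonneg) (E.cost_nonneg _ _)

theorem outer_nonneg (x y : Z) : 0 ≤ E.outer x y := by
  obtain ⟨b, b', h⟩ := E.exists_outer_eq x y
  rw [h]
  exact E.way_nonneg x y b b'

open scoped Classical in
/-- The distance determined by the exits. -/
noncomputable def edge (x y : Z) : ℝ :=
  if E.same x y then min |E.coord x - E.coord y| (E.outer x y) else E.outer x y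

theorem edge_le_outer (x y : Z) : E.edge x y ≤ E.outer x y := by
  unfold edge
  split_ifs
  exacts [min_le_right _ _, le_rfl]

theorem edge_le_way (x y : Z) (b b' : Bool) : E.edge x y ≤ E.way x y b b' :=
  (E.edge_le_outer x y).trans (E.outer_le x y b b')

theorem edge_le_abs {x y : Z} (h : E.same x y) : E.edge x y ≤ |E.coord x - E.coord y| := by
  rw [edge, if_pos h]
  exact min_le_left _ _

theorem edge_eq (x y : Z) :
    (E.same x y ∧ E.edge x y = |E.coord x - E.coord y|) ∨
      ∃ b b', E.edge x y = E.way x y b b' := by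
  unfold edge
  split_ifs with h
  · rcases min_choice |E.coord x - E.coord y| (E.outer x y) with h' | h' <;> rw [h']
    · exact Or.inl ⟨h, rfl⟩
    · exact Or.inr (E.exists_outer_eq x y)
  · exact Or.inr (E.exists_outer_eq x y)

theorem edge_comm (x y : Z) : E.edge x y = E.edge y x := by
  unfold edge
  rw [E.outer_comm, abs_sub_comm]
  by_cases h : E.same x y
  · rw [if_pos h, if_pos (E.same_symm h)]
  · rw [if_neg h, if_neg fun h' => h (E.same_symm h')]

theorem edge_self (x : Z) : E.edge x x = 0 := by
  refine le_antisymm ?_ ?_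
  · rcases E.self x with h | ⟨b, hb⟩
    · simpa using E.edge_le_abs h
    · simpa [way, hb] using E.edge_le_way x x b b
  · unfold edge
    split_ifs
    exacts [le_min (abs_nonneg _) (E.outer_nonneg _ _), E.outer_nonneg _ _]

theorem edge_le_of_same (x : Z) {y z : Z} (h : E.same x y) {b b' : Bool} :
    E.edge x z ≤ |E.coord x - E.coord y| + E.way y z b b' := by
  refine (E.edge_le_way x z b b').trans ?_
  rw [way, way, E.anchor_eq b h]
  linarith [E.cost_le b h]

/-- Two direct moves combine into one, and a direct move next to a way through exits is absorbed by
`cost_le`. For two ways through exits, `dist_anchor_le` replaces the detour via `y` by a way inside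
`M`. -/
theorem edge_triangle (x y z : Z) : E.edge x z ≤ E.edge x y + E.edge y z := by
  rcases E.edge_eq x y with ⟨h1, h1'⟩ | ⟨b, c, h1⟩ <;>
    rcases E.edge_eq y z with ⟨h2, h2'⟩ | ⟨b', c', h2⟩
  · rw [h1', h2']
    exact (E.edge_le_abs (E.same_trans h1 h2)).trans (abs_sub_le _ _ _)
  · rw [h1', h2]
    exact E.edge_le_of_same x h1
  · rw [h1, h2', E.edge_comm x z, E.way_comm, abs_sub_comm, add_comm]
    exact E.edge_le_of_same z (E.same_symm h2)
  · rw [h1, h2]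
    refine (E.edge_le_way x z b c').trans ?_
    unfold way
    linarith [dist_triangle4 (E.anchor x b) (E.anchor y c) (E.anchor y b') (E.anchor z c'),
      E.dist_anchor_le y c b']

/-- The pseudometric space determined by the exits. -/
@[reducible]
noncomputable def pseudoMetricSpace : PseudoMetricSpace Z where
  dist := E.edge
  dist_self := E.edge_self
  dist_comm := E.edge_comm
  dist_triangle := E.edge_triangle

end ExitData

/-- The disjoint union of `M` with threads indexed by `ι × Δ`. -/
inductive ThreadUnion (q : ℕ ≃ Ioo (0 : ℚ) 1) (M ι : Type) : Type
  | base (m : M) : ThreadUnion q M ι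
  | point (i : ι) (γ : GapLengths q) (t : ℝ) (ht : t ∈ threadSet q γ.1) : ThreadUnion q M ι

/-- The end of a thread in direction `e`. -/
def threadEnd {M ι : Type} (a b : ι → M) (i : ι) (e : Bool) : M := if e then a i else b i

/-- The distance along a thread of its point with parameter `t` to the end in direction `e`. -/
noncomputable def threadCost (t : ℝ) (e : Bool) : ℝ := if e then t else 1 - t

/-- Threads indexed by `ι × Δ`, glued to `M` by their ends `a i`, `b i`. -/
noncomputable def threadExitData (q : ℕ ≃ Ioo (0 : ℚ) 1) {M ι : Type} [MetricSpace M]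
    (a b : ι → M) (hab : ∀ i, dist (a i) (b i) ≤ 1) : ExitData (ThreadUnion q M ι) M where
  anchor
    | .base m, _ => m
    | .point i _ _ _, e => threadEnd a b i e
  cost
    | .base _, _ => 0
    | .point _ _ t _, e => threadCost t e
  coord
    | .base _ => 0
    | .point _ _ t _ => t
  same
    | .point i γ _ _, .point i' γ' _ _ => i = i' ∧ γ = γ'
    | _, _ => False
  same_symm := by
    rintro (m | ⟨i, γ, t, ht⟩) (m' | ⟨i', γ', t', ht'⟩) h
    exacts [h, h, h, ⟨h.1.symm, h.2.symm⟩]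
  same_trans := by
    rintro (m | ⟨i, γ, t, ht⟩) (m' | ⟨i', γ', t', ht'⟩) (m'' | ⟨i'', γ'', t'', ht''⟩) h h'
    exacts [h, h, h, h.elim, h, h.elim, h', ⟨h.1.trans h'.1, h.2.trans h'.2⟩]
  self := by
    rintro (m | ⟨i, γ, t, ht⟩)
    · exact Or.inr ⟨true, rfl⟩
    · exact Or.inl ⟨rfl, rfl⟩
  cost_nonneg := by
    rintro (m | ⟨i, γ, t, ht⟩) e
    · exact le_rfl
    · have := threadSet_subset ht
      cases e <;> simp [threadCost, this.1, this.2]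
  dist_anchor_le := by
    rintro (m | ⟨i, γ, t, ht⟩) e e'
    · simp
    · have h1 := threadSet_subset ht
      have h2 := hab i
      have h3 := h1.1
      have h4 := h1.2
      cases e <;> cases e' <;> simp [threadCost, threadEnd, dist_comm (b _) (a _)] <;> linarith
  anchor_eq := by
    rintro (m | ⟨i, γ, t, ht⟩) (m' | ⟨i', γ', t', ht'⟩) e h
    exacts [h.elim, h.elim, h.elim, by rw [h.1]]
  cost_le := by
    rintro (m | ⟨i, γ, t, ht⟩) (m' | ⟨i', γ', t', ht'⟩) e h
    · exact h.elim
    · exact h.elim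
    · exact h.elim
    · have h1 := le_abs_self (t - t')
      have h2 := neg_abs_le (t - t')
      cases e <;> simp [threadCost] <;> linarith

/-! ### Transport of thread systems along injections preserving distances -/

section Transfer

variable {V W : Type*} {q : ℕ ≃ Ioo (0 : ℚ) 1} {d : V → V → ℝ} {d' : W → W → ℝ}
  {M' M Y : Set V} {A B : Set V → V} {f : Set V → (ℕ → ℝ) → ℝ → V} {k : V → W}

theorem IsThreadSystem.subset_base (h : IsThreadSystem q d M' M Y A B f) : M ⊆ Y :=
  fun x hx => (h.mem_iff x).2 (Or.inl hx)

theorem isNewPair_image_iff (hk : InjOn k M) (hM' : M' ⊆ M)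
    (hd : ∀ x ∈ M, ∀ y ∈ M, d' (k x) (k y) = d x y) {s : Set W} :
    IsNewPair d' (k '' M') (k '' M) s ↔ ∃ s₀, IsNewPair d M' M s₀ ∧ s = k '' s₀ := by
  constructor
  · rintro ⟨_, ⟨p, hp, rfl⟩, _, ⟨⟨z, hz, rfl⟩, hz'⟩, rfl, h0, h1⟩
    rw [hd p hp z hz] at h0 h1
    exact ⟨{p, z}, ⟨p, hp, z, ⟨hz, fun h => hz' ⟨z, h, rfl⟩⟩, rfl, h0, h1⟩, by rw [image_pair]⟩
  · rintro ⟨_, ⟨p, hp, z, hz, rfl, h0, h1⟩, rfl⟩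
    refine ⟨k p, ⟨p, hp, rfl⟩, k z, ⟨⟨z, hz.1, rfl⟩, ?_⟩, image_pair _ _ _, ?_, ?_⟩
    · rintro ⟨w, hw, hwz⟩
      exact hz.2 (hk (hM' hw) hz.1 hwz ▸ hw)
    · rwa [hd p hp z hz.1]
    · rwa [hd p hp z hz.1]

/-- This moves an abstractly built attachment into the ambient type, and later the stages into the
final space. -/
theorem IsThreadSystem.image (h : IsThreadSystem q d M' M Y A B f) (hM' : M' ⊆ M)
    (hk : InjOn k Y) (hd : ∀ x ∈ Y, ∀ y ∈ Y, d' (k x) (k y) = d x y) :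
    ∃ A' B' f', IsThreadSystem q d' (k '' M') (k '' M) (k '' Y) A' B' f' := by
  have hMY := h.subset_base
  refine ⟨fun s => k (A (k ⁻¹' s ∩ Y)), fun s => k (B (k ⁻¹' s ∩ Y)),
    fun s γ t => k (f (k ⁻¹' s ∩ Y) γ t), ?_⟩
  have hiff : ∀ {s}, IsNewPair d' (k '' M') (k '' M) s → ∃ s₀, IsNewPair d M' M s₀ ∧ s = k '' s₀ ∧
      k ⁻¹' s ∩ Y = s₀ := fun {s} hs => by
    obtain ⟨s₀, hs₀, rfl⟩ := (isNewPair_image_iff (hk.mono hMY) hM'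
      fun x hx y hy => hd x (hMY hx) y (hMY hy)).1 hs
    exact ⟨s₀, hs₀, rfl, hk.preimage_image_inter (hs₀.subset.trans hMY)⟩
  have hfY : ∀ s, IsNewPair d M' M s → ∀ γ ∈ GapLengths q, ∀ t ∈ threadSet q γ, f s γ t ∈ Y :=
    fun s hs γ hγ t ht => (h.mem_iff _).2 (Or.inr ⟨s, hs, γ, hγ, t, ht, rfl⟩)
  have hA : ∀ s, IsNewPair d M' M s → A s ∈ Y ∧ B s ∈ Y := fun s hs => by
    have h1 := hs.subset.trans hMY
    rw [h.pair s hs] at h1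
    exact ⟨h1 (by simp), h1 (by simp)⟩
  constructor
  · intro s hs
    obtain ⟨s₀, hs₀, rfl, heq⟩ := hiff hs
    rw [heq, ← image_pair, ← h.pair s₀ hs₀]
  · intro s hs γ hγ
    obtain ⟨s₀, hs₀, rfl, heq⟩ := hiff hs
    simp only [heq, h.zero s₀ hs₀ γ hγ]
  · intro s hs γ hγ
    obtain ⟨s₀, hs₀, rfl, heq⟩ := hiff hs
    simp only [heq, h.one s₀ hs₀ γ hγ]
  · intro s hs γ hγ t ht t' ht'
    obtain ⟨s₀, hs₀, rfl, heq⟩ := hiff hs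
    simp only [heq]
    rw [hd _ (hfY s₀ hs₀ γ hγ t ht) _ (hfY s₀ hs₀ γ hγ t' ht'), hd _ (hA s₀ hs₀).1 _ (hA s₀ hs₀).2]
    exact h.dist_thread s₀ hs₀ γ hγ t ht t' ht'
  · intro x
    constructor
    · rintro ⟨y, hy, rfl⟩
      rcases (h.mem_iff y).1 hy with hy | ⟨s₀, hs₀, γ, hγ, t, ht, rfl⟩
      · exact Or.inl ⟨y, hy, rfl⟩
      · have hs := (isNewPair_image_iff (d' := d') (hk.mono hMY) hM'
          fun x hx y hy => hd x (hMY hx) y (hMY hy)).2 ⟨s₀, hs₀, rfl⟩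
        refine Or.inr ⟨k '' s₀, hs, γ, hγ, t, ht, ?_⟩
        rw [hk.preimage_image_inter (hs₀.subset.trans hMY)]
    · rintro (⟨y, hy, rfl⟩ | ⟨s, hs, γ, hγ, t, ht, rfl⟩)
      · exact ⟨y, hMY hy, rfl⟩
      · obtain ⟨s₀, hs₀, rfl, heq⟩ := hiff hs
        simp only [heq]
        exact ⟨_, hfY s₀ hs₀ γ hγ t ht, rfl⟩
  · intro s hs γ hγ t ht
    obtain ⟨s₀, hs₀, rfl, heq⟩ := hiff hs
    simp only [heq]
    rintro ⟨y, hy, hyt⟩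
    refine h.endpoint s₀ hs₀ γ hγ t ht ?_
    rwa [← hk (hMY hy) (hfY s₀ hs₀ γ hγ t ht) hyt]
  · rintro s hs γ hγ t ht _ ⟨z, hz, rfl⟩
    obtain ⟨s₀, hs₀, rfl, heq⟩ := hiff hs
    simp only [heq]
    obtain ⟨w, hw, hdw⟩ := h.dist_base s₀ hs₀ γ hγ t ht z hz
    have hwY := hMY (hs₀.subset hw)
    refine ⟨k w, ⟨w, hw, rfl⟩, ?_⟩
    rw [hd _ (hfY s₀ hs₀ γ hγ t ht) _ (hMY hz), hd _ (hfY s₀ hs₀ γ hγ t ht) _ hwY,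
      hd _ hwY _ (hMY hz), hdw]
  · intro s hs γ hγ t ht s' hs' γ' hγ' t' ht' hne
    obtain ⟨s₀, hs₀, rfl, heq⟩ := hiff hs
    obtain ⟨s₁, hs₁, rfl, heq'⟩ := hiff hs'
    simp only [heq, heq']
    have hne' : (s₀, γ) ≠ (s₁, γ') := fun h => hne (by
      simp only [Prod.mk.injEq] at h ⊢
      exact ⟨by rw [h.1], h.2⟩)
    obtain ⟨w, hw, w', hw', hdw⟩ := h.dist_pieces s₀ hs₀ γ hγ t ht s₁ hs₁ γ' hγ' t' ht' hne'
    have hwY := hMY (hs₀.subset hw)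
    have hwY' := hMY (hs₁.subset hw')
    refine ⟨k w, ⟨w, hw, rfl⟩, k w', ⟨w', hw', rfl⟩, ?_⟩
    rw [hd _ (hfY s₀ hs₀ γ hγ t ht) _ (hfY s₁ hs₁ γ' hγ' t' ht'),
      hd _ (hfY s₀ hs₀ γ hγ t ht) _ hwY, hd _ hwY _ hwY',
      hd _ hwY' _ (hfY s₁ hs₁ γ' hγ' t' ht'), hdw]

end Transfer

/-- Converse to `IsSkeinSucc.exists_threadSystem`. The required minima are attained by the given
chains, and the triangle inequality supplies the lower bounds. -/
theorem IsThreadSystem.isSkeinSucc {X : Type*} [MetricSpace X] {q : ℕ ≃ Ioo (0 : ℚ) 1}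
    {M' M Y : Set X} {A B : Set X → X} {f : Set X → (ℕ → ℝ) → ℝ → X}
    (h : IsThreadSystem q dist M' M Y A B f) : IsSkeinSucc q M' M Y := by
  have hleast_base : ∀ (p z : X) (S : Set X), (∃ w ∈ S, dist p z = dist p w + dist w z) →
      IsLeast {r : ℝ | ∃ x ∈ S, r = dist p x + dist x z} (dist p z) := by
    rintro p z S ⟨w, hw, hd⟩
    refine ⟨⟨w, hw, hd⟩, ?_⟩
    rintro _ ⟨x, -, rfl⟩
    exact dist_triangle _ _ _
  have hleast_pieces : ∀ (p z : X) (S S' : Set X),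
      (∃ w ∈ S, ∃ w' ∈ S', dist p z = dist p w + dist w w' + dist w' z) →
      IsLeast {r : ℝ | ∃ x ∈ S, ∃ y ∈ S', r = dist p x + dist x y + dist y z} (dist p z) := by
    rintro p z S S' ⟨w, hw, w', hw', hd⟩
    refine ⟨⟨w, hw, w', hw', hd⟩, ?_⟩
    rintro _ ⟨x, -, y, -, rfl⟩
    exact dist_triangle4 _ _ _ _
  have hmem : ∀ s, IsNewPair dist M' M s → ∀ γ ∈ GapLengths q, ∀ t ∈ threadSet q γ,
      f s γ t ∈ M → f s γ t ∈ s := by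
    intro s hs γ hγ t ht hM
    rcases h.endpoint s hs γ hγ t ht hM with rfl | rfl
    · rw [h.zero s hs γ hγ]; exact h.left_mem hs
    · rw [h.one s hs γ hγ]; exact h.right_mem hs
  have hinter : ∀ s, IsNewPair dist M' M s → ∀ γ ∈ GapLengths q, ∀ t ∈ threadSet q γ,
      ∀ s', IsNewPair dist M' M s' → ∀ γ' ∈ GapLengths q, ∀ t' ∈ threadSet q γ',
      (s, γ) ≠ (s', γ') → f s γ t = f s' γ' t' → f s γ t ∈ M := by
    intro s hs γ hγ t ht s' hs' γ' hγ' t' ht' hne heq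
    obtain ⟨w, hw, w', hw', hd⟩ := h.dist_pieces s hs γ hγ t ht s' hs' γ' hγ' t' ht' hne
    rw [← heq, dist_self] at hd
    have h1 := dist_nonneg (x := f s γ t) (y := w)
    have h2 := dist_nonneg (x := w) (y := w')
    have h3 := dist_nonneg (x := w') (y := f s γ t)
    have h4 : f s γ t = w := dist_le_zero.1 (by linarith)
    rw [h4]
    exact hs.subset hw
  have hfin : ∀ s, IsNewPair dist M' M s → IsCompact s := fun s hs => by
    rw [h.pair s hs]
    exact (Set.toFinite _).isCompact
  let T : newPairs M' M → GapLengths q → Set X := fun s γ => f s.1 γ.1 '' threadSet q γ.1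
  refine ⟨fun s => ⋃ γ, T s γ, fun s => ⟨A s.1, B s.1, h.pair s.1 s.2, T s, fun γ => ?_, ?_⟩, ?_⟩
  · exact ⟨f s.1 γ.1, h.zero s.1 s.2 γ.1 γ.2, h.one s.1 s.2 γ.1 γ.2, rfl,
      h.dist_thread s.1 s.2 γ.1 γ.2⟩
  · have hs : IsNewPair dist M' M s.1 := s.2
    rw [← h.pair s.1 s.2]
    have hsT : ∀ γ, s.1 ⊆ T s γ := by
      intro γ x hx
      rw [h.pair s.1 s.2] at hx
      rcases hx with rfl | hx
      · exact ⟨0, zero_mem_threadSet γ.2, h.zero s.1 s.2 γ.1 γ.2⟩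
      · rw [mem_singleton_iff] at hx
        subst hx
        exact ⟨1, one_mem_threadSet γ.2, h.one s.1 s.2 γ.1 γ.2⟩
    refine ⟨fun _ => hfin s.1 s.2, fun γ => inter_eq_right.2 (hsT γ), ?_, ?_, ?_, ?_⟩
    · rintro γ γ' hne x ⟨⟨t, ht, rfl⟩, ⟨t', ht', heq⟩⟩
      refine hmem s.1 hs γ.1 γ.2 t ht (hinter s.1 hs γ.1 γ.2 t ht s.1 hs γ'.1 γ'.2 t' ht' ?_ heq.symm)
      exact fun h => hne (Subtype.ext (Prod.mk.inj h).2)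
    · obtain ⟨γ, hγ, -⟩ := exists_gapLengths_le q (fun _ => one_pos)
      exact (union_eq_right.2 ((hsT ⟨γ, hγ⟩).trans (subset_iUnion _ _))).symm
    · rintro γ p - z hz
      exact hleast_base _ _ _ ⟨z, hz, by simp⟩
    · rintro γ γ' hne p ⟨⟨t, ht, rfl⟩, -⟩ z ⟨⟨t', ht', rfl⟩, -⟩
      exact hleast_pieces _ _ _ _ (h.dist_pieces s.1 hs γ.1 γ.2 t ht s.1 hs γ'.1 γ'.2 t' ht'
        fun h => hne (Subtype.ext (Prod.mk.inj h).2))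
  · refine ⟨fun s => hfin s.1 s.2, fun s => ?_, ?_, ?_, ?_, ?_⟩
    · refine Subset.antisymm ?_ fun x hx => ⟨?_, IsNewPair.subset (d := dist) s.2 hx⟩
      · rintro x ⟨hx, hxM⟩
        obtain ⟨γ, t, ht, rfl⟩ := mem_iUnion.1 hx
        exact hmem s.1 s.2 γ.1 γ.2 t ht hxM
      · obtain ⟨γ, hγ, -⟩ := exists_gapLengths_le q (fun _ => one_pos)
        rw [h.pair s.1 s.2] at hx
        rcases hx with rfl | hx
        · exact mem_iUnion.2 ⟨⟨γ, hγ⟩, 0, zero_mem_threadSet hγ, h.zero s.1 s.2 γ hγ⟩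
        · rw [mem_singleton_iff] at hx
          subst hx
          exact mem_iUnion.2 ⟨⟨γ, hγ⟩, 1, one_mem_threadSet hγ, h.one s.1 s.2 γ hγ⟩
    · rintro s s' hne x ⟨hx, hx'⟩
      obtain ⟨γ, t, ht, rfl⟩ := mem_iUnion.1 hx
      obtain ⟨γ', t', ht', heq⟩ := mem_iUnion.1 hx'
      exact hinter s.1 s.2 γ.1 γ.2 t ht s'.1 s'.2 γ'.1 γ'.2 t' ht'
        (fun h => hne (Subtype.ext (Prod.mk.inj h).1)) heq.symm
    · ext x
      rw [h.mem_iff]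
      refine or_congr Iff.rfl ?_
      simp only [mem_iUnion]
      constructor
      · rintro ⟨s, hs, γ, hγ, t, ht, rfl⟩
        exact ⟨⟨s, hs⟩, ⟨γ, hγ⟩, t, ht, rfl⟩
      · rintro ⟨s, γ, t, ht, rfl⟩
        exact ⟨s.1, s.2, γ.1, γ.2, t, ht, rfl⟩
    · rintro s p ⟨hp, -⟩ z hz
      obtain ⟨γ, t, ht, rfl⟩ := mem_iUnion.1 hp
      exact hleast_base _ _ _ (h.dist_base s.1 s.2 γ.1 γ.2 t ht z hz)
    · rintro s s' hne p ⟨hp, -⟩ z ⟨hz, -⟩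
      obtain ⟨γ, t, ht, rfl⟩ := mem_iUnion.1 hp
      obtain ⟨γ', t', ht', rfl⟩ := mem_iUnion.1 hz
      exact hleast_pieces _ _ _ _ (h.dist_pieces s.1 s.2 γ.1 γ.2 t ht s'.1 s'.2 γ'.1 γ'.2 t' ht'
        fun h => hne (Subtype.ext (Prod.mk.inj h).1))

/-! ### Realization of the successor step as a metric quotient -/

section Attachment

variable {q : ℕ ≃ Ioo (0 : ℚ) 1} {M ι : Type} [MetricSpace M] {a b : ι → M}

variable (hab : ∀ i, dist (a i) (b i) ≤ 1)

theorem threadExitData_edge_base (m m' : M) :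
    (threadExitData q a b hab).edge (.base m) (.base m') = dist m m' := by
  rcases (threadExitData q a b hab).edge_eq (.base m) (.base m') with ⟨h, -⟩ | ⟨e, e', h⟩
  · exact h.elim
  · rw [h]
    change 0 + dist m m' + 0 = dist m m'
    ring

variable {i i' : ι} {γ γ' : GapLengths q} {t t' : ℝ} (ht : t ∈ threadSet q γ.1)
  (ht' : t' ∈ threadSet q γ'.1)

theorem threadExitData_edge_point_base (m : M) :
    ∃ e, (threadExitData q a b hab).edge (.point i γ t ht) (.base m) =
      threadCost t e + dist (threadEnd a b i e) m := by
  rcases (threadExitData q a b hab).edge_eq (.point i γ t ht) (.base m) with ⟨h, -⟩ | ⟨e, e', h⟩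
  · exact h.elim
  · refine ⟨e, ?_⟩
    rw [h]
    exact add_zero _

theorem threadExitData_edge_point_end (e : Bool) :
    (threadExitData q a b hab).edge (.point i γ t ht) (.base (threadEnd a b i e)) ≤
      threadCost t e := by
  refine ((threadExitData q a b hab).edge_le_way _ _ e true).trans_eq ?_
  change threadCost t e + dist (threadEnd a b i e) (threadEnd a b i e) + 0 = _
  simp

theorem threadExitData_edge_point_of_ne (hne : (i, γ) ≠ (i', γ')) :
    ∃ e e', (threadExitData q a b hab).edge (.point i γ t ht) (.point i' γ' t' ht') =
      threadCost t e + dist (threadEnd a b i e) (threadEnd a b i' e') + threadCost t' e' := by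
  rcases (threadExitData q a b hab).edge_eq (.point i γ t ht) (.point i' γ' t' ht') with
    ⟨h, -⟩ | ⟨e, e', h⟩
  · exact absurd (Prod.ext h.1 h.2) hne
  · exact ⟨e, e', h⟩

/-- Of the four ways through exits, the two that leave and return by the same end are never shorter
than `|t - t'|`; the other two are those in the thread metric. -/
theorem threadExitData_edge_point {t' : ℝ} (ht' : t' ∈ threadSet q γ.1) :
    (threadExitData q a b hab).edge (.point i γ t ht) (.point i γ t' ht') =
      threadDist 1 (dist (a i) (b i)) t t' := by
  have h1 := threadSet_subset ht
  have h2 := threadSet_subset ht'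
  have hsame : (threadExitData q a b hab).same (.point i γ t ht) (.point i γ t' ht') := ⟨rfl, rfl⟩
  unfold ExitData.edge
  rw [if_pos hsame]
  change min |t - t'| (min (min (t + dist (a i) (a i) + t') (t + dist (a i) (b i) + (1 - t')))
    (min (1 - t + dist (b i) (a i) + t') (1 - t + dist (b i) (b i) + (1 - t')))) = _
  rw [dist_self, dist_self, dist_comm (b _) (a _), threadDist]
  set c := dist (a i) (b i)
  have e1 : |t - t'| ≤ t + 0 + t' :=
    abs_le.2 ⟨by linarith [h1.1, h2.1], by linarith [h1.1, h2.1]⟩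
  have e2 : |t - t'| ≤ 1 - t + 0 + (1 - t') :=
    abs_le.2 ⟨by linarith [h1.2, h2.2], by linarith [h1.2, h2.2]⟩
  have e3 : t + (1 - t') + c = t + c + (1 - t') := by ring
  have e4 : t' + (1 - t) + c = 1 - t + c + t' := by ring
  rw [e3, e4]
  refine le_antisymm ?_ ?_
  · refine min_le_min le_rfl (min_le_min (min_le_right _ _) (min_le_left _ _))
  · refine le_min (min_le_left _ _) (le_min (le_min ?_ ?_) (le_min ?_ ?_))
    · exact (min_le_left _ _).trans e1
    · exact (min_le_right _ _).trans (min_le_left _ _)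
    · exact (min_le_right _ _).trans (min_le_right _ _)
    · exact (min_le_left _ _).trans e2

open Cardinal in
theorem exists_attachment (q : ℕ ≃ Ioo (0 : ℚ) 1) {M : Type} [MetricSpace M] [Nonempty M]
    (M' : Set M) (hM : #M ≤ 𝔠) :
    ∃ (Y : Type) (_ : MetricSpace Y) (φ : M → Y), Isometry φ ∧ #Y ≤ 𝔠 ∧
      ∃ A B f, IsThreadSystem q dist (φ '' M') (range φ) univ A B f := by
  classical
  let ι : Type := {s : Set M // IsNewPair dist M' univ s}
  have hι : ∀ i : ι, ∃ p z, i.1 = {p, z} ∧ dist p z ≤ 1 / 2 := by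
    rintro ⟨s, p, -, z, -, h, -, h'⟩
    exact ⟨p, z, h, h'⟩
  choose a b hs hab' using hι
  have hab : ∀ i, dist (a i) (b i) ≤ 1 := fun i => (hab' i).trans (by norm_num)
  have hend : ∀ i e, threadEnd a b i e ∈ i.1 := fun i e => by
    rw [hs i]; cases e <;> simp [threadEnd]
  let _ : PseudoMetricSpace (ThreadUnion q M ι) := (threadExitData q a b hab).pseudoMetricSpace
  -- The separation quotient performs the gluing: each thread end has pseudodistance zero to its
  -- anchor.
  let mk : ThreadUnion q M ι → SeparationQuotient (ThreadUnion q M ι) := SeparationQuotient.mk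
  let φ : M → SeparationQuotient (ThreadUnion q M ι) := fun m => mk (.base m)
  have hd : ∀ x y, dist (mk x) (mk y) = (threadExitData q a b hab).edge x y :=
    fun x y => SeparationQuotient.dist_mk x y
  have hφd : ∀ m m', dist (φ m) (φ m') = dist m m' := fun m m' => by
    exact (hd _ _).trans (threadExitData_edge_base hab m m')
  have hdφ : ∀ x m, dist (mk x) (φ m) = (threadExitData q a b hab).edge x (.base m) :=
    fun x m => hd x _
  have hφ : Isometry φ := Isometry.of_dist_eq hφd
  have hcard : #(SeparationQuotient (ThreadUnion q M ι)) ≤ 𝔠 := by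
    refine (mk_le_of_surjective SeparationQuotient.surjective_mk).trans ?_
    let F : ThreadUnion q M ι → M ⊕ ((M × M) × (ℕ → ℝ) × ℝ)
      | .base m => Sum.inl m
      | .point i γ t _ => Sum.inr ((a i, b i), γ.1, t)
    have hF : Function.Injective F := by
      rintro (m | ⟨i, γ, t, ht⟩) (m' | ⟨i', γ', t', ht'⟩) h
      · rw [Sum.inl_injective h]
      · exact absurd h Sum.inl_ne_inr
      · exact absurd h Sum.inr_ne_inl
      · have h := Sum.inr_injective h
        simp only [Prod.mk.injEq] at h
        obtain ⟨⟨h1, h2⟩, h3, h4⟩ := h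
        have hi : i = i' := Subtype.ext (by rw [hs i, hs i', h1, h2])
        have hγ : γ = γ' := Subtype.ext h3
        subst hi hγ h4
        rfl
    refine (mk_le_of_injective hF).trans ?_
    rw [mk_sum, lift_id, lift_id]
    exact add_le_of_le aleph0_le_continuum hM (mk_thread_parameters_le M hM)
  refine ⟨SeparationQuotient (ThreadUnion q M ι), inferInstance, φ, hφ, hcard, ?_⟩
  let img : ι → Set (SeparationQuotient (ThreadUnion q M ι)) := fun i => φ '' i.1
  have himg : Function.Injective img := fun i j h => Subtype.ext (hφ.injective.image_injective h)
  have hnew : ∀ {s}, IsNewPair dist (φ '' M') (range φ) s → ∃ i, img i = s := by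
    intro s h
    rw [← image_univ, isNewPair_image_iff hφ.injective.injOn (subset_univ _)
      fun x _ y _ => hφd x y] at h
    obtain ⟨s₀, hs₀, rfl⟩ := h
    exact ⟨⟨s₀, hs₀⟩, rfl⟩
  have hnew' : ∀ i, IsNewPair dist (φ '' M') (range φ) (img i) := by
    intro i
    rw [← image_univ, isNewPair_image_iff hφ.injective.injOn (subset_univ _)
      fun x _ y _ => hφd x y]
    exact ⟨i.1, i.2, rfl⟩
  let y₀ := φ (Classical.arbitrary M)
  let th : ι → (ℕ → ℝ) → ℝ → SeparationQuotient (ThreadUnion q M ι) := fun i γ t =>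
    if h : ∃ hγ : γ ∈ GapLengths q, t ∈ threadSet q γ then
      mk (.point i ⟨γ, h.1⟩ t h.2) else y₀
  have hth : ∀ i γ (hγ : γ ∈ GapLengths q) t (ht : t ∈ threadSet q γ),
      th i γ t = mk (.point i ⟨γ, hγ⟩ t ht) := fun i γ hγ t ht => dif_pos ⟨hγ, ht⟩
  refine ⟨Function.extend img (fun i => φ (a i)) fun _ => y₀,
    Function.extend img (fun i => φ (b i)) fun _ => y₀,
    Function.extend img th fun _ _ _ => y₀, ?_⟩
  constructor
  · intro s h
    obtain ⟨i, rfl⟩ := hnew h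
    rw [himg.extend_apply, himg.extend_apply, ← image_pair, ← hs i]
  · intro s h γ hγ
    obtain ⟨i, rfl⟩ := hnew h
    rw [himg.extend_apply, himg.extend_apply, hth i γ hγ 0 (zero_mem_threadSet hγ)]
    refine dist_le_zero.1 ?_
    rw [hdφ]
    exact threadExitData_edge_point_end hab _ true
  · intro s h γ hγ
    obtain ⟨i, rfl⟩ := hnew h
    rw [himg.extend_apply, himg.extend_apply, hth i γ hγ 1 (one_mem_threadSet hγ)]
    refine dist_le_zero.1 ?_
    rw [hdφ]
    exact (threadExitData_edge_point_end hab (one_mem_threadSet hγ) false).trans_eq (sub_self _)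
  · intro s h γ hγ t ht t' ht'
    obtain ⟨i, rfl⟩ := hnew h
    rw [himg.extend_apply, himg.extend_apply, himg.extend_apply, hth i γ hγ t ht,
      hth i γ hγ t' ht', hd, hφd, threadExitData_edge_point]
  · intro y
    refine ⟨fun _ => ?_, fun _ => mem_univ _⟩
    obtain ⟨z, rfl⟩ := SeparationQuotient.surjective_mk y
    rcases z with m | ⟨i, γ, t, ht⟩
    · exact Or.inl ⟨m, rfl⟩
    · refine Or.inr ⟨img i, hnew' i, γ.1, γ.2, t, ht, ?_⟩
      rw [himg.extend_apply, hth i γ.1 γ.2 t ht]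
  · intro s h γ hγ t ht
    obtain ⟨i, rfl⟩ := hnew h
    rw [himg.extend_apply, hth i γ hγ t ht]
    rintro ⟨m, hm⟩
    have h0 := hdφ (.point i ⟨γ, hγ⟩ t ht) m
    obtain ⟨e, he⟩ := threadExitData_edge_point_base (i := i) (γ := ⟨γ, hγ⟩) hab ht m
    rw [he, ← hm, dist_self] at h0
    have h01 := threadSet_subset ht
    have hnn := dist_nonneg (x := threadEnd a b i e) (y := m)
    cases e
    · right
      simp only [threadCost] at h0
      norm_num at h0
      linarith [h01.2]
    · left
      simp only [threadCost] at h0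
      norm_num at h0
      linarith [h01.1]
  · rintro s h γ hγ t ht _ ⟨m, rfl⟩
    obtain ⟨i, rfl⟩ := hnew h
    rw [himg.extend_apply, hth i γ hγ t ht]
    obtain ⟨e, he⟩ := threadExitData_edge_point_base (i := i) (γ := ⟨γ, hγ⟩) hab ht m
    refine ⟨φ (threadEnd a b i e), mem_image_of_mem _ (hend i e),
      le_antisymm (dist_triangle _ _ _) ?_⟩
    rw [hφd, hdφ, hdφ, he]
    exact add_le_add (threadExitData_edge_point_end (i := i) (γ := ⟨γ, hγ⟩) hab ht e) le_rfl
  · intro s h γ hγ t ht s' h' γ' hγ' t' ht' hne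
    obtain ⟨i, rfl⟩ := hnew h
    obtain ⟨i', rfl⟩ := hnew h'
    rw [himg.extend_apply, himg.extend_apply, hth i γ hγ t ht, hth i' γ' hγ' t' ht']
    have hne' : ((i, ⟨γ, hγ⟩) : ι × GapLengths q) ≠ (i', ⟨γ', hγ'⟩) := fun h => hne (by
      simp only [Prod.mk.injEq, Subtype.mk.injEq] at h ⊢
      exact ⟨by rw [h.1], h.2⟩)
    obtain ⟨e, e', he⟩ := threadExitData_edge_point_of_ne (i := i) (i' := i') (γ := ⟨γ, hγ⟩)
      (γ' := ⟨γ', hγ'⟩) hab ht ht' hne'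
    refine ⟨φ (threadEnd a b i e), mem_image_of_mem _ (hend i e),
      φ (threadEnd a b i' e'), mem_image_of_mem _ (hend i' e'),
      le_antisymm (dist_triangle4 _ _ _ _) ?_⟩
    rw [hφd, dist_comm (φ (threadEnd a b i' e')), hdφ (.point i ⟨γ, hγ⟩ t ht),
      hdφ (.point i' ⟨γ', hγ'⟩ t' ht'), hd (.point i ⟨γ, hγ⟩ t ht) (.point i' ⟨γ', hγ'⟩ t' ht'), he]
    have k := threadExitData_edge_point_end (i := i) (γ := ⟨γ, hγ⟩) hab ht e
    have k' := threadExitData_edge_point_end (i := i') (γ := ⟨γ', hγ'⟩) hab ht' e'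
    exact add_le_add (add_le_add k le_rfl) k'

end Attachment

/-! ### Stages of the construction inside a fixed large type -/

section Stages

open Cardinal

variable {U : Type}

/-- The function `d` restricts to a metric on the set `A`. -/
structure IsMetricOn (A : Set U) (d : U → U → ℝ) : Prop where
  self : ∀ x ∈ A, d x x = 0
  comm : ∀ x ∈ A, ∀ y ∈ A, d x y = d y x
  triangle : ∀ x ∈ A, ∀ y ∈ A, ∀ z ∈ A, d x z ≤ d x y + d y z
  eq_of_eq_zero : ∀ x ∈ A, ∀ y ∈ A, d x y = 0 → x = y

/-- The metric space structure on `A` given by a metric on `A`. -/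
abbrev IsMetricOn.metricSpace {A : Set U} {d : U → U → ℝ} (h : IsMetricOn A d) :
    MetricSpace A where
  dist x y := d x y
  dist_self x := h.self x x.2
  dist_comm x y := h.comm x x.2 y y.2
  dist_triangle x y z := h.triangle x x.2 y y.2 z z.2
  eq_of_dist_eq_zero h0 := Subtype.ext (h.eq_of_eq_zero _ (Subtype.prop _) _ (Subtype.prop _) h0)

theorem isMetricOn_range {Y : Type} [MetricSpace Y] {e : Y → U} {d : U → U → ℝ}
    (hd : ∀ y y', d (e y) (e y') = dist y y') : IsMetricOn (range e) d where
  self := by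
    rintro _ ⟨y, rfl⟩
    rw [hd, dist_self]
  comm := by
    rintro _ ⟨y, rfl⟩ _ ⟨y', rfl⟩
    rw [hd, hd, dist_comm]
  triangle := by
    rintro _ ⟨y, rfl⟩ _ ⟨y', rfl⟩ _ ⟨z, rfl⟩
    rw [hd, hd, hd]
    exact dist_triangle _ _ _
  eq_of_eq_zero := by
    rintro _ ⟨y, rfl⟩ _ ⟨y', rfl⟩ h
    rw [hd] at h
    rw [dist_eq_zero.1 h]

/-- A small metric space extending a metric on a small subset of a large type is realized inside
the type. -/
theorem exists_realization (hU : 𝔠 < #U) {A : Set U} (hA : #A ≤ 𝔠) {Y : Type} [MetricSpace Y]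
    (hY : #Y ≤ 𝔠) {φ : A → Y} (hφ : Function.Injective φ) :
    ∃ (e : Y → U) (d : U → U → ℝ), Function.Injective e ∧ (∀ a, e (φ a) = a) ∧
      ∀ y y', d (e y) (e y') = dist y y' := by
  classical
  have : Infinite U := infinite_iff.2 (aleph0_le_continuum.trans hU.le)
  -- Removing a small set leaves the cardinality of `U` unchanged, so there is room for the new
  -- points, while the old ones keep their places and successive stages are literally nested.
  have hAc : #Y ≤ #(Aᶜ : Set U) := by
    rw [mk_compl_of_infinite A (hA.trans_lt hU)]
    exact hY.trans hU.le
  obtain ⟨g⟩ := hAc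
  let e : Y → U := fun y => if h : ∃ a, φ a = y then h.choose else g y
  have he : ∀ a, e (φ a) = a := fun a => by
    have h : ∃ a', φ a' = φ a := ⟨a, rfl⟩
    change (if h : ∃ a', φ a' = φ a then (h.choose : U) else g (φ a)) = a
    rw [dif_pos h, hφ h.choose_spec]
  have he' : ∀ y, (¬ ∃ a, φ a = y) → e y = g y := fun y h => dif_neg h
  have hinj : Function.Injective e := by
    intro y y' h
    by_cases hy : ∃ a, φ a = y <;> by_cases hy' : ∃ a, φ a = y'
    · obtain ⟨a, rfl⟩ := hy
      obtain ⟨a', rfl⟩ := hy'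
      rw [he, he] at h
      rw [Subtype.ext h]
    · obtain ⟨a, rfl⟩ := hy
      rw [he, he' y' hy'] at h
      exact absurd (h ▸ a.2) (g y').2
    · obtain ⟨a, rfl⟩ := hy'
      rw [he, he' y hy] at h
      exact absurd (h ▸ a.2) (g y).2
    · rw [he' y hy, he' y' hy'] at h
      exact g.injective (Subtype.ext h)
  refine ⟨e, fun u v => if h : (∃ y, e y = u) ∧ ∃ y, e y = v then
    dist h.1.choose h.2.choose else 0, hinj, he, fun y y' => ?_⟩
  have h : (∃ z, e z = e y) ∧ ∃ z, e z = e y' := ⟨⟨y, rfl⟩, ⟨y', rfl⟩⟩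
  change (if h : (∃ z, e z = e y) ∧ ∃ z, e z = e y' then
    dist h.1.choose h.2.choose else 0) = _
  rw [dif_pos h, hinj h.1.choose_spec, hinj h.2.choose_spec]

/-- A stage of the construction of a skein space inside a type `U`: the points constructed so far,
those among them that come from earlier stages, and the distances. -/
structure SkeinStage (U : Type) where
  /-- The points constructed at earlier stages. -/
  old : Set U
  /-- The points constructed so far. -/
  cur : Set U
  /-- The distance function. -/
  d : U → U → ℝ

namespace SkeinStage

/-- The stage `P` is a metric space of size at most the continuum. -/
structure Good (P : SkeinStage U) : Prop where
  subset : P.old ⊆ P.cur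
  metric : IsMetricOn P.cur P.d
  card : #P.cur ≤ 𝔠
  nonempty : P.cur.Nonempty

/-- The stage `P'` contains the stage `P` as a metric subspace. -/
structure Extends (P P' : SkeinStage U) : Prop where
  subset : P.cur ⊆ P'.cur
  dist_eq : ∀ x ∈ P.cur, ∀ y ∈ P.cur, P'.d x y = P.d x y

theorem Extends.refl (P : SkeinStage U) : P.Extends P := ⟨Subset.rfl, fun _ _ _ _ => rfl⟩

theorem Extends.trans {P P' P'' : SkeinStage U} (h : P.Extends P') (h' : P'.Extends P'') :
    P.Extends P'' :=
  ⟨h.subset.trans h'.subset, fun x hx y hy => by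
    rw [h'.dist_eq x (h.subset hx) y (h.subset hy), h.dist_eq x hx y hy]⟩

/-- The stage `P'` arises from `P` by the successor step. -/
structure IsSucc (q : ℕ ≃ Ioo (0 : ℚ) 1) (P P' : SkeinStage U) : Prop where
  old_eq : P'.old = P.cur
  isExtension : P.Extends P'
  good : P'.Good
  threads : ∃ A B f, IsThreadSystem q P'.d P.old P.cur P'.cur A B f

/-- The stage `P'` is a completion of the union of the stages `F δ`. -/
structure IsLimit (o : Ordinal.{0}) (F : ∀ δ < o, SkeinStage U) (P' : SkeinStage U) : Prop where
  old_eq : P'.old = ⋃ (δ) (h : δ < o), (F δ h).cur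
  isExtension : ∀ δ h, (F δ h).Extends P'
  good : P'.Good
  -- The ambient type carries no metric, so completeness is expressed through an isometric
  -- parametrization by a complete space.
  complete : ∃ (Y : Type) (_ : MetricSpace Y) (_ : CompleteSpace Y) (e : Y → U),
    range e = P'.cur ∧ ∀ y y', P'.d (e y) (e y') = dist y y'
  dense : ∀ x ∈ P'.cur, ∀ ε > 0, ∃ y ∈ P'.old, P'.d x y < ε

theorem Good.exists_isSucc (hU : 𝔠 < #U) (q : ℕ ≃ Ioo (0 : ℚ) 1) {P : SkeinStage U}
    (hP : P.Good) : ∃ P', IsSucc q P P' := by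
  let _ : MetricSpace P.cur := hP.metric.metricSpace
  have : Nonempty P.cur := hP.nonempty.to_subtype
  obtain ⟨Y, _, φ, hφ, hY, A, B, f, hf⟩ :=
    exists_attachment q (Subtype.val ⁻¹' P.old : Set P.cur) hP.card
  obtain ⟨e, d, he, heφ, hd⟩ := exists_realization hU hP.card hY hφ.injective
  have h1 : e '' range φ = P.cur := by
    rw [← range_comp, show e ∘ φ = Subtype.val from funext heφ, Subtype.range_val]
  have h2 : e '' (φ '' (Subtype.val ⁻¹' P.old)) = P.old := by
    rw [image_image]
    simp only [heφ]
    rw [Subtype.image_preimage_coe, inter_eq_right.2 hP.subset]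
  have hsub : P.cur ⊆ range e := by
    rw [← h1]
    exact image_subset_range _ _
  refine ⟨⟨P.cur, range e, d⟩, rfl, ⟨hsub, fun x hx y hy => ?_⟩,
    ⟨hsub, isMetricOn_range hd, mk_range_le.trans hY, hP.nonempty.mono hsub⟩, ?_⟩
  · have := hd (φ ⟨x, hx⟩) (φ ⟨y, hy⟩)
    rwa [heφ, heφ, hφ.dist_eq] at this
  · have := hf.image (d' := d) (k := e) (image_subset_range _ _) he.injOn fun x _ y _ => hd x y
    rwa [h1, h2, image_univ] at this

/-- Any finite set of points of the union lies in a single stage of the chain, and all stages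
containing two given points agree on their distance. -/
theorem exists_isMetricOn_iUnion {o : Ordinal.{0}} {F : ∀ δ < o, SkeinStage U}
    (hF : ∀ δ h, (F δ h).Good)
    (hE : ∀ δ h δ' h', δ ≤ δ' → (F δ h).Extends (F δ' h')) :
    ∃ d : U → U → ℝ, IsMetricOn (⋃ (δ) (h : δ < o), (F δ h).cur) d ∧
      ∀ δ h, ∀ x ∈ (F δ h).cur, ∀ y ∈ (F δ h).cur, d x y = (F δ h).d x y := by
  classical
  let p : U → U → Ordinal.{0} → Prop := fun x y δ => ∃ h : δ < o, x ∈ (F δ h).cur ∧ y ∈ (F δ h).cur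
  let d : U → U → ℝ := fun x y =>
    if h : ∃ δ, p x y δ then (F h.choose h.choose_spec.1).d x y else 0
  have hd : ∀ δ h, ∀ x ∈ (F δ h).cur, ∀ y ∈ (F δ h).cur, d x y = (F δ h).d x y := by
    intro δ h x hx y hy
    have hp : ∃ δ, p x y δ := ⟨δ, h, hx, hy⟩
    change (if h : ∃ δ, p x y δ then (F h.choose h.choose_spec.1).d x y else 0) = _
    rw [dif_pos hp]
    obtain ⟨h', hx', hy'⟩ := hp.choose_spec
    rcases le_total δ hp.choose with hle | hle
    · exact (hE _ h _ h' hle).dist_eq x hx y hy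
    · exact ((hE _ h' _ h hle).dist_eq x hx' y hy').symm
  have hmem : ∀ x, x ∈ ⋃ (δ) (h : δ < o), (F δ h).cur → ∃ δ h, x ∈ (F δ h).cur := fun x hx => by
    simpa only [mem_iUnion] using hx
  have hpair : ∀ x, (∃ δ h, x ∈ (F δ h).cur) → ∀ y, (∃ δ h, y ∈ (F δ h).cur) →
      ∃ δ h, x ∈ (F δ h).cur ∧ y ∈ (F δ h).cur := by
    rintro x ⟨δ, h, hx⟩ y ⟨δ', h', hy⟩
    rcases le_total δ δ' with hle | hle
    · exact ⟨δ', h', (hE _ h _ h' hle).subset hx, hy⟩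
    · exact ⟨δ, h, hx, (hE _ h' _ h hle).subset hy⟩
  refine ⟨d, ⟨fun x hx => ?_, fun x hx y hy => ?_, fun x hx y hy z hz => ?_,
    fun x hx y hy h0 => ?_⟩, hd⟩
  · obtain ⟨δ, h, hx⟩ := hmem x hx
    rw [hd δ h x hx x hx, (hF δ h).metric.self x hx]
  · obtain ⟨δ, h, hx, hy⟩ := hpair x (hmem x hx) y (hmem y hy)
    rw [hd δ h x hx y hy, hd δ h y hy x hx, (hF δ h).metric.comm x hx y hy]
  · obtain ⟨δ, h, hx, hy⟩ := hpair x (hmem x hx) y (hmem y hy)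
    obtain ⟨δ', h', hz⟩ := hmem z hz
    rcases le_total δ δ' with hle | hle
    · have hx := (hE _ h _ h' hle).subset hx
      have hy := (hE _ h _ h' hle).subset hy
      rw [hd δ' h' x hx z hz, hd δ' h' x hx y hy, hd δ' h' y hy z hz]
      exact (hF δ' h').metric.triangle x hx y hy z hz
    · have hz := (hE _ h' _ h hle).subset hz
      rw [hd δ h x hx z hz, hd δ h x hx y hy, hd δ h y hy z hz]
      exact (hF δ h).metric.triangle x hx y hy z hz
  · obtain ⟨δ, h, hx, hy⟩ := hpair x (hmem x hx) y (hmem y hy)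
    rw [hd δ h x hx y hy] at h0
    exact (hF δ h).metric.eq_of_eq_zero x hx y hy h0

/-- A union of at most `ℵ₁ ≤ 𝔠` stages of size at most `𝔠` is small, and so is its completion; hence
both fit into `U`. -/
theorem exists_isLimit (hU : 𝔠 < #U) {o : Ordinal.{0}} (ho : 0 < o) (ho' : o ≤ Ordinal.omega 1)
    {F : ∀ δ < o, SkeinStage U} (hF : ∀ δ h, (F δ h).Good)
    (hE : ∀ δ h δ' h', δ ≤ δ' → (F δ h).Extends (F δ' h')) : ∃ P', IsLimit o F P' := by
  obtain ⟨d₀, hd₀, hdF⟩ := exists_isMetricOn_iUnion hF hE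
  set A : Set U := ⋃ (δ) (h : δ < o), (F δ h).cur with hA
  have hAcard : #A ≤ 𝔠 := by
    classical
    have hAG : A = ⋃ δ < o, if h : δ < o then (F δ h).cur else ∅ :=
      iUnion₂_congr fun δ h => by rw [dif_pos h]
    rw [hAG]
    refine mk_biUnion_le_of_le ?_ aleph0_le_continuum _ fun δ hδ => ?_
    · have := Ordinal.card_le_card ho'
      rw [← ord_aleph, card_ord] at this
      exact this.trans aleph_one_le_continuum
    · rw [dif_pos hδ]
      exact (hF δ hδ).card
  have hFA : ∀ δ h, (F δ h).cur ⊆ A := fun δ h => subset_iUnion₂_of_subset δ h Subset.rfl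
  let _ : MetricSpace A := hd₀.metricSpace
  let φ : A → UniformSpace.Completion A := (↑)
  have hφ : Isometry φ := UniformSpace.Completion.coe_isometry
  have hcl : closure (range φ) = Set.univ := UniformSpace.Completion.denseRange_coe.closure_range
  have hY : #(UniformSpace.Completion A) ≤ 𝔠 := by
    have := mk_closure_le_continuum (mk_range_le (f := φ) |>.trans hAcard)
    rwa [hcl, mk_univ] at this
  obtain ⟨e, d, he, heφ, hd⟩ := exists_realization hU hAcard hY hφ.injective
  have hsub : A ⊆ range e := fun x hx => ⟨φ ⟨x, hx⟩, heφ ⟨x, hx⟩⟩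
  have hdA : ∀ x ∈ A, ∀ y ∈ A, d x y = d₀ x y := by
    intro x hx y hy
    have := hd (φ ⟨x, hx⟩) (φ ⟨y, hy⟩)
    rwa [heφ, heφ, hφ.dist_eq] at this
  refine ⟨⟨A, range e, d⟩, rfl, fun δ h => ⟨(hFA δ h).trans hsub, fun x hx y hy => ?_⟩,
    ⟨hsub, isMetricOn_range hd, mk_range_le.trans hY,
      ((hF 0 ho).nonempty.mono (hFA 0 ho)).mono hsub⟩,
    ⟨UniformSpace.Completion A, inferInstance, inferInstance, e, rfl, hd⟩, ?_⟩
  · change d x y = _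
    rw [hdA x (hFA δ h hx) y (hFA δ h hy), hdF δ h x hx y hy]
  · rintro _ ⟨y, rfl⟩ ε hε
    obtain ⟨_, ⟨a, rfl⟩, ha⟩ := Metric.mem_closure_iff.1 (hcl ▸ Set.mem_univ y) ε hε
    refine ⟨a, a.2, ?_⟩
    change d (e y) a < ε
    rwa [← heφ a, hd]

end SkeinStage

end Stages

/-! ### Transfinite recursion and existence of skein spaces -/

section Existence

open Cardinal SkeinStage

variable (q : ℕ ≃ Ioo (0 : ℚ) 1)

open Classical in
/-- The initial stage, consisting of two points at distance `1 / 2`. -/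
noncomputable def skeinStageZero : SkeinStage (Set ℝ) where
  old := ∅
  cur := {∅, Set.univ}
  d u v := if u = v then 0 else 1 / 2

theorem skeinStageZero_good : skeinStageZero.Good where
  subset := empty_subset _
  metric :=
    { self := fun x _ => if_pos rfl
      comm := fun x _ y _ => by simp only [skeinStageZero, eq_comm]
      triangle := fun x _ y _ z _ => by
        simp only [skeinStageZero]
        split_ifs with h h1 h2 h2 h1 h2 h2 <;> norm_num
        exact h (h1.trans h2)
      eq_of_eq_zero := fun x _ y _ h => by
        by_contra hne
        simp only [skeinStageZero, if_neg hne] at h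
        norm_num at h }
  card := (Set.toFinite ({∅, Set.univ} : Set (Set ℝ))).countable.le_aleph0.trans aleph0_le_continuum
  nonempty := insert_nonempty _ _

open Classical in
/-- The stages of the construction of a skein space. -/
noncomputable def skeinStage (α : Ordinal.{0}) : SkeinStage (Set ℝ) :=
  Ordinal.limitRecOn α skeinStageZero
    -- The fallback values only make the recursion total; by `skeinStage_invariant` they do not
    -- occur up to `ω₁`.
    (fun _ P => if h : ∃ P', IsSucc q P P' then h.choose else P)
    (fun o _ F => if h : ∃ P', IsLimit o F P' then h.choose else skeinStageZero)

theorem skeinStage_zero : skeinStage q 0 = skeinStageZero := by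
  rw [skeinStage, Ordinal.limitRecOn_zero]

theorem mk_ambient : 𝔠 < #(Set ℝ) := by
  rw [mk_set, mk_real]
  exact cantor _

theorem skeinStage_isSucc {α : Ordinal.{0}} (h : (skeinStage q α).Good) :
    IsSucc q (skeinStage q α) (skeinStage q (Order.succ α)) := by
  have hex := h.exists_isSucc mk_ambient q
  have : skeinStage q (Order.succ α) = hex.choose := by
    rw [Order.succ_eq_add_one]
    unfold skeinStage at hex ⊢
    rw [Ordinal.limitRecOn_add_one, dif_pos hex]
  rw [this]
  exact hex.choose_spec

theorem skeinStage_isLimit {o : Ordinal.{0}} (ho : Order.IsSuccLimit o)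
    (ho' : o ≤ Ordinal.omega 1) (hF : ∀ δ < o, (skeinStage q δ).Good)
    (hE : ∀ δ < o, ∀ δ' < o, δ ≤ δ' → (skeinStage q δ).Extends (skeinStage q δ')) :
    IsLimit o (fun δ _ => skeinStage q δ) (skeinStage q o) := by
  have hex : ∃ P', IsLimit o (fun δ _ => skeinStage q δ) P' :=
    exists_isLimit mk_ambient ho.bot_lt ho' hF hE
  have : skeinStage q o = hex.choose := by
    unfold skeinStage at hex ⊢
    rw [Ordinal.limitRecOn_limit _ _ _ _ ho, dif_pos hex]
  rw [this]
  exact hex.choose_spec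

/-- Goodness, nesting and the description of the old points are carried through the induction
together, since the limit step needs the first two for all earlier stages. -/
theorem skeinStage_invariant {α : Ordinal.{0}} (hα : α ≤ Ordinal.omega 1) :
    (skeinStage q α).Good ∧ (∀ δ ≤ α, (skeinStage q δ).Extends (skeinStage q α)) ∧
      (skeinStage q α).old = ⋃ δ < α, (skeinStage q δ).cur := by
  induction α using Ordinal.limitRecOn with
  | zero =>
    refine ⟨?_, ?_, ?_⟩
    · rw [skeinStage_zero]
      exact skeinStageZero_good
    · intro δ hδ
      rw [nonpos_iff_eq_zero.1 hδ]
      exact Extends.refl _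
    · rw [skeinStage_zero]
      simp [skeinStageZero]
  | add_one α ih =>
    rw [← Order.succ_eq_add_one] at hα ⊢
    obtain ⟨ih1, ih2, -⟩ := ih ((Order.le_succ α).trans hα)
    have hs := skeinStage_isSucc q ih1
    refine ⟨hs.good, fun δ hδ => ?_, ?_⟩
    · rcases Order.le_succ_iff_eq_or_le.1 hδ with rfl | hδ
      · exact Extends.refl _
      · exact (ih2 δ hδ).trans hs.isExtension
    · rw [hs.old_eq]
      refine subset_antisymm (subset_iUnion₂_of_subset α (Order.lt_succ α) Subset.rfl)
        (iUnion₂_subset fun δ hδ => (ih2 δ (Order.lt_succ_iff.1 hδ)).subset)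
  | limit α hlim ih =>
    have hl := skeinStage_isLimit q hlim hα (fun δ hδ => (ih δ hδ (hδ.le.trans hα)).1)
      fun δ _ δ' hδ' hle => (ih δ' hδ' (hδ'.le.trans hα)).2.1 δ hle
    refine ⟨hl.good, fun δ hδ => ?_, hl.old_eq⟩
    rcases hδ.eq_or_lt with rfl | hδ
    · exact Extends.refl _
    · exact hl.isExtension δ hδ

theorem exists_isSkeinSpace :
    ∃ (M : Type) (_ : MetricSpace M), IsSkeinSpace q (Ordinal.omega 1) M := by
  classical
  set C : SkeinStage (Set ℝ) := skeinStage q (Ordinal.omega 1) with hC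
  obtain ⟨hgood, hext, -⟩ := skeinStage_invariant q le_rfl
  rw [← hC] at hgood hext
  let _ : MetricSpace C.cur := hgood.metric.metricSpace
  have : Inhabited C.cur := ⟨hgood.nonempty.some, hgood.nonempty.some_mem⟩
  -- The values of `k` outside `C.cur` are irrelevant; `k` turns the ambient stages into subsets of
  -- the final metric space.
  let k : Set ℝ → C.cur := fun u => if h : u ∈ C.cur then ⟨u, h⟩ else default
  have hk : ∀ u (h : u ∈ C.cur), k u = ⟨u, h⟩ := fun u h => dif_pos h
  let Sk : Ordinal.{0} → Set C.cur := fun α => Subtype.val ⁻¹' (skeinStage q α).cur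
  have himage : ∀ S ⊆ C.cur, k '' S = Subtype.val ⁻¹' S := by
    intro S hS
    ext x
    constructor
    · rintro ⟨u, hu, rfl⟩
      rw [mem_preimage, hk u (hS hu)]
      exact hu
    · intro hx
      exact ⟨x, hx, hk x x.2⟩
  have hold : ∀ α ≤ Ordinal.omega 1,
      Subtype.val ⁻¹' (skeinStage q α).old = ⋃ δ < α, Sk δ := by
    intro α hα
    rw [(skeinStage_invariant q hα).2.2]
    simp only [preimage_iUnion, Sk]
  have hdist : ∀ α ≤ Ordinal.omega 1, ∀ x ∈ (skeinStage q α).cur, ∀ y ∈ (skeinStage q α).cur,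
      dist (k x) (k y) = (skeinStage q α).d x y := by
    intro α hα x hx y hy
    rw [hk x ((hext α hα).subset hx), hk y ((hext α hα).subset hy)]
    exact (hext α hα).dist_eq x hx y hy
  refine ⟨C.cur, inferInstance, Sk, ⟨?_, fun α hα => ?_, fun α hα hlim => ?_, ?_⟩⟩
  · have hsub := (hext 0 zero_le).subset
    have hd := hdist 0 zero_le
    have him := himage _ hsub
    rw [skeinStage_zero] at hd him hsub
    refine ⟨k ∅, k Set.univ, ?_, ?_⟩
    · rw [hd _ (Or.inl rfl) _ (Or.inr rfl)]
      exact if_neg empty_ne_univ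
    · change Subtype.val ⁻¹' (skeinStage q 0).cur = _
      rw [skeinStage_zero, ← him, ← image_pair]
      rfl
  · have hs := skeinStage_isSucc q (skeinStage_invariant q hα.le).1
    obtain ⟨A, B, f, hf⟩ := hs.threads
    have hsucc := Order.succ_le_of_lt hα
    have hinj : InjOn k (skeinStage q (Order.succ α)).cur := by
      intro u hu v hv h
      rw [hk u ((hext _ hsucc).subset hu), hk v ((hext _ hsucc).subset hv)] at h
      exact congrArg Subtype.val h
    obtain ⟨A', B', f', hf'⟩ := hf.image (d' := dist) (skeinStage_invariant q hα.le).1.subset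
      hinj (hdist _ hsucc)
    rw [himage _ (hext α hα.le).subset, himage _ (hext _ hsucc).subset,
      himage _ ((skeinStage_invariant q hα.le).1.subset.trans (hext α hα.le).subset),
      hold α hα.le] at hf'
    exact hf'.isSkeinSucc
  · have hl := skeinStage_isLimit q hlim hα
      (fun δ hδ => (skeinStage_invariant q (hδ.le.trans hα)).1)
      fun δ _ δ' hδ' hle => (skeinStage_invariant q (hδ'.le.trans hα)).2.1 δ hle
    refine ⟨?_, ?_, ?_⟩
    · obtain ⟨Y, _, _, e, he, hd⟩ := hl.complete
      have hmem : ∀ y, e y ∈ (skeinStage q α).cur := fun y => he ▸ mem_range_self y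
      have hiso : Isometry (k ∘ e) := Isometry.of_dist_eq fun y y' =>
        (hdist α hα _ (hmem y) _ (hmem y')).trans (hd y y')
      have : Sk α = range (k ∘ e) := by
        rw [range_comp, he, himage _ (hext α hα).subset]
      rw [this]
      exact hiso.isUniformInducing.isComplete_range
    · rw [← hold α hα]
      exact preimage_mono hl.good.subset
    · rw [← hold α hα]
      intro x hx
      refine Metric.mem_closure_iff.2 fun ε hε => ?_
      obtain ⟨y, hy, hxy⟩ := hl.dense x hx ε hε
      have hy' := (hext α hα).subset (hl.good.subset hy)
      refine ⟨⟨y, hy'⟩, hy, ?_⟩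
      rw [← (hext α hα).dist_eq x hx y (hl.good.subset hy)] at hxy
      exact hxy
  · exact eq_univ_of_forall fun x => x.2

end Existence

end

theorem theoremA (q : ℕ ≃ Ioo (0 : ℚ) 1) :
    (∃ (M : Type) (_ : MetricSpace M), IsSkeinSpace q (Ordinal.omega 1) M) ∧
    ∀ (M : Type) [MetricSpace M], IsSkeinSpace q (Ordinal.omega 1) M →
      CompleteSpace M ∧ Cardinal.mk M = Cardinal.continuum ∧
      ∀ S : Set M, IsClosed S → TopologicalSpace.IsSeparable S → (∀ x, S ≠ {x}) →
        ¬ IsLipschitzRetract S := by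
  exact ⟨exists_isSkeinSpace q, fun M _ ⟨Sk, h⟩ => ⟨h.completeSpace, h.mk_eq_continuum,
    fun S _ hS hne => h.not_isLipschitzRetract hS hne⟩⟩
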